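/- Let $a<b$, let $\kappa_1,\kappa_2:[a,b]\to\mathbb R$ be Lipschitz with $\kappa_1<\kappa_2$ on $(a,b)$, and let $\Omega=\{x\in\mathbb R^2:\ a<x_1<b,\ \kappa_1(x_1)<x_2<\kappa_2(x_1)\}$ (a domain which is normal with respect to the $x_2$-axis). Let $\hat\Omega\subset\mathbb R^2$ be a bounded open set which contains $\Omega$ and the vertical sides $\{a\}\times(\kappa_1(a),\kappa_2(a))$ and $\{b\}\times(\kappa_1(b),\kappa_2(b))$; for instance $\Omega=(-1,1)\times(-1,1)$ and $\hat\Omega=(-2,2)\times(-1,1)$. Let $u_0:\mathbb R^2\to\mathbb R$ be Lipschitz. Let $A:[0,\infty)\to[0,\infty)$ be continuous, strictly increasing and convex with $\lim_{t\downarrow0}A(t)/t=0$, $\lim_{t\to\infty}A(t)/t=\infty$ and, for some $k,t_0>0$, $A(2t)\le kA(t)$ for all $t\ge t_0$; let $L_A(\Omega)$ be the space of measurable functions $v$ on $\Omega$ with $\int_\Omega A(\lambda|v|)\,dx<\infty$ for some $\lambda>0$. Let $f_2:\mathbb R\to\mathbb R$ be convex and suppose that there are $b_1>0$, $b_2\ge0$,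 $c_3>0$ such that for all $t,\hat t\in\mathbb R$ $$b_1A(|t|)-b_2\le f_2(t),\qquad f_2(t+\hat t)\le c_3\big[f_2(t)+f_2(\hat t)\big].$$ Let $w\in BV(\Omega)$ be such that the distributional derivative $\partial_2w$ is a function in $L_A(\Omega)$ and such that $(w-u_0)\nu_2=0$ holds $\mathcal H^1$-a.e. on $\partial\Omega$, where $w$ stands for its trace and $\nu$ for the outward unit normal. For a function $v$ on $\Omega$ let $\hat v=v$ on $\Omega$ and $\hat v=u_0$ on $\hat\Omega\setminus\Omega$. Then there is a sequence $(w_m)$ in $u_0+C_0^\infty(\Omega)$ such that, as $m\to\infty$, 1. $\hat w_m\to\hat w$ in $L^1(\hat\Omega)$; 2. $\displaystyle\int_{\hat\Omega}\sqrt{1+|\nabla\hat w_m|^2}\,dx\to\int_{\hat\Omega}\sqrt{1+|\nabla\hat w|^2}$, where the right-hand side is understood in the sense of a convex function of the measure $\nabla\hat w$, that is, as the supremum of $-\int_{\hat\Omega}\hat w\operatorname{div}\eta\,dx+\int_{\hat\Omega}\sqrt{1-|\eta|^2}\,dx$ over all $\eta\in C_0^\infty(\hat\Omega;\mathbb R^2)$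 with $|\eta|\le1$; 3. $\displaystyle\int_\Omega f_2(\partial_2w_m)\,dx\to\int_\Omega f_2(\partial_2w)\,dx$ in $[0,\infty]$ (the hypotheses imply $f_2\ge0$). -/

import Mathlib

open MeasureTheory Filter Topology Set
open scoped NNReal ENNReal

namespace SplitBV

/-- The Euclidean plane. The coordinates `x_1`, `x_2` of the mathematics are `x 0`, `x 1`. -/
abbrev Plane : Type := EuclideanSpace ℝ (Fin 2)

/-- The points over `I` between the graphs of `κ₁` and `κ₂`. With `I = (a,b)` this is the domain
which is normal with respect to the `x_2`-axis. -/
def between (I : Set ℝ) (κ₁ κ₂ : ℝ → ℝ) : Set Plane :=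
  {x | x 0 ∈ I ∧ κ₁ (x 0) < x 1 ∧ x 1 < κ₂ (x 0)}

/-- The classical partial derivative `∂_i φ`. -/
noncomputable def pderiv (i : Fin 2) (φ : Plane → ℝ) (x : Plane) : ℝ :=
  fderiv ℝ φ x (EuclideanSpace.single i 1)

/-- The divergence of a differentiable vector field. -/
noncomputable def divergence (η : Plane → Plane) (x : Plane) : ℝ :=
  ∑ i : Fin 2, pderiv i (fun y => η y i) x

/-- `φ ∈ C_0^∞(U; F)`: smooth with compact support contained in `U`. -/
structure IsTest {F : Type*} [NormedAddCommGroup F] [NormedSpace ℝ F]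
    (U : Set Plane) (φ : Plane → F) : Prop where
  smooth : ContDiff ℝ ((⊤ : ℕ∞) : WithTop ℕ∞) φ
  hasCompactSupport : HasCompactSupport φ
  tsupport_subset : tsupport φ ⊆ U

/-- The distributional derivative `∂_i w` on the open set `U` is the locally integrable
function `g`. -/
structure IsWeakPartial (U : Set Plane) (i : Fin 2) (w g : Plane → ℝ) : Prop where
  locallyIntegrable : LocallyIntegrableOn w U
  locallyIntegrable_deriv : LocallyIntegrableOn g U
  integral_eq : ∀ φ : Plane → ℝ, IsTest U φ →
    ∫ x in U, w x * pderiv i φ x = -∫ x in U, g x * φ x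

/-- The total variation `|Dw|(U)`. -/
noncomputable def variation (U : Set Plane) (w : Plane → ℝ) : ℝ≥0∞ :=
  ⨆ (η : Plane → Plane) (_ : IsTest U η) (_ : ∀ x, ‖η x‖ ≤ 1),
    ENNReal.ofReal (∫ x in U, w x * divergence η x)

/-- `w ∈ BV(U)`. -/
structure MemBV (U : Set Plane) (w : Plane → ℝ) : Prop where
  integrable : IntegrableOn w U
  variation_lt_top : variation U w < ⊤

/-- The area functional `∫_U √(1 + |∇w|²)` of a function `w ∈ BV(U)`, in the sense of a convex
function `g` of the measure `∇w`:
`sup { -∫_U w div η dx - ∫_U g^*(η) dx : η ∈ C_0^∞(U; ℝ²), |η| ≤ 1 }`, where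
`g(ξ) = √(1 + |ξ|²)` has the conjugate `g^*(η) = -√(1 - |η|²)` on `|η| ≤ 1`.
The choice `η = 0` shows that negative competitors do not matter. -/
noncomputable def area (U : Set Plane) (w : Plane → ℝ) : ℝ≥0∞ :=
  ⨆ (η : Plane → Plane) (_ : IsTest U η) (_ : ∀ x, ‖η x‖ ≤ 1),
    ENNReal.ofReal (-(∫ x in U, w x * divergence η x) + ∫ x in U, √(1 - ‖η x‖ ^ 2))

/-- `t` is the value at the boundary point `x` of the trace of `w ∈ BV(U)`:
`ρ^{-2} ∫_{U ∩ B_ρ(x)} |w - t| dy → 0` as `ρ ↓ 0`. -/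
def HasTraceAt (U : Set Plane) (w : Plane → ℝ) (x : Plane) (t : ℝ) : Prop :=
  Tendsto (fun ρ : ℝ => (ρ ^ 2)⁻¹ * ∫ y in U ∩ Metric.ball x ρ, |w y - t|) (𝓝[>] 0) (𝓝 0)

/-- `ν` is the (measure theoretic) outward unit normal to `U` at the boundary point `x`: blown
up at `x`, the set `U` becomes the half-plane `{y | (y - x) · ν < 0}`. -/
structure IsOuterNormal (U : Set Plane) (x ν : Plane) : Prop where
  norm_eq_one : ‖ν‖ = 1
  outside : Tendsto (fun ρ : ℝ => (ρ ^ 2)⁻¹ *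
    volume.real (Metric.ball x ρ ∩ U ∩ {y | 0 < inner ℝ (y - x) ν})) (𝓝[>] 0) (𝓝 0)
  inside : Tendsto (fun ρ : ℝ => (ρ ^ 2)⁻¹ *
    volume.real ((Metric.ball x ρ \ U) ∩ {y | inner ℝ (y - x) ν < 0})) (𝓝[>] 0) (𝓝 0)

/-- `(w - u₀) ν_2 = 0` holds `ℋ¹`-almost everywhere on `∂U`, where `w` stands for its trace.
For a `BV` function on a Lipschitz domain the trace and the normal exist and are unique at
`ℋ¹`-almost every boundary point; their existence is not part of the condition. -/
def VerticalBoundaryCondition (U : Set Plane) (w u₀ : Plane → ℝ) : Prop :=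
  ∀ᵐ x ∂((Measure.hausdorffMeasure 1 : Measure Plane).restrict (frontier U)),
    ∀ (t : ℝ) (ν : Plane), HasTraceAt U w x t → IsOuterNormal U x ν → (t - u₀ x) * ν 1 = 0

/-- `N`-functions `A : [0,∞) → [0,∞)` with a `Δ_2`-condition near infinity. Only the values of
`A` on `[0,∞)` matter. -/
structure IsNFunction (A : ℝ → ℝ) : Prop where
  nonneg : ∀ t, 0 ≤ t → 0 ≤ A t
  continuousOn : ContinuousOn A (Ici 0)
  strictMonoOn : StrictMonoOn A (Ici 0)
  convexOn : ConvexOn ℝ (Ici 0) A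
  tendsto_zero : Tendsto (fun t => A t / t) (𝓝[>] 0) (𝓝 0)
  tendsto_top : Tendsto (fun t => A t / t) atTop atTop
  delta_two : ∃ k t₀ : ℝ, 0 < k ∧ 0 < t₀ ∧ ∀ t, t₀ ≤ t → A (2 * t) ≤ k * A t

/-- `v` belongs to the Orlicz space `L_A(U)`. -/
structure MemOrlicz (A : ℝ → ℝ) (U : Set Plane) (v : Plane → ℝ) : Prop where
  aestronglyMeasurable : AEStronglyMeasurable v (volume.restrict U)
  lintegral_lt_top : ∃ l : ℝ, 0 < l ∧ ∫⁻ x in U, ENNReal.ofReal (A (l * |v x|)) < ⊤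

open Classical in
/-- The extension `ŵ` of `w : U → ℝ` by `u₀`: `w` on `U`, and `u₀` elsewhere. -/
noncomputable def extend (U : Set Plane) (u₀ w : Plane → ℝ) (x : Plane) : ℝ :=
  if x ∈ U then w x else u₀ x

/-- `w ∈ u₀ + C_0^∞(U)`. -/
def MemAddTest (U : Set Plane) (u₀ w : Plane → ℝ) : Prop :=
  ∃ φ : Plane → ℝ, IsTest U φ ∧ ∀ x ∈ U, w x = u₀ x + φ x

/-- A density `f₂` with the quasi-triangle inequality and a lower bound by an `N`-function is
nonnegative. -/
theorem density_nonneg {A f₂ : ℝ → ℝ} (hA : IsNFunction A) {b₁ b₂ c₃ : ℝ} (hb₁ : 0 < b₁)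
    (hlow : ∀ t, b₁ * A |t| - b₂ ≤ f₂ t) (hc₃ : 0 < c₃)
    (htri : ∀ t s, f₂ (t + s) ≤ c₃ * (f₂ t + f₂ s)) (t : ℝ) : 0 ≤ f₂ t := by
  have hlarge : ∃ T : ℝ, 0 < T ∧ ∀ s, T ≤ |s| → 0 < f₂ s := by
    obtain ⟨T, hT⟩ := eventually_atTop.1
      ((hA.tendsto_top.eventually_ge_atTop ((|b₂| + 1) / b₁)).and (eventually_ge_atTop (1 : ℝ)))
    refine ⟨max T 1, by positivity, fun s hs => ?_⟩
    obtain ⟨h1, h2⟩ := hT |s| ((le_max_left _ _).trans hs)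
    rw [div_le_div_iff₀ hb₁ (by linarith)] at h1
    have h3 := hlow s
    have h4 := le_abs_self b₂
    nlinarith [abs_nonneg b₂]
  obtain ⟨T, hT, hpos⟩ := hlarge
  by_contra! hneg
  by_cases ht : t = 0
  · subst ht
    have h0 := htri 0 0
    have h1 := htri T 0
    have h2 := hpos T (le_abs_self T)
    simp only [add_zero] at h0 h1
    have hc : c₃ ≤ 1 / 2 := by
      by_contra! h
      nlinarith
    nlinarith
  · have hk : ∀ k : ℕ, f₂ (2 ^ k * t) < 0 := by
      intro k
      induction k with
      | zero => simpa using hneg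
      | succ k ih =>
        have h := htri (2 ^ k * t) (2 ^ k * t)
        have h' : (2 : ℝ) ^ (k + 1) * t = 2 ^ k * t + 2 ^ k * t := by ring
        rw [h']
        nlinarith
    obtain ⟨k, hk'⟩ := pow_unbounded_of_one_lt (T / |t|) (one_lt_two)
    have ht' : 0 < |t| := abs_pos.2 ht
    have h := hpos (2 ^ k * t) (by
      rw [abs_mul, abs_of_pos (by positivity : (0 : ℝ) < 2 ^ k)]
      rw [div_lt_iff₀ ht'] at hk'
      exact hk'.le)
    exact absurd (hk k) (not_lt.2 h.le)

/-- The energy `E[v] = ∫_U f₂(v) dx ∈ [0,∞]` for a nonnegative density `f₂`. -/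
noncomputable def energy (f₂ : ℝ → ℝ) (U : Set Plane) (v : Plane → ℝ) : ℝ≥0∞ :=
  ∫⁻ x in U, ENNReal.ofReal (f₂ (v x))

end SplitBV

open SplitBV

/-! Let v be w - u₀ on Ω, extended by zero. The normal of a Lipschitz graph has ν_2 ≠ 0 at almost
every point, so the boundary condition makes v vanish on both graphs and leaves it free on the
vertical sides. Hence v is the vertical primitive of G = ∂_2 w - ∂_2 u₀ (zero off Ω), and almost
every vertical section of G has integral zero (`exists_primitive`). Consequently ∂_2 v = G on the
whole plane, and the singular part of ∇v lies in ∂_1 v alone. It may charge the vertical sides,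
which Ω' contains, so that the area functional sees it.

The approximation has two stages. A cutoff β which vanishes near the graphs creates the term v ∂β.
Where β varies, on strips of width 4ε, v / (4ε) is up to sign the average of G over a vertical
segment that reaches the graph. Jensen's inequality therefore controls v ∂β, in L¹ and in the
energy, by integrals over thin neighbourhoods of the graphs (`exists_cutoff_approx`). Next, β v is
mollified on the scale r and composed with the dilation of factor l = 1 + 4r / (b - a) in x_1, which
pulls the support into Ω (`isTest_moll_dil`). This dilation leaves ∂_2 without any factor, so
Jensen's inequality and L¹ convergence bound the energy (`eventually_energy_moll_dil_le`).

The area is bounded from above by duality. On Ω the field η which is optimal for ∇(u₀ + φ) is taken,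
and mollification, dilation and cutoff are transposed onto it. The result is a smooth field with
values in the unit disc, supported in a slightly widened core of Ω (`interior_area_le`). For small r
this support lies in Ω' and is disjoint from that of an almost optimal field for ∇u₀ outside the
closure of Ω (`exists_exterior_field`). The sum of both fields competes in the supremum which
defines the area of ŵ (`le_area`, `eventually_area_le`).

The reverse inequalities are semicontinuity statements. The area is a supremum of L¹-continuous
functionals (`tendsto_area`), and Fatou's lemma serves for the energy
(`tendsto_lintegral_of_upper_bound`). The errors 1 / (m + 1) in `exists_test_approx` give the
sequence. -/

namespace SplitBV

/-! ### Mollification: derivatives, supports, duality. -/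

/-- The mollification of `h` with the kernel given by a bump function. -/
noncomputable def moll (ρ : ContDiffBump (0 : Plane)) (h : Plane → ℝ) (x : Plane) : ℝ :=
  ∫ y, ρ.normed volume (x - y) * h y

section Moll

variable (ρ : ContDiffBump (0 : Plane))

theorem moll_eq_convolution (h : Plane → ℝ) :
    moll ρ h = convolution (ρ.normed volume) h (ContinuousLinearMap.lsmul ℝ ℝ) volume := by
  ext x
  rw [convolution_lsmul_swap]
  rfl

theorem contDiff_normed_top : ContDiff ℝ ((⊤ : ℕ∞) : WithTop ℕ∞) (ρ.normed volume) :=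
  ρ.contDiff_normed

theorem contDiff_moll {h : Plane → ℝ} (hh : LocallyIntegrable h) :
    ContDiff ℝ ((⊤ : ℕ∞) : WithTop ℕ∞) (moll ρ h) := by
  rw [moll_eq_convolution]
  exact ρ.hasCompactSupport_normed.contDiff_convolution_left _ (contDiff_normed_top ρ) hh

theorem continuous_pderiv {φ : Plane → ℝ} (hφ : ContDiff ℝ ((⊤ : ℕ∞) : WithTop ℕ∞) φ) (i : Fin 2) :
    Continuous (pderiv i φ) :=
  (hφ.continuous_fderiv (by simp)).clm_apply continuous_const

theorem hasCompactSupport_pderiv {φ : Plane → ℝ} (hφ : HasCompactSupport φ) (i : Fin 2) :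
    HasCompactSupport (pderiv i φ) :=
  (hφ.fderiv (𝕜 := ℝ)).comp_left (g := fun T : Plane →L[ℝ] ℝ => T (EuclideanSpace.single i 1)) rfl

theorem pderiv_eq_zero_of_notMem_tsupport {φ : Plane → ℝ} {x : Plane} (hx : x ∉ tsupport φ)
    (i : Fin 2) : pderiv i φ x = 0 := by
  have : fderiv ℝ φ x = 0 := by
    by_contra h
    exact hx (support_fderiv_subset ℝ h)
  simp [pderiv, this]

theorem pderiv_moll {h : Plane → ℝ} (hh : LocallyIntegrable h) (i : Fin 2) (x : Plane) :
    pderiv i (moll ρ h) x = ∫ y, pderiv i (ρ.normed volume) (x - y) * h y := by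
  have h1 := ρ.hasCompactSupport_normed.hasFDerivAt_convolution_left (𝕜 := ℝ) (μ := volume)
    (ContinuousLinearMap.lsmul ℝ ℝ) ((contDiff_normed_top ρ).of_le (by simp)) hh x
  rw [pderiv, moll_eq_convolution, h1.fderiv]
  have h2 : ConvolutionExistsAt (fderiv ℝ (ρ.normed volume)) h x
      ((ContinuousLinearMap.lsmul ℝ ℝ).precompL Plane) volume :=
    HasCompactSupport.convolutionExists_left _ (ρ.hasCompactSupport_normed.fderiv ℝ)
      ((contDiff_normed_top ρ).continuous_fderiv (by simp)) hh x
  rw [convolution_eq_swap] 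
  have h3 : Integrable (fun t => ((ContinuousLinearMap.lsmul ℝ ℝ).precompL Plane
      (fderiv ℝ (ρ.normed volume) (x - t))) (h t)) := by
    exact h2.integrable_swap
  rw [ContinuousLinearMap.integral_apply h3]
  rfl

theorem moll_eq_zero {h : Plane → ℝ} {S : Set Plane} (hS : ∀ y, y ∉ S → h y = 0) {x : Plane}
    (hx : ∀ y ∈ S, ρ.rOut ≤ dist x y) : moll ρ h x = 0 := by
  have : ∀ y, ρ.normed volume (x - y) * h y = 0 := by
    intro y
    by_cases hy : y ∈ S
    · have : x - y ∉ Function.support (ρ.normed volume) := by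
        rw [ρ.support_normed_eq, Metric.mem_ball, dist_zero_right, ← dist_eq_norm, not_lt]
        exact hx y hy
      rw [Function.notMem_support.1 this, zero_mul]
    · rw [hS y hy, mul_zero]
  simp [moll, this]

theorem tsupport_moll_subset {h : Plane → ℝ} {S : Set Plane} (hS : ∀ y, y ∉ S → h y = 0) :
    tsupport (moll ρ h) ⊆ Metric.cthickening ρ.rOut S := by
  refine closure_minimal (fun x hx => ?_) Metric.isClosed_cthickening
  by_contra hx'
  refine hx (moll_eq_zero ρ hS fun y hy => ?_)
  by_contra! hlt
  exact hx' (Metric.mem_cthickening_of_dist_le x y _ _ hy hlt.le)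

theorem hasCompactSupport_moll {h : Plane → ℝ} {S : Set Plane} (hS : ∀ y, y ∉ S → h y = 0)
    (hb : Bornology.IsBounded S) : HasCompactSupport (moll ρ h) :=
  Metric.isCompact_of_isClosed_isBounded (isClosed_tsupport _)
    (hb.cthickening.subset (tsupport_moll_subset ρ hS))

theorem isTest_moll {h : Plane → ℝ} {S U : Set Plane} (hh : LocallyIntegrable h)
    (hS : ∀ y, y ∉ S → h y = 0) (hb : Bornology.IsBounded S)
    (hU : Metric.cthickening ρ.rOut S ⊆ U) : IsTest U (moll ρ h) :=
  ⟨contDiff_moll ρ hh, hasCompactSupport_moll ρ hS hb, (tsupport_moll_subset ρ hS).trans hU⟩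

theorem normed_sub_comm (x y : Plane) :
    ρ.normed volume (x - y) = ρ.normed volume (y - x) := by
  rw [← ρ.normed_neg, neg_sub]

theorem pderiv_normed_neg (i : Fin 2) (x : Plane) :
    pderiv i (ρ.normed volume) (-x) = -pderiv i (ρ.normed volume) x := by
  have h1 : (fun y => ρ.normed volume (-y)) = ρ.normed volume := by
    ext y; exact ρ.normed_neg y
  have h2 : fderiv ℝ (fun y => ρ.normed volume (-y)) x = -fderiv ℝ (ρ.normed volume) (-x) := by
    have hd : DifferentiableAt ℝ (ρ.normed volume) (-x) :=
      (contDiff_normed_top ρ).differentiable (by simp) _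
    have h3 := (hd.hasFDerivAt.comp x (hasFDerivAt_id x).neg).fderiv
    ext v
    have h4 := congrArg (fun T : Plane →L[ℝ] ℝ => T v) h3
    simpa [Function.comp_def] using h4
  rw [h1] at h2
  simp [pderiv, h2]

theorem pderiv_normed_sub (i : Fin 2) (x y : Plane) :
    pderiv i (fun y => ρ.normed volume (x - y)) y = -pderiv i (ρ.normed volume) (x - y) := by
  have h1 : (fun y => ρ.normed volume (x - y)) = fun y => ρ.normed volume (y - x) := by
    ext y; exact normed_sub_comm ρ x y
  have h2 : fderiv ℝ (fun y => ρ.normed volume (y - x)) y = fderiv ℝ (ρ.normed volume) (y - x) := by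
    rw [fderiv_comp_sub]
  rw [h1, ← pderiv_normed_neg, neg_sub, pderiv, h2, pderiv]

theorem isTest_normed_sub {x : Plane} {U : Set Plane} (hU : Metric.closedBall x ρ.rOut ⊆ U) :
    IsTest U (fun y => ρ.normed volume (x - y)) := by
  have hs : tsupport (fun y => ρ.normed volume (x - y)) ⊆ Metric.closedBall x ρ.rOut := by
    refine closure_minimal (fun y hy => ?_) Metric.isClosed_closedBall
    have : x - y ∈ Function.support (ρ.normed volume) := hy
    rw [ρ.support_normed_eq, Metric.mem_ball, dist_zero_right, ← dist_eq_norm, dist_comm] at this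
    exact this.le
  exact ⟨(contDiff_normed_top ρ).comp (contDiff_const.sub contDiff_id),
    Metric.isCompact_of_isClosed_isBounded (isClosed_tsupport _)
      (Metric.isBounded_closedBall.subset hs), hs.trans hU⟩

/-- The kernel y ↦ ρ(x - y) is itself a test function on U as soon as its closed ball lies in U, so
the weak derivative can be tested with it. -/
theorem pderiv_moll_of_weak {U : Set Plane} {h H : Plane → ℝ} {i : Fin 2}
    (hh : LocallyIntegrable h) {x : Plane} (hU : Metric.closedBall x ρ.rOut ⊆ U)
    (hw : ∀ φ, IsTest U φ → ∫ y, h y * pderiv i φ y = -∫ y, H y * φ y) :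
    pderiv i (moll ρ h) x = moll ρ H x := by
  have h1 := hw _ (isTest_normed_sub ρ hU)
  simp only [pderiv_normed_sub, mul_neg, integral_neg, neg_inj] at h1
  rw [pderiv_moll ρ hh, moll]
  simpa only [mul_comm] using h1

/-- Fubini for a general kernel, so that it serves both ρ, which is even and makes mollification
symmetric, and ∂_i ρ, which is odd and produces the minus sign of an integration by parts. -/
theorem integral_kernel_swap {K : Plane → ℝ} (hK : Continuous K) (hKc : HasCompactSupport K)
    {h q : Plane → ℝ} (hh : Integrable h) (hq : Integrable q) :
    ∫ x, (∫ y, K (x - y) * h y) * q x = ∫ y, h y * ∫ x, K (x - y) * q x := by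
  obtain ⟨C, hC⟩ := hK.bounded_above_of_compact_support hKc
  have hint : Integrable (fun p : Plane × Plane => K (p.1 - p.2) * h p.2 * q p.1)
      (volume.prod volume) := by
    have h1 : Integrable (fun p : Plane × Plane => q p.1 * h p.2) (volume.prod volume) :=
      hq.mul_prod hh
    refine (h1.bdd_mul (c := C) (f := fun p : Plane × Plane => K (p.1 - p.2)) ?_ ?_).congr ?_
    · exact (hK.comp (continuous_fst.sub continuous_snd)).aestronglyMeasurable
    · exact Eventually.of_forall fun p => hC _
    · exact Eventually.of_forall fun p => by ring
  simp_rw [← integral_mul_const, ← integral_const_mul]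
  rw [integral_integral_swap hint]
  congr 1; ext y; congr 1; ext x; ring

theorem integral_moll_mul {h q : Plane → ℝ} (hh : Integrable h) (hq : Integrable q) :
    ∫ x, moll ρ h x * q x = ∫ x, h x * moll ρ q x := by
  have := integral_kernel_swap (ρ.continuous_normed (μ := volume)) ρ.hasCompactSupport_normed hh hq
  simp only [moll]
  rw [this]
  simp_rw [normed_sub_comm ρ]

theorem integral_pderiv_moll_mul {h q : Plane → ℝ} (hh : Integrable h) (hq : Integrable q)
    (i : Fin 2) :
    ∫ x, pderiv i (moll ρ h) x * q x = -∫ x, h x * pderiv i (moll ρ q) x := by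
  have := integral_kernel_swap (continuous_pderiv (contDiff_normed_top ρ) i)
    (hasCompactSupport_pderiv ρ.hasCompactSupport_normed i) hh hq
  simp only [pderiv_moll ρ hh.locallyIntegrable, pderiv_moll ρ hq.locallyIntegrable]
  rw [this, ← integral_neg]
  congr 1; ext y
  rw [← mul_neg, ← integral_neg]
  congr 2; ext x
  rw [← neg_sub, pderiv_normed_neg]
  ring

theorem integrable_moll {h : Plane → ℝ} (hh : Integrable h) : Integrable (moll ρ h) := by
  rw [moll_eq_convolution]
  exact ρ.integrable_normed.integrable_convolution _ hh

theorem integrable_kernel_mul {h : Plane → ℝ} (hh : LocallyIntegrable h) (x : Plane) :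
    Integrable (fun y => ρ.normed volume (x - y) * h y) := by
  have h2 : ConvolutionExistsAt (ρ.normed volume) h x (ContinuousLinearMap.lsmul ℝ ℝ) volume :=
    HasCompactSupport.convolutionExists_left _ ρ.hasCompactSupport_normed ρ.continuous_normed hh x
  exact h2.integrable_swap

theorem moll_sub {h q : Plane → ℝ} (hh : LocallyIntegrable h) (hq : LocallyIntegrable q) :
    moll ρ (h - q) = moll ρ h - moll ρ q := by
  ext x
  simp only [moll, Pi.sub_apply, mul_sub]
  exact integral_sub (integrable_kernel_mul ρ hh x) (integrable_kernel_mul ρ hq x)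

/-- The probability measure `ρ(x - y) dy`. -/
noncomputable def mollMeasure (x : Plane) : Measure Plane :=
  volume.withDensity fun y => ENNReal.ofReal (ρ.normed volume (x - y))

theorem measurable_kernel (x : Plane) :
    Measurable fun y => ENNReal.ofReal (ρ.normed volume (x - y)) :=
  (ρ.continuous_normed.comp (continuous_const.sub continuous_id)).measurable.ennreal_ofReal

instance (x : Plane) : IsProbabilityMeasure (mollMeasure ρ x) := by
  constructor
  rw [mollMeasure, withDensity_apply _ MeasurableSet.univ, setLIntegral_univ,
    ← ofReal_integral_eq_lintegral_ofReal]
  · rw [integral_sub_left_eq_self (fun y => ρ.normed volume y), ρ.integral_normed,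
      ENNReal.ofReal_one]
  · exact ρ.integrable_normed.comp_sub_left x
  · exact Eventually.of_forall fun y => ρ.nonneg_normed _

theorem integral_mollMeasure {F : Type*} [NormedAddCommGroup F] [NormedSpace ℝ F]
    (h : Plane → F) (x : Plane) :
    ∫ y, h y ∂(mollMeasure ρ x) = ∫ y, ρ.normed volume (x - y) • h y := by
  rw [mollMeasure, integral_withDensity_eq_integral_toReal_smul (measurable_kernel ρ x)
    (Eventually.of_forall fun y => ENNReal.ofReal_lt_top)]
  simp_rw [ENNReal.toReal_ofReal (ρ.nonneg_normed _)]

theorem moll_eq_integral (h : Plane → ℝ) (x : Plane) : moll ρ h x = ∫ y, h y ∂(mollMeasure ρ x) := by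
  rw [integral_mollMeasure]; rfl

theorem integrable_mollMeasure {h : Plane → ℝ} (hh : LocallyIntegrable h) (x : Plane) :
    Integrable h (mollMeasure ρ x) := by
  rw [mollMeasure, integrable_withDensity_iff_integrable_smul' (measurable_kernel ρ x)
    (Eventually.of_forall fun y => ENNReal.ofReal_lt_top)]
  simp_rw [ENNReal.toReal_ofReal (ρ.nonneg_normed _)]
  exact integrable_kernel_mul ρ hh x

/-- Mollification preserves the integral. -/
theorem lintegral_lintegral_mollMeasure {F : Plane → ℝ≥0∞} (hF : AEMeasurable F) :
    ∫⁻ x, ∫⁻ y, F y ∂(mollMeasure ρ x) = ∫⁻ y, F y := by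
  have h1 : ∀ x, ∫⁻ y, F y ∂(mollMeasure ρ x)
      = ∫⁻ y, ENNReal.ofReal (ρ.normed volume (x - y)) * F y := by
    intro x
    rw [mollMeasure, lintegral_withDensity_eq_lintegral_mul₀ (measurable_kernel ρ x).aemeasurable hF]
    rfl
  simp_rw [h1]
  rw [lintegral_lintegral_swap]
  · have h2 : ∀ y, ∫⁻ x, ENNReal.ofReal (ρ.normed volume (x - y)) * F y = F y := by
      intro y
      rw [lintegral_mul_const _ (by
        exact (ρ.continuous_normed.comp (continuous_id.sub continuous_const)).measurable.ennreal_ofReal)]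
      have h3 := lintegral_mollMeasure_one y
      rw [h3, one_mul]
    simp_rw [h2]
  · refine AEMeasurable.mul ?_ hF.comp_snd
    exact (ρ.continuous_normed.comp (continuous_fst.sub continuous_snd)).measurable.ennreal_ofReal.aemeasurable
where
  lintegral_mollMeasure_one (y : Plane) :
      ∫⁻ x, ENNReal.ofReal (ρ.normed volume (x - y)) = 1 := by
    rw [← ofReal_integral_eq_lintegral_ofReal (ρ.integrable_normed.comp_sub_right y)
      (Eventually.of_forall fun y => ρ.nonneg_normed _),
      integral_sub_right_eq_self (fun y => ρ.normed volume y), ρ.integral_normed,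
      ENNReal.ofReal_one]

end Moll

/-! ### Jensen's inequality and the L¹ bound for mollification. -/

/-- Jensen's inequality for nonnegative convex functions, without integrability of the
composition. -/
theorem jensen_lintegral {α : Type*} [MeasurableSpace α] {μ : Measure α} [IsProbabilityMeasure μ]
    {f : ℝ → ℝ} (hf : ConvexOn ℝ univ f) (hf0 : ∀ t, 0 ≤ f t) {g : α → ℝ} (hg : Integrable g μ) :
    ENNReal.ofReal (f (∫ x, g x ∂μ)) ≤ ∫⁻ x, ENNReal.ofReal (f (g x)) ∂μ := by
  have hc : Continuous f := continuousOn_univ.1 (hf.continuousOn isOpen_univ)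
  by_cases hfi : Integrable (fun x => f (g x)) μ
  · rw [← ofReal_integral_eq_lintegral_ofReal hfi (Eventually.of_forall fun x => hf0 _)]
    exact ENNReal.ofReal_le_ofReal
      (hf.map_integral_le hc.continuousOn isClosed_univ (by simp) hg hfi)
  · have : ∫⁻ x, ENNReal.ofReal (f (g x)) ∂μ = ⊤ := by
      by_contra h
      refine hfi ⟨hc.comp_aestronglyMeasurable hg.aestronglyMeasurable, ?_⟩
      rw [hasFiniteIntegral_iff_ofReal (Eventually.of_forall fun x => hf0 _)]
      exact lt_top_iff_ne_top.2 h
    rw [this]; exact le_top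

theorem lintegral_enorm_moll_le (ρ : ContDiffBump (0 : Plane)) {h : Plane → ℝ}
    (hh : Integrable h) : ∫⁻ x, ‖moll ρ h x‖ₑ ≤ ∫⁻ x, ‖h x‖ₑ := by
  rw [← lintegral_lintegral_mollMeasure ρ hh.aestronglyMeasurable.enorm]
  refine lintegral_mono fun x => ?_
  rw [moll_eq_integral]
  exact enorm_integral_le_lintegral_enorm _

/-! ### Coordinates of the plane and horizontal dilations. -/

/-- The identification of `ℝ × ℝ` with the Euclidean plane. -/
def pt (p : ℝ × ℝ) : Plane := !₂[p.1, p.2]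

@[simp] theorem pt_zero (p : ℝ × ℝ) : pt p 0 = p.1 := rfl

@[simp] theorem pt_one (p : ℝ × ℝ) : pt p 1 = p.2 := rfl

theorem plane_ext {x y : Plane} (h0 : x 0 = y 0) (h1 : x 1 = y 1) : x = y := by
  ext i; fin_cases i
  · exact h0
  · exact h1

theorem pt_coord (x : Plane) : pt (x 0, x 1) = x := plane_ext rfl rfl

/-- `pt` as a measurable equivalence. -/
def ptEquiv : ℝ × ℝ ≃ᵐ Plane :=
  (MeasurableEquiv.finTwoArrow (α := ℝ)).symm.trans (MeasurableEquiv.toLp 2 (Fin 2 → ℝ))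

theorem ptEquiv_apply (p : ℝ × ℝ) : ptEquiv p = pt p := plane_ext rfl rfl

theorem coe_ptEquiv : ⇑ptEquiv = pt := funext ptEquiv_apply

theorem measurePreserving_pt : MeasurePreserving pt := by
  rw [← coe_ptEquiv]
  exact (PiLp.volume_preserving_toLp (Fin 2)).comp (volume_preserving_finTwoArrow ℝ).symm

theorem measurableEmbedding_pt : MeasurableEmbedding pt := by
  rw [← coe_ptEquiv]; exact ptEquiv.measurableEmbedding

theorem ae_plane_iff {p : Plane → Prop} :
    (∀ᵐ x, p x) ↔ ∀ᵐ q : ℝ × ℝ, p (pt q) := by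
  rw [← measurePreserving_pt.map_eq, measurableEmbedding_pt.ae_map_iff]

theorem norm_le_abs_add_abs (x : Plane) : ‖x‖ ≤ |x 0| + |x 1| := by
  rw [EuclideanSpace.norm_eq, Fin.sum_univ_two, Real.sqrt_le_left (by positivity)]
  simp only [Real.norm_eq_abs]
  nlinarith [abs_nonneg (x 0), abs_nonneg (x 1)]

theorem abs_coord_le_norm (x : Plane) (i : Fin 2) : |x i| ≤ ‖x‖ := PiLp.norm_apply_le x i

theorem abs_coord_sub_le_dist (x y : Plane) (i : Fin 2) : |x i - y i| ≤ dist x y := by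
  rw [dist_eq_norm]; exact abs_coord_le_norm (x - y) i

theorem dist_le_abs_add_abs (x y : Plane) : dist x y ≤ |x 0 - y 0| + |x 1 - y 1| := by
  rw [dist_eq_norm]; exact norm_le_abs_add_abs (x - y)

theorem continuous_coord (i : Fin 2) : Continuous fun x : Plane => x i := by fun_prop

/-- The dilation with factor `l` in the direction `x_1` about the line `x_1 = c`. -/
def dil (c l : ℝ) (x : Plane) : Plane := pt (c + l * (x 0 - c), x 1)

theorem continuous_pt : Continuous pt := by
  unfold pt
  fun_prop

theorem continuous_dil (c l : ℝ) : Continuous (dil c l) := by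
  unfold dil pt
  fun_prop

theorem dil_dil_inv (c : ℝ) {l : ℝ} (hl : l ≠ 0) (x : Plane) : dil c l (dil c l⁻¹ x) = x := by
  refine plane_ext ?_ rfl
  simp only [dil, pt_zero]
  field_simp
  ring

theorem dil_inv_dil (c : ℝ) {l : ℝ} (hl : l ≠ 0) (x : Plane) : dil c l⁻¹ (dil c l x) = x := by
  have := dil_dil_inv c (inv_ne_zero hl) x
  rwa [inv_inv] at this

theorem measurableEmbedding_dil (c : ℝ) {l : ℝ} (hl : l ≠ 0) : MeasurableEmbedding (dil c l) :=
  MeasurableEquiv.measurableEmbedding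
    { toFun := dil c l
      invFun := dil c l⁻¹
      left_inv := dil_inv_dil c hl
      right_inv := dil_dil_inv c hl
      measurable_toFun := (continuous_dil c l).measurable
      measurable_invFun := (continuous_dil c l⁻¹).measurable }

theorem map_dil (c : ℝ) {l : ℝ} (hl : 0 < l) :
    Measure.map (dil c l) volume = ENNReal.ofReal l⁻¹ • (volume : Measure Plane) := by
  have h1 : Measure.map (fun s : ℝ => c + l * (s - c)) volume = ENNReal.ofReal l⁻¹ • volume := by
    have e : (fun s : ℝ => c + l * (s - c)) = (fun s => (c - l * c) + s) ∘ fun s => l * s := by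
      ext s; simp only [Function.comp_apply]; ring
    rw [e, ← Measure.map_map (by fun_prop) (by fun_prop), Real.map_volume_mul_left hl.ne',
      Measure.map_smul, map_add_left_eq_self, abs_of_pos (inv_pos.2 hl)]
  have h2 : Measure.map (Prod.map (fun s : ℝ => c + l * (s - c)) (id : ℝ → ℝ)) volume
      = ENNReal.ofReal l⁻¹ • volume := by
    rw [Measure.volume_eq_prod, ← Measure.map_prod_map _ _ (by fun_prop) measurable_id, h1,
      Measure.map_id, Measure.prod_smul_left]
  have h3 : dil c l ∘ pt = pt ∘ Prod.map (fun s : ℝ => c + l * (s - c)) (id : ℝ → ℝ) := rfl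
  rw [← measurePreserving_pt.map_eq, Measure.map_map (continuous_dil c l).measurable
    continuous_pt.measurable, h3, ← Measure.map_map continuous_pt.measurable (by fun_prop), h2,
    Measure.map_smul]

theorem lintegral_comp_dil (c : ℝ) {l : ℝ} (hl : 0 < l) (F : Plane → ℝ≥0∞) :
    ∫⁻ x, F (dil c l x) = ENNReal.ofReal l⁻¹ * ∫⁻ x, F x := by
  rw [← (measurableEmbedding_dil c hl.ne').lintegral_map, map_dil c hl, lintegral_smul_measure,
    smul_eq_mul]

theorem integral_comp_dil (c : ℝ) {l : ℝ} (hl : 0 < l) (F : Plane → ℝ) :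
    ∫ x, F (dil c l x) = l⁻¹ * ∫ x, F x := by
  rw [← (measurableEmbedding_dil c hl.ne').integral_map, map_dil c hl, integral_smul_measure,
    smul_eq_mul, ENNReal.toReal_ofReal (inv_pos.2 hl).le]

theorem integrable_comp_dil (c : ℝ) {l : ℝ} (hl : 0 < l) {F : Plane → ℝ} (hF : Integrable F) :
    Integrable fun x => F (dil c l x) := by
  refine ((measurableEmbedding_dil c hl.ne').integrable_map_iff (μ := volume)).1 ?_
  rw [map_dil c hl]
  exact hF.smul_measure ENNReal.ofReal_ne_top

theorem lintegral_comp_dil_le (c : ℝ) {l : ℝ} (hl : 1 ≤ l) (F : Plane → ℝ≥0∞) :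
    ∫⁻ x, F (dil c l x) ≤ ∫⁻ x, F x := by
  rw [lintegral_comp_dil c (by linarith)]
  refine (mul_le_mul_left ?_ _).trans_eq (one_mul _)
  exact ENNReal.ofReal_le_one.2 (inv_le_one_of_one_le₀ hl)

/-- For l ≥ 1 the preimages of a ball under the dilations stay in one ball independent of l. This
gives a common support in dominated convergence. -/
theorem norm_le_of_norm_dil_le {c l R : ℝ} (hl : 1 ≤ l) {x : Plane} (hx : ‖dil c l x‖ ≤ R) :
    ‖x‖ ≤ 2 * |c| + 2 * R := by
  have h0 := (abs_coord_le_norm _ 0).trans hx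
  have h1 := (abs_coord_le_norm _ 1).trans hx
  have e0 : dil c l x 0 = c + l * (x 0 - c) := rfl
  have e1 : dil c l x 1 = x 1 := rfl
  rw [e0] at h0
  rw [e1] at h1
  have h2 : |x 0 - c| ≤ |l * (x 0 - c)| := by
    rw [abs_mul, abs_of_pos (by linarith : 0 < l)]
    nlinarith [abs_nonneg (x 0 - c)]
  have h3 : |l * (x 0 - c)| ≤ R + |c| := by
    have := abs_sub_abs_le_abs_sub (l * (x 0 - c)) (-c)
    rw [abs_neg, sub_neg_eq_add, add_comm (l * (x 0 - c))] at this
    linarith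
  have h4 : |x 0| ≤ |x 0 - c| + |c| := by
    simpa using abs_add_le (x 0 - c) c
  linarith [norm_le_abs_add_abs x]

/-! ### Convergence in L¹ of mollification combined with dilation. -/

/-- Mollification followed by a dilation tends to the identity in `L¹`. -/
theorem tendsto_moll_dil {ρ : ℕ → ContDiffBump (0 : Plane)} {c : ℝ} {l : ℕ → ℝ}
    (hρ : Tendsto (fun j => (ρ j).rOut) atTop (𝓝 0)) (hl1 : ∀ j, 1 ≤ l j)
    (hl : Tendsto l atTop (𝓝 1)) {h : Plane → ℝ} (hh : Integrable h) :
    Tendsto (fun j => ∫⁻ x, ‖moll (ρ j) h (dil c (l j) x) - h x‖ₑ) atTop (𝓝 0) := by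
  rw [ENNReal.tendsto_nhds_zero]
  intro ε hε
  obtain ⟨ε', hε', hε3⟩ : ∃ ε' : ℝ≥0∞, 0 < ε' ∧ ε' + ε' + ε' ≤ ε := by
    exact ⟨ε / 3, by simp [hε.ne'], (ENNReal.add_thirds ε).le⟩
  -- Density argument: for continuous g of compact support dominated convergence applies, and the
  -- error h - g is harmless because neither the mollification nor the dilation with l ≥ 1 increases
  -- the L¹ norm.
  obtain ⟨g, hgc, hgh, hgcont, hgi⟩ :=
    hh.exists_hasCompactSupport_lintegral_sub_le (ε := ε') hε'.ne'
  obtain ⟨C, hC⟩ := hgcont.bounded_above_of_compact_support hgc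
  obtain ⟨R, hR⟩ := hgc.isBounded.subset_closedBall (0 : Plane)
  have hgR : ∀ y, y ∉ Metric.closedBall (0 : Plane) R → g y = 0 := fun y hy =>
    image_eq_zero_of_notMem_tsupport fun hy' => hy (hR hy')
  have hmid : Tendsto (fun j => ∫⁻ x, ‖moll (ρ j) g (dil c (l j) x) - g x‖ₑ) atTop (𝓝 0) := by
    -- The summand 1 allows for a mollification radius below 1; the rest is the bound of
    -- `norm_le_of_norm_dil_le`.
    set B := Metric.closedBall (0 : Plane) (2 * |c| + 2 * (|R| + 1)) with hB
    have hlim : ∀ x, Tendsto (fun j => ‖moll (ρ j) g (dil c (l j) x) - g x‖ₑ) atTop (𝓝 0) := by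
      intro x
      have hk : Tendsto (fun j => dil c (l j) x) atTop (𝓝 x) := by
        have hcont : Continuous fun t => dil c t x := by unfold dil pt; fun_prop
        have := (hcont.tendsto 1).comp hl
        have e : dil c 1 x = x := plane_ext (by simp [dil]) rfl
        rwa [e] at this
      have := ContDiffBump.convolution_tendsto_right (μ := volume) (φ := ρ) (g := fun _ => g)
        (k := fun j => dil c (l j) x) (x₀ := x) (z₀ := g x) hρ
        (Eventually.of_forall fun _ => hgcont.aestronglyMeasurable)
        ((hgcont.tendsto x).comp tendsto_snd) hk
      simp_rw [← moll_eq_convolution] at this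
      have h2 := (this.sub_const (g x)).enorm
      simpa using h2
    have := tendsto_lintegral_filter_of_dominated_convergence (μ := (volume : Measure Plane))
      (F := fun j x => ‖moll (ρ j) g (dil c (l j) x) - g x‖ₑ) (f := fun _ => 0) (l := atTop)
      (B.indicator fun _ => ENNReal.ofReal (C + C)) ?_ ?_ ?_ (Eventually.of_forall hlim)
    · simpa using this
    · refine Eventually.of_forall fun j => ?_
      exact (((contDiff_moll (ρ j) hgi.locallyIntegrable).continuous.comp
        (continuous_dil c (l j))).sub hgcont).enorm.measurable
    · filter_upwards [hρ.eventually (gt_mem_nhds (zero_lt_one' ℝ))] with j hj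
      refine Eventually.of_forall fun x => ?_
      by_cases hx : x ∈ B
      · rw [indicator_of_mem hx, ← ofReal_norm]
        refine ENNReal.ofReal_le_ofReal ((norm_sub_le _ _).trans (add_le_add ?_ (hC x)))
        rw [moll_eq_integral]
        refine (norm_integral_le_of_norm_le_const (Eventually.of_forall hC)).trans ?_
        simp
      · rw [indicator_of_notMem hx]
        have h1 : g x = 0 := by
          refine hgR x fun h => hx ?_
          rw [Metric.mem_closedBall, dist_zero_right] at h ⊢
          linarith [le_abs_self R, abs_nonneg c, abs_nonneg R]
        have h2 : moll (ρ j) g (dil c (l j) x) = 0 := by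
          refine moll_eq_zero _ hgR fun y hy => ?_
          by_contra! hlt
          refine hx ?_
          rw [hB, Metric.mem_closedBall, dist_zero_right]
          refine norm_le_of_norm_dil_le (hl1 j) ?_
          rw [Metric.mem_closedBall, dist_zero_right] at hy
          rw [dist_eq_norm] at hlt
          have := norm_sub_norm_le (dil c (l j) x) y
          linarith [le_abs_self R]
        simp [h1, h2]
    · rw [lintegral_indicator_const Metric.isClosed_closedBall.measurableSet]
      exact ENNReal.mul_ne_top ENNReal.ofReal_ne_top
        (isCompact_closedBall (0 : Plane) _).measure_lt_top.ne
  filter_upwards [(ENNReal.tendsto_nhds_zero.1 hmid) ε' hε'] with j hj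
  have hd : Integrable (h - g) := hh.sub hgi
  have hb : ∀ x, ‖moll (ρ j) h (dil c (l j) x) - h x‖ₑ ≤ ‖moll (ρ j) (h - g) (dil c (l j) x)‖ₑ
      + ‖moll (ρ j) g (dil c (l j) x) - g x‖ₑ + ‖h x - g x‖ₑ := by
    intro x
    rw [moll_sub _ hh.locallyIntegrable hgi.locallyIntegrable, Pi.sub_apply]
    have e : moll (ρ j) h (dil c (l j) x) - h x
        = (moll (ρ j) h (dil c (l j) x) - moll (ρ j) g (dil c (l j) x))
          + (moll (ρ j) g (dil c (l j) x) - g x) + -(h x - g x) := by ring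
    rw [e]
    refine (enorm_add_le _ _).trans ?_
    rw [enorm_neg]
    exact add_le_add (enorm_add_le _ _) le_rfl
  have hm1 : Measurable fun x => ‖moll (ρ j) (h - g) (dil c (l j) x)‖ₑ :=
    ((contDiff_moll (ρ j) hd.locallyIntegrable).continuous.comp
        (continuous_dil c (l j))).enorm.measurable
  have hm2 : Measurable fun x => ‖moll (ρ j) g (dil c (l j) x) - g x‖ₑ :=
    (((contDiff_moll (ρ j) hgi.locallyIntegrable).continuous.comp
        (continuous_dil c (l j))).sub hgcont).enorm.measurable
  refine (lintegral_mono hb).trans ?_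
  rw [lintegral_add_left (by exact hm1.add hm2), lintegral_add_left hm1]
  refine le_trans (add_le_add (add_le_add ?_ hj) hgh) hε3
  refine (lintegral_comp_dil_le c (hl1 j) fun x => ‖moll (ρ j) (h - g) x‖ₑ).trans ?_
  exact (lintegral_enorm_moll_le _ hd).trans hgh

/-! ### Passage to the limit in integrals of f(d_j). -/

section Energy

variable {α : Type*} [MeasurableSpace α] {μ : Measure α} {d : ℕ → α → ℝ} {d₀ : α → ℝ} {f : ℝ → ℝ}

/-- Upper semicontinuity of `∫ f(d)` along sequences with integrands dominated by a sequence
which converges in `L¹`. -/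
theorem eventually_lintegral_le_of_dominated (hf : Continuous f)
    (hd : ∀ j, AEStronglyMeasurable (d j) μ) (hd₀ : AEStronglyMeasurable d₀ μ)
    (hlim : Tendsto (fun j => ∫⁻ x, ‖d j x - d₀ x‖ₑ ∂μ) atTop (𝓝 0))
    {h : ℕ → α → ℝ≥0∞} {h₀ : α → ℝ≥0∞} (hh₀ : AEMeasurable h₀ μ)
    (hle : ∀ᶠ j in atTop, ∀ᵐ x ∂μ, ENNReal.ofReal (f (d j x)) ≤ h j x)
    (hh : Tendsto (fun j => ∫⁻ x, (h j x - h₀ x) ∂μ) atTop (𝓝 0)) (hfin : ∫⁻ x, h₀ x ∂μ ≠ ⊤)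
    (hfin' : ∫⁻ x, ENNReal.ofReal (f (d₀ x)) ∂μ ≠ ⊤)
    {ε : ℝ≥0∞} (hε : 0 < ε) :
    ∀ᶠ j in atTop, ∫⁻ x, ENNReal.ofReal (f (d j x)) ∂μ
      ≤ ∫⁻ x, ENNReal.ofReal (f (d₀ x)) ∂μ + ε := by
  -- Truncation at the fixed integrable function h₀ makes dominated convergence possible. Since L¹
  -- convergence gives convergence almost everywhere only along subsequences, the limit is checked
  -- along these.
  have hmin : Tendsto (fun j => ∫⁻ x, min (ENNReal.ofReal (f (d j x))) (h₀ x) ∂μ) atTop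
      (𝓝 (∫⁻ x, min (ENNReal.ofReal (f (d₀ x))) (h₀ x) ∂μ)) := by
    refine tendsto_of_subseq_tendsto fun ns hns => ?_
    have hL : Tendsto (fun j => eLpNorm (d (ns j) - d₀) 1 μ) atTop (𝓝 0) := by
      simp_rw [eLpNorm_one_eq_lintegral_enorm]
      exact hlim.comp hns
    obtain ⟨ms, -, hms⟩ := (tendstoInMeasure_of_tendsto_eLpNorm one_ne_zero
      (fun j => hd (ns j)) hd₀ hL).exists_seq_tendsto_ae
    refine ⟨ms, tendsto_lintegral_of_dominated_convergence' h₀ (fun j => ?_)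
      (fun j => Eventually.of_forall fun x => min_le_right _ _) hfin ?_⟩
    · exact ((hf.comp_aestronglyMeasurable (hd _)).aemeasurable.ennreal_ofReal).min hh₀
    · filter_upwards [hms] with x hx
      exact ((ENNReal.continuous_ofReal.comp hf).tendsto _ |>.comp hx).min tendsto_const_nhds
  have hε2 : 0 < ε / 2 := ENNReal.half_pos hε.ne'
  have hlt : ∫⁻ x, min (ENNReal.ofReal (f (d₀ x))) (h₀ x) ∂μ
      < ∫⁻ x, ENNReal.ofReal (f (d₀ x)) ∂μ + ε / 2 :=
    (lintegral_mono fun x => min_le_left _ _).trans_lt (ENNReal.lt_add_right hfin' hε2.ne')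
  filter_upwards [hmin.eventually (gt_mem_nhds hlt), hle,
    (ENNReal.tendsto_nhds_zero.1 hh) _ hε2] with j h1 h2 h3
  -- The part above h₀ is at most the truncated difference h j - h₀, whose integral tends to zero.
  have h4 : ∫⁻ x, ENNReal.ofReal (f (d j x)) ∂μ ≤
      ∫⁻ x, (min (ENNReal.ofReal (f (d j x))) (h₀ x) + (h j x - h₀ x)) ∂μ := by
    refine lintegral_mono_ae ?_
    filter_upwards [h2] with x hx
    rcases le_total (ENNReal.ofReal (f (d j x))) (h₀ x) with hc | hc
    · rw [min_eq_left hc]; exact le_self_add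
    · rw [min_eq_right hc]; exact hx.trans le_add_tsub
  refine h4.trans ?_
  rw [lintegral_add_left' 
    (((hf.comp_aestronglyMeasurable (hd _)).aemeasurable.ennreal_ofReal).min hh₀)]
  calc _ ≤ (∫⁻ x, ENNReal.ofReal (f (d₀ x)) ∂μ + ε / 2) + ε / 2 := add_le_add h1.le h3
    _ = _ := by rw [add_assoc, ENNReal.add_halves]

/-- Fatou's lemma along sequences which converge in `L¹`, combined with an upper bound. -/
theorem tendsto_lintegral_of_upper_bound (hf : Continuous f)
    (hd : ∀ j, AEStronglyMeasurable (d j) μ) (hd₀ : AEStronglyMeasurable d₀ μ)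
    (hlim : Tendsto (fun j => ∫⁻ x, ‖d j x - d₀ x‖ₑ ∂μ) atTop (𝓝 0))
    {ε : ℕ → ℝ≥0∞} (hε : Tendsto ε atTop (𝓝 0))
    (hle : ∀ j, ∫⁻ x, ENNReal.ofReal (f (d j x)) ∂μ
      ≤ ∫⁻ x, ENNReal.ofReal (f (d₀ x)) ∂μ + ε j) :
    Tendsto (fun j => ∫⁻ x, ENNReal.ofReal (f (d j x)) ∂μ) atTop
      (𝓝 (∫⁻ x, ENNReal.ofReal (f (d₀ x)) ∂μ)) := by
  refine tendsto_of_subseq_tendsto fun ns hns => ?_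
  have hL : Tendsto (fun j => eLpNorm (d (ns j) - d₀) 1 μ) atTop (𝓝 0) := by
    simp_rw [eLpNorm_one_eq_lintegral_enorm]
    exact hlim.comp hns
  obtain ⟨ms, hms1, hms⟩ := (tendstoInMeasure_of_tendsto_eLpNorm one_ne_zero
    (fun j => hd (ns j)) hd₀ hL).exists_seq_tendsto_ae
  refine ⟨ms, tendsto_of_le_liminf_of_limsup_le ?_ ?_⟩
  · calc ∫⁻ x, ENNReal.ofReal (f (d₀ x)) ∂μ
        = ∫⁻ x, liminf (fun j => ENNReal.ofReal (f (d (ns (ms j)) x))) atTop ∂μ := by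
          refine lintegral_congr_ae ?_
          filter_upwards [hms] with x hx
          exact (((ENNReal.continuous_ofReal.comp hf).tendsto _).comp hx).liminf_eq.symm
      _ ≤ _ := lintegral_liminf_le' fun j =>
          (hf.comp_aestronglyMeasurable (hd _)).aemeasurable.ennreal_ofReal
  · have h1 : Tendsto (fun j => ∫⁻ x, ENNReal.ofReal (f (d₀ x)) ∂μ + ε (ns (ms j))) atTop
        (𝓝 (∫⁻ x, ENNReal.ofReal (f (d₀ x)) ∂μ)) := by
      have := (tendsto_const_nhds (x := ∫⁻ x, ENNReal.ofReal (f (d₀ x)) ∂μ)).add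
        (hε.comp (hns.comp hms1.tendsto_atTop))
      simpa using this
    rw [← h1.limsup_eq]
    exact limsup_le_limsup (Eventually.of_forall fun j => hle _)

end Energy

/-! ### Vertical primitives. -/

theorem hasDerivAt_pt_snd (s t : ℝ) :
    HasDerivAt (fun t => pt (s, t)) (EuclideanSpace.single 1 1) t := by
  have e : (fun t => pt (s, t)) = fun t : ℝ => pt (s, 0) + t • EuclideanSpace.single (1 : Fin 2) (1 : ℝ) := by
    ext t; exact congrFun (congrArg _ (plane_ext (by simp) (by simp))) _
  rw [e]
  simpa using ((hasDerivAt_id t).smul_const (EuclideanSpace.single (1 : Fin 2) (1 : ℝ))).const_add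
    (pt (s, 0))

theorem hasDerivAt_comp_pt_snd {φ : Plane → ℝ} {s t : ℝ} (hφ : DifferentiableAt ℝ φ (pt (s, t))) :
    HasDerivAt (fun t => φ (pt (s, t))) (pderiv 1 φ (pt (s, t))) t :=
  hφ.hasFDerivAt.comp_hasDerivAt t (hasDerivAt_pt_snd s t)

/-- The primitive of `G` in the direction `x_2` which vanishes at `-∞`. -/
noncomputable def vint (G : Plane → ℝ) (x : Plane) : ℝ := ∫ t in Iio (x 1), G (pt (x 0, t))

theorem measurable_vint {G : Plane → ℝ} (hG : Measurable G) : Measurable (vint G) := by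
  have e : vint G = fun x => ∫ t, (Iio (x 1)).indicator (fun t => G (pt (x 0, t))) t := by
    ext x; rw [integral_indicator measurableSet_Iio]; rfl
  rw [e]
  have hm : Measurable fun p : Plane × ℝ => (Iio (p.1 1)).indicator (fun t => G (pt (p.1 0, t))) p.2 := by
    have : (fun p : Plane × ℝ => (Iio (p.1 1)).indicator (fun t => G (pt (p.1 0, t))) p.2)
        = {p : Plane × ℝ | p.2 < p.1 1}.indicator fun p => G (pt (p.1 0, p.2)) := by
      ext p; simp [indicator]
    rw [this]
    refine Measurable.indicator ?_ ?_
    · refine hG.comp (continuous_pt.measurable.comp ?_)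
      exact (((continuous_coord 0).measurable.comp measurable_fst).prodMk measurable_snd)
    · exact measurableSet_lt measurable_snd ((continuous_coord 1).measurable.comp measurable_fst)
  exact (hm.stronglyMeasurable.integral_prod_right').measurable

theorem integrable_comp_pt {G : Plane → ℝ} (hG : Integrable G) :
    Integrable fun p : ℝ × ℝ => G (pt p) :=
  measurePreserving_pt.integrable_comp_of_integrable hG

theorem ae_integrable_fiber {G : Plane → ℝ} (hG : Integrable G) :
    ∀ᵐ s : ℝ, Integrable fun t => G (pt (s, t)) := by
  have := integrable_comp_pt hG
  rw [Measure.volume_eq_prod] at this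
  exact this.prod_right_ae

theorem integrable_fiber_norm {G : Plane → ℝ} (hG : Integrable G) :
    Integrable fun s : ℝ => ∫ t, ‖G (pt (s, t))‖ := by
  have := (integrable_comp_pt hG).norm
  rw [Measure.volume_eq_prod] at this
  exact this.integral_prod_left

theorem norm_vint_le {G : Plane → ℝ} (x : Plane) (hx : Integrable fun t => G (pt (x 0, t))) :
    ‖vint G x‖ ≤ ∫ t, ‖G (pt (x 0, t))‖ :=
  (norm_integral_le_integral_norm _).trans
    (setIntegral_le_integral hx.norm (Eventually.of_forall fun _ => norm_nonneg _))

theorem ae_norm_vint_le {G : Plane → ℝ} (hG : Integrable G) :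
    ∀ᵐ x : Plane, ‖vint G x‖ ≤ ∫ t, ‖G (pt (x 0, t))‖ := by
  rw [ae_plane_iff, Measure.volume_eq_prod]
  have h : ∀ᵐ p : ℝ × ℝ ∂(volume.prod volume), Integrable fun t => G (pt (p.1, t)) :=
    Measure.quasiMeasurePreserving_fst.ae (ae_integrable_fiber hG)
  filter_upwards [h] with p hp
  exact norm_vint_le (pt p) hp

/-- The primitive is bounded by an integrable function of x_1 alone and need not decay as x_2 → ∞; a
factor ψ of bounded vertical extent restores integrability. -/
theorem integrable_vint_mul {G : Plane → ℝ} (hGm : Measurable G) (hG : Integrable G)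
    {ψ : Plane → ℝ} (hψ : Measurable ψ) {C R : ℝ} (hC : ∀ x, ‖ψ x‖ ≤ C)
    (hR : ∀ x, R < |x 1| → ψ x = 0) : Integrable fun x => vint G x * ψ x := by
  have h1 : Integrable (fun p : ℝ × ℝ => (∫ t, ‖G (pt (p.1, t))‖) * (Icc (-R) R).indicator
      (fun _ => C) p.2) := by
    rw [Measure.volume_eq_prod]
    refine (integrable_fiber_norm hG).mul_prod ?_
    exact (integrable_indicator_iff measurableSet_Icc).2 (integrableOn_const (by simp) (by simp))
  rw [← measurePreserving_pt.integrable_comp_emb measurableEmbedding_pt]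
  have h2 := ae_plane_iff.1 (ae_norm_vint_le hG)
  refine h1.mono' ?_ ?_
  · exact (((measurable_vint hGm).mul hψ).comp continuous_pt.measurable).aestronglyMeasurable
  · filter_upwards [h2] with p hp
    simp only [Function.comp_apply, norm_mul]
    by_cases h : p.2 ∈ Icc (-R) R
    · rw [indicator_of_mem h]
      exact mul_le_mul hp (hC _) (norm_nonneg _) (integral_nonneg fun _ => norm_nonneg _)
    · rw [indicator_of_notMem h, hR (pt p), norm_zero, mul_zero, mul_zero]
      rw [mem_Icc, ← abs_le, not_le] at h
      exact h

theorem locallyIntegrable_vint {G : Plane → ℝ} (hGm : Measurable G) (hG : Integrable G) :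
    LocallyIntegrable (vint G) := by
  rw [locallyIntegrable_iff]
  intro K hK
  rw [← integrable_indicator_iff hK.measurableSet]
  obtain ⟨R, hR⟩ := hK.isBounded.subset_closedBall (0 : Plane)
  have := integrable_vint_mul hGm hG (ψ := K.indicator 1) (C := 1) (R := R)
    (measurable_one.indicator hK.measurableSet) (fun x => ?_) (fun x hx => ?_)
  · refine this.congr (Eventually.of_forall fun x => ?_)
    by_cases h : x ∈ K <;> simp [h]
  · by_cases h : x ∈ K <;> simp [h]
  · refine indicator_of_notMem (fun h => ?_) _
    have h2 := hR h
    rw [Metric.mem_closedBall, dist_zero_right] at h2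
    linarith [abs_coord_le_norm x 1]

theorem bounded_of_isTest {U : Set Plane} {φ : Plane → ℝ} (hφ : IsTest U φ) :
    ∃ C, ∀ x, ‖φ x‖ ≤ C :=
  hφ.smooth.continuous.bounded_above_of_compact_support hφ.hasCompactSupport

theorem integral_eq_integral_fiber {F : Plane → ℝ} (hF : Integrable F) :
    ∫ x, F x = ∫ s, ∫ t, F (pt (s, t)) := by
  rw [← measurePreserving_pt.integral_comp measurableEmbedding_pt, Measure.volume_eq_prod,
    integral_prod]
  have := integrable_comp_pt hF
  rwa [Measure.volume_eq_prod] at this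

theorem IsTest.exists_radius {U : Set Plane} {φ : Plane → ℝ} (hφ : IsTest U φ) :
    ∃ R : ℝ, ∀ x : Plane, R < ‖x‖ → x ∉ tsupport φ := by
  obtain ⟨R, hR⟩ := hφ.hasCompactSupport.isBounded.subset_closedBall (0 : Plane)
  refine ⟨R, fun x hx h => ?_⟩
  have := hR h
  rw [Metric.mem_closedBall, dist_zero_right] at this
  linarith

theorem integral_Ioi_pderiv {U : Set Plane} {φ : Plane → ℝ} (hφ : IsTest U φ) (s t : ℝ) :
    ∫ y in Ioi t, pderiv 1 φ (pt (s, y)) = -φ (pt (s, t)) := by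
  obtain ⟨R, hR⟩ := hφ.exists_radius
  have hd : ∀ y, HasDerivAt (fun y => φ (pt (s, y))) (pderiv 1 φ (pt (s, y))) y := fun y =>
    hasDerivAt_comp_pt_snd (hφ.smooth.differentiable (by simp) _)
  have hc : Continuous fun y => pderiv 1 φ (pt (s, y)) :=
    (continuous_pderiv hφ.smooth 1).comp (continuous_pt.comp (by fun_prop))
  have hfar : ∀ y, y ∉ Icc (-R) R → pt (s, y) ∉ tsupport φ := by
    intro y hy
    rw [mem_Icc, ← abs_le, not_le] at hy
    exact hR _ (hy.trans_le (abs_coord_le_norm (pt (s, y)) 1))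
  have hcs : HasCompactSupport fun y => pderiv 1 φ (pt (s, y)) :=
    HasCompactSupport.intro isCompact_Icc fun y hy => pderiv_eq_zero_of_notMem_tsupport (hfar y hy) 1
  have hlim : Tendsto (fun y => φ (pt (s, y))) atTop (𝓝 0) := by
    refine tendsto_const_nhds.congr' ?_
    filter_upwards [eventually_gt_atTop R] with y hy
    exact (image_eq_zero_of_notMem_tsupport (hfar y fun h => absurd h.2 (not_le.2 hy))).symm
  rw [integral_Ioi_of_hasDerivAt_of_tendsto (hd t).continuousAt.continuousWithinAt
    (fun y _ => hd y) (hc.integrable_of_hasCompactSupport hcs).integrableOn hlim, zero_sub]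

/-- On almost every vertical line the order of integration is exchanged over {t < y}; the inner
integral of ∂_2 φ over (t, ∞) is -φ(t). No mean value condition on G is needed. -/
theorem integral_vint_mul_pderiv {G : Plane → ℝ} (hGm : Measurable G) (hG : Integrable G)
    {U : Set Plane} {φ : Plane → ℝ} (hφ : IsTest U φ) :
    ∫ x, vint G x * pderiv 1 φ x = -∫ x, G x * φ x := by
  obtain ⟨R, hR⟩ := hφ.exists_radius
  have hpc := continuous_pderiv hφ.smooth 1
  obtain ⟨C, hC⟩ := hpc.bounded_above_of_compact_support
    (hasCompactSupport_pderiv hφ.hasCompactSupport 1)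
  obtain ⟨C', hC'⟩ := bounded_of_isTest hφ
  have h1 : Integrable fun x => vint G x * pderiv 1 φ x :=
    integrable_vint_mul hGm hG hpc.measurable hC fun x hx =>
      pderiv_eq_zero_of_notMem_tsupport (hR x (hx.trans_le (abs_coord_le_norm x 1))) 1
  have h2 : Integrable fun x => G x * φ x :=
    hG.mul_bdd (c := C') hφ.smooth.continuous.aestronglyMeasurable (Eventually.of_forall hC')
  rw [integral_eq_integral_fiber h1, integral_eq_integral_fiber h2, ← integral_neg]
  refine integral_congr_ae ?_
  filter_upwards [ae_integrable_fiber hG] with s hs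
  have hc : Continuous fun y => pderiv 1 φ (pt (s, y)) :=
    hpc.comp (continuous_pt.comp (by fun_prop))
  have hcs : HasCompactSupport fun y => pderiv 1 φ (pt (s, y)) := by
    refine HasCompactSupport.intro (isCompact_Icc (a := -R) (b := R)) fun y hy => ?_
    rw [mem_Icc, ← abs_le, not_le] at hy
    exact pderiv_eq_zero_of_notMem_tsupport
      (hR _ (hy.trans_le (abs_coord_le_norm (pt (s, y)) 1))) 1
  have hp := hc.integrable_of_hasCompactSupport hcs (μ := volume)
  have hswap : ∫ y, ∫ t, (Iio y).indicator (fun t => G (pt (s, t)) * pderiv 1 φ (pt (s, y))) t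
      = ∫ t, ∫ y, (Iio y).indicator (fun t => G (pt (s, t)) * pderiv 1 φ (pt (s, y))) t := by
    refine integral_integral_swap ?_
    have := (hp.mul_prod hs).indicator (s := {p : ℝ × ℝ | p.2 < p.1})
      (measurableSet_lt measurable_snd measurable_fst)
    refine this.congr (Eventually.of_forall fun p => ?_)
    simp [indicator, mul_comm, Function.uncurry]
  calc ∫ y, vint G (pt (s, y)) * pderiv 1 φ (pt (s, y))
      = ∫ y, ∫ t, (Iio y).indicator (fun t => G (pt (s, t)) * pderiv 1 φ (pt (s, y))) t := by
        congr 1; ext y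
        rw [integral_indicator measurableSet_Iio, integral_mul_const]
        rfl
    _ = ∫ t, ∫ y, (Iio y).indicator (fun t => G (pt (s, t)) * pderiv 1 φ (pt (s, y))) t := hswap
    _ = ∫ t, G (pt (s, t)) * ∫ y in Ioi t, pderiv 1 φ (pt (s, y)) := by
        congr 1; ext t
        rw [← integral_const_mul, ← integral_indicator measurableSet_Ioi]
        congr 1
    _ = ∫ t, -(G (pt (s, t)) * φ (pt (s, t))) := by
        simp_rw [integral_Ioi_pderiv hφ, mul_neg]
    _ = _ := integral_neg _

/-! ### Functions without vertical derivative. -/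

/-- A bump function with outer radius `r`. -/
noncomputable def bump (r : ℝ) (hr : 0 < r) : ContDiffBump (0 : Plane) :=
  ⟨r / 2, r, half_pos hr, half_lt_self hr⟩

theorem ae_tendsto_moll {h : Plane → ℝ} (hh : LocallyIntegrable h) {r : ℕ → ℝ} (hr : ∀ n, 0 < r n)
    (hr0 : Tendsto r atTop (𝓝 0)) :
    ∀ᵐ x, Tendsto (fun n => moll (bump (r n) (hr n)) h x) atTop (𝓝 (h x)) := by
  have := ContDiffBump.ae_convolution_tendsto_right_of_locallyIntegrable (μ := volume)
    (φ := fun n => bump (r n) (hr n)) (K := 2) (l := atTop) hr0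
    (Eventually.of_forall fun n => by simp [bump]; linarith) hh
  simpa only [← moll_eq_convolution] using this

theorem moll_fiber_const (ρ : ContDiffBump (0 : Plane)) {U : Set Plane} {W : Plane → ℝ}
    (hW : LocallyIntegrable W) (hw : ∀ φ, IsTest U φ → ∫ x, W x * pderiv 1 φ x = 0)
    {s t₁ t₂ : ℝ} (ht : t₁ ≤ t₂)
    (hU : ∀ t ∈ Icc t₁ t₂, Metric.closedBall (pt (s, t)) ρ.rOut ⊆ U) :
    moll ρ W (pt (s, t₂)) = moll ρ W (pt (s, t₁)) := by
  have hz : ∀ t ∈ Icc t₁ t₂, pderiv 1 (moll ρ W) (pt (s, t)) = 0 := by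
    intro t ht
    rw [pderiv_moll_of_weak ρ (U := U) (H := fun _ => 0) hW (hU t ht) (fun φ hφ => by
      rw [hw φ hφ]; simp)]
    simp [moll]
  have hd : ∀ t, HasDerivAt (fun t => moll ρ W (pt (s, t)))
      (pderiv 1 (moll ρ W) (pt (s, t))) t := fun t =>
    hasDerivAt_comp_pt_snd ((contDiff_moll ρ hW).differentiable (by simp) _)
  refine constant_of_has_deriv_right_zero (f := fun t => moll ρ W (pt (s, t)))
    (a := t₁) (b := t₂) (fun t _ => (hd t).continuousAt.continuousWithinAt)
    (fun t ht => ?_) t₂ ⟨ht, le_rfl⟩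
  have h2 := (hd t).hasDerivWithinAt (s := Ici t)
  rwa [hz t ⟨ht.1, ht.2.le⟩] at h2

/-- A function whose weak derivative `∂_2` vanishes on an open set with connected vertical
sections is constant along these, up to a null set. -/
theorem ae_fiber_const {U : Set Plane} (hU : IsOpen U)
    (hconv : ∀ x ∈ U, ∀ y ∈ U, x 0 = y 0 → ∀ t ∈ Icc (x 1) (y 1), pt (x 0, t) ∈ U)
    {W : Plane → ℝ} (hW : LocallyIntegrable W)
    (hw : ∀ φ, IsTest U φ → ∫ x, W x * pderiv 1 φ x = 0) :
    ∃ E : Set Plane, (∀ᵐ x, x ∈ E) ∧ ∀ x ∈ U ∩ E, ∀ y ∈ U ∩ E, x 0 = y 0 → W x = W y := by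
  have hr : ∀ n : ℕ, (0 : ℝ) < 1 / (n + 1) := fun n => by positivity
  obtain ⟨ρ, hρ, hae⟩ : ∃ ρ : ℕ → ContDiffBump (0 : Plane),
      (∀ n, (ρ n).rOut = 1 / ((n : ℝ) + 1)) ∧
      ∀ᵐ x, Tendsto (fun n => moll (ρ n) W x) atTop (𝓝 (W x)) :=
    ⟨fun n => bump _ (hr n), fun n => rfl,
      ae_tendsto_moll hW hr tendsto_one_div_add_atTop_nhds_zero_nat⟩
  -- E consists of the points where the mollifications converge to W itself, so equality of the
  -- mollifications at two points of E passes to W at exactly these points.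
  refine ⟨{x | Tendsto (fun n => moll (ρ n) W x) atTop (𝓝 (W x))}, hae, ?_⟩
  have key : ∀ x ∈ U, ∀ y ∈ U, x 0 = y 0 → x 1 ≤ y 1 → ∀ᶠ n : ℕ in atTop,
      moll (ρ n) W x = moll (ρ n) W y := by
    intro x hx y hy h0 h1
    set K : Set Plane := (fun t => pt (x 0, t)) '' Icc (x 1) (y 1) with hK
    have hKc : IsCompact K := isCompact_Icc.image (continuous_pt.comp (by fun_prop))
    have hKU : K ⊆ U := by
      rintro _ ⟨t, ht, rfl⟩
      exact hconv x hx y hy h0 t ht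
    -- The vertical segment from x to y is compact in U, hence for small radii all kernels centred
    -- on it are supported in U.
    obtain ⟨r, hr0, hrU⟩ := hKc.exists_cthickening_subset_open hU hKU
    filter_upwards [tendsto_one_div_add_atTop_nhds_zero_nat.eventually (gt_mem_nhds hr0)]
      with n hn
    have hball : ∀ t ∈ Icc (x 1) (y 1), Metric.closedBall (pt (x 0, t)) (ρ n).rOut ⊆ U := by
      intro t ht
      have hmem : pt (x 0, t) ∈ K := ⟨t, ht, rfl⟩
      have hle : (ρ n).rOut ≤ r := by rw [hρ n]; exact hn.le
      exact ((Metric.closedBall_subset_closedBall hle).trans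
        (Metric.closedBall_subset_cthickening hmem r)).trans hrU
    have := moll_fiber_const (ρ n) hW hw (s := x 0) (t₁ := x 1) (t₂ := y 1) h1 hball
    have e2 : pt (x 0, y 1) = y := plane_ext h0 rfl
    rw [pt_coord, e2] at this
    exact this.symm
  rintro x ⟨hxU, hxE⟩ y ⟨hyU, hyE⟩ h0
  rcases le_total (x 1) (y 1) with h1 | h1
  · exact tendsto_nhds_unique (hxE.congr' (key x hxU y hyU h0 h1)) hyE
  · exact (tendsto_nhds_unique (hyE.congr' (key y hyU x hxU h0.symm h1)) hxE).symm

/-! ### Existence of traces on Lipschitz graphs. -/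

/-- The part of `G` in the strip of height `R` about the graph of `κ`. -/
noncomputable def strip (κ : ℝ → ℝ) (R : ℝ) (G : Plane → ℝ) : Plane → ℝ :=
  {x : Plane | |x 1 - κ (x 0)| ≤ R}.indicator G

theorem measurableSet_strip {κ : ℝ → ℝ} (hκ : Continuous κ) (R : ℝ) :
    MeasurableSet {x : Plane | |x 1 - κ (x 0)| ≤ R} :=
  (isClosed_le ((continuous_coord 1).sub (hκ.comp (continuous_coord 0))).abs
    continuous_const).measurableSet

theorem integrable_strip {κ : ℝ → ℝ} (hκ : Continuous κ) (R : ℝ) {G : Plane → ℝ}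
    (hG : Integrable G) : Integrable (strip κ R G) :=
  hG.indicator (measurableSet_strip hκ R)

theorem norm_strip_pt (κ : ℝ → ℝ) (R : ℝ) (G : Plane → ℝ) (s t : ℝ) :
    ‖strip κ R G (pt (s, t))‖ = {t | |t - κ s| ≤ R}.indicator (fun t => ‖G (pt (s, t))‖) t := by
  by_cases h : |t - κ s| ≤ R
  · rw [strip, indicator_of_mem (by exact h), indicator_of_mem (by exact h)]
  · rw [strip, indicator_of_notMem (by exact h), indicator_of_notMem (by exact h), norm_zero]

/-- The strips shrink to the single point t = κ s of the section, which is a null set. -/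
theorem tendsto_integral_strip {κ : ℝ → ℝ} {G : Plane → ℝ} {s : ℝ}
    (hs : Integrable fun t => G (pt (s, t))) :
    Tendsto (fun m : ℕ => ∫ t, ‖strip κ (1 / ((m : ℝ) + 1)) G (pt (s, t))‖) atTop (𝓝 0) := by
  have hmeas : ∀ R : ℝ, MeasurableSet {t : ℝ | |t - κ s| ≤ R} := fun R =>
    (isClosed_le (by fun_prop) continuous_const).measurableSet
  have := tendsto_integral_of_dominated_convergence (μ := (volume : Measure ℝ))
    (F := fun (m : ℕ) t => ‖strip κ (1 / ((m : ℝ) + 1)) G (pt (s, t))‖) (f := fun _ => 0)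
    (fun t => ‖G (pt (s, t))‖) (fun m => ?_) hs.norm (fun m => ?_) ?_
  · simpa using this
  · simp_rw [norm_strip_pt]
    exact hs.norm.aestronglyMeasurable.indicator (hmeas _)
  · refine Eventually.of_forall fun t => ?_
    rw [norm_norm, norm_strip_pt]
    exact indicator_le_self' (fun _ _ => norm_nonneg _) t
  · have h0 : ∀ᵐ t : ℝ, t ≠ κ s := by simp [ae_iff, measure_singleton]
    filter_upwards [h0] with t ht
    refine tendsto_const_nhds.congr' ?_
    have hpos : 0 < |t - κ s| := abs_pos.2 (sub_ne_zero.2 ht)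
    filter_upwards [tendsto_one_div_add_atTop_nhds_zero_nat.eventually (gt_mem_nhds hpos)]
      with m hm
    rw [norm_strip_pt, indicator_of_notMem]
    simpa using hm

theorem setIntegral_square (H : ℝ → ℝ) {s z ρ : ℝ} (hρ : 0 < ρ) :
    ∫ y in {y : Plane | y 0 ∈ Icc (s - ρ) (s + ρ) ∧ y 1 ∈ Icc (z - ρ) (z + ρ)}, H (y 0)
      = 2 * ρ * ∫ r in Icc (s - ρ) (s + ρ), H r := by
  rw [← measurePreserving_pt.setIntegral_preimage_emb measurableEmbedding_pt]
  have e : pt ⁻¹' {y : Plane | y 0 ∈ Icc (s - ρ) (s + ρ) ∧ y 1 ∈ Icc (z - ρ) (z + ρ)}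
      = Icc (s - ρ) (s + ρ) ×ˢ Icc (z - ρ) (z + ρ) := rfl
  have := setIntegral_prod_mul (μ := (volume : Measure ℝ)) (ν := (volume : Measure ℝ))
    H (fun _ => (1 : ℝ)) (Icc (s - ρ) (s + ρ)) (Icc (z - ρ) (z + ρ))
  rw [e, Measure.volume_eq_prod]
  simp only [mul_one, pt_zero] at this ⊢
  rw [this, setIntegral_const, smul_eq_mul, mul_one, Real.volume_real_Icc_of_le (by linarith)]
  ring

theorem integrableOn_square {H : ℝ → ℝ} {s z ρ : ℝ} (hH : IntegrableOn H (Icc (s - ρ) (s + ρ))) :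
    IntegrableOn (fun y : Plane => H (y 0))
      {y : Plane | y 0 ∈ Icc (s - ρ) (s + ρ) ∧ y 1 ∈ Icc (z - ρ) (z + ρ)} := by
  rw [← measurePreserving_pt.integrableOn_comp_preimage measurableEmbedding_pt]
  have e : pt ⁻¹' {y : Plane | y 0 ∈ Icc (s - ρ) (s + ρ) ∧ y 1 ∈ Icc (z - ρ) (z + ρ)}
      = Icc (s - ρ) (s + ρ) ×ˢ Icc (z - ρ) (z + ρ) := rfl
  have h1 : IntegrableOn (fun _ : ℝ => (1 : ℝ)) (Icc (z - ρ) (z + ρ)) := by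
    exact integrableOn_const (by simp) (by simp)
  have h2 := Integrable.mul_prod hH h1
  rw [e, IntegrableOn, Measure.volume_eq_prod, ← Measure.prod_restrict]
  simpa [Function.comp_def] using h2

/-- The ball is enlarged to a square, on which a bound depending on x_1 alone integrates trivially.
By the Lipschitz condition the points of the square are within (1 + L) ρ of the graph, so a single
strip of height R serves them all. -/
theorem setIntegral_le_square {U : Set Plane} (hUm : MeasurableSet U) {v : Plane → ℝ} {τ : ℝ → ℝ}
    {G : Plane → ℝ} (hG : Integrable G) {κ : ℝ → ℝ} {L : ℝ≥0} (hκ : LipschitzWith L κ)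
    (hv : ∀ᵐ x ∂(volume.restrict U), |v x - τ (x 0)|
      ≤ ∫ t, ‖strip κ |x 1 - κ (x 0)| G (pt (x 0, t))‖) {s ρ R : ℝ} (hρ : 0 < ρ)
    (hR : (1 + L) * ρ ≤ R) (hτ : IntegrableOn τ (Icc (s - ρ) (s + ρ))) :
    ∫ y in U ∩ Metric.ball (pt (s, κ s)) ρ, |v y - τ s|
      ≤ 2 * ρ * ∫ r in Icc (s - ρ) (s + ρ), (‖τ r - τ s‖ + ∫ t, ‖strip κ R G (pt (r, t))‖) := by
  set Q := {y : Plane | y 0 ∈ Icc (s - ρ) (s + ρ) ∧ y 1 ∈ Icc (κ s - ρ) (κ s + ρ)}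
  have hJ : Integrable fun r => ∫ t, ‖strip κ R G (pt (r, t))‖ :=
    integrable_fiber_norm (integrable_strip hκ.continuous R hG)
  have hH : IntegrableOn (fun r => ‖τ r - τ s‖ + ∫ t, ‖strip κ R G (pt (r, t))‖)
      (Icc (s - ρ) (s + ρ)) :=
    ((hτ.sub (integrableOn_const (by simp) (by simp))).norm).add hJ.integrableOn
  have hHQ := integrableOn_square (z := κ s) hH
  have hsub : U ∩ Metric.ball (pt (s, κ s)) ρ ⊆ Q := by
    rintro y ⟨-, hy⟩
    have h0 := (abs_coord_sub_le_dist y (pt (s, κ s)) 0).trans (Metric.mem_ball.1 hy).le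
    have h1 := (abs_coord_sub_le_dist y (pt (s, κ s)) 1).trans (Metric.mem_ball.1 hy).le
    rw [abs_le] at h0 h1
    simp only [pt_zero, pt_one] at h0 h1
    exact ⟨⟨by linarith, by linarith⟩, ⟨by linarith, by linarith⟩⟩
  have hnn : ∀ r, 0 ≤ ‖τ r - τ s‖ + ∫ t, ‖strip κ R G (pt (r, t))‖ := fun r =>
    add_nonneg (norm_nonneg _) (integral_nonneg fun _ => norm_nonneg _)
  rw [← setIntegral_square _ hρ]
  refine le_trans ?_ (setIntegral_mono_set hHQ (Eventually.of_forall fun y => hnn (y 0))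
    (Eventually.of_forall hsub))
  refine integral_mono_of_nonneg (Eventually.of_forall fun _ => abs_nonneg _)
    (hHQ.mono_set hsub) ?_
  have hfib : ∀ᵐ x : Plane, Integrable fun t => G (pt (x 0, t)) := by
    rw [ae_plane_iff, Measure.volume_eq_prod]
    exact Measure.quasiMeasurePreserving_fst.ae (ae_integrable_fiber hG)
  have hv' : ∀ᵐ x ∂(volume.restrict (U ∩ Metric.ball (pt (s, κ s)) ρ)), |v x - τ (x 0)|
      ≤ ∫ t, ‖strip κ |x 1 - κ (x 0)| G (pt (x 0, t))‖ :=
    ae_mono (Measure.restrict_mono inter_subset_left le_rfl) hv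
  filter_upwards [hv', ae_restrict_of_ae hfib,
    ae_restrict_mem (hUm.inter Metric.isOpen_ball.measurableSet)] with y hy hfy hmem
  have hyQ := hsub hmem
  have h1 : |y 1 - κ (y 0)| ≤ R := by
    have h2 := hκ.dist_le_mul s (y 0)
    rw [Real.dist_eq, Real.dist_eq] at h2
    have h3 : |s - y 0| ≤ ρ := abs_le.2 ⟨by linarith [hyQ.1.2], by linarith [hyQ.1.1]⟩
    have h4 : |y 1 - κ s| ≤ ρ := abs_le.2 ⟨by linarith [hyQ.2.1], by linarith [hyQ.2.2]⟩
    have h5 := abs_sub_le (y 1) (κ s) (κ (y 0))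
    have h6 : (L : ℝ) * |s - y 0| ≤ L * ρ := mul_le_mul_of_nonneg_left h3 L.2
    linarith
  have h7 : ∫ t, ‖strip κ |y 1 - κ (y 0)| G (pt (y 0, t))‖ ≤ ∫ t, ‖strip κ R G (pt (y 0, t))‖ := by
    simp_rw [norm_strip_pt]
    refine integral_mono_of_nonneg (Eventually.of_forall fun t => ?_) ?_
      (Eventually.of_forall fun t => ?_)
    · exact indicator_nonneg (fun _ _ => norm_nonneg _) t
    · exact hfy.norm.indicator (isClosed_le (by fun_prop) continuous_const).measurableSet
    · exact indicator_le_indicator_of_subset (fun t ht => le_trans ht h1)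
        (fun _ => norm_nonneg _) t
  have h8 := abs_sub_le (v y) (τ (y 0)) (τ s)
  rw [Real.norm_eq_abs]
  linarith

/-- The points s which work are Lebesgue points of τ and of the fibre integrals over the strips.
Fixing a strip, letting ρ ↓ 0 and then shrinking the strip gives the trace. -/
theorem ae_hasTraceAt_of_mem {U : Set Plane} (hUm : MeasurableSet U) {v : Plane → ℝ} {τ : ℝ → ℝ}
    {G : Plane → ℝ} (hG : Integrable G) {κ : ℝ → ℝ} {L : ℝ≥0} (hκ : LipschitzWith L κ)
    (hv : ∀ᵐ x ∂(volume.restrict U), |v x - τ (x 0)|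
      ≤ ∫ t, ‖strip κ |x 1 - κ (x 0)| G (pt (x 0, t))‖)
    {a' b' : ℝ} (hτ : IntegrableOn τ (Icc a' b')) :
    ∀ᵐ s, s ∈ Ioo a' b' → HasTraceAt U v (pt (s, κ s)) (τ s) := by
  -- The differentiation theorem needs a locally integrable function on the whole line, and τ is
  -- controlled only on [a', b'].
  set τ' := (Icc a' b').indicator τ with hτ'
  have hτi : Integrable τ' := (integrable_indicator_iff measurableSet_Icc).2 hτ
  have hJ : ∀ R, Integrable fun r => ∫ t, ‖strip κ R G (pt (r, t))‖ := fun R =>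
    integrable_fiber_norm (integrable_strip hκ.continuous R hG)
  have h1 := IsUnifLocDoublingMeasure.ae_tendsto_average_norm_sub (μ := (volume : Measure ℝ))
    hτi.locallyIntegrable 1
  -- Only countably many strip heights 1 / (m + 1) are used, so that the exceptional sets add up to
  -- a null set.
  have h2 : ∀ᵐ s : ℝ, ∀ m : ℕ, ∀ {ι : Type} {l : Filter ι} (w : ι → ℝ) (δ : ι → ℝ)
      (_ : Tendsto δ l (𝓝[>] 0)) (_ : ∀ᶠ j in l, s ∈ Metric.closedBall (w j) (1 * δ j)),
      Tendsto (fun j => ⨍ r in Metric.closedBall (w j) (δ j),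
        ∫ t, ‖strip κ (1 / ((m : ℝ) + 1)) G (pt (r, t))‖) l
        (𝓝 (∫ t, ‖strip κ (1 / ((m : ℝ) + 1)) G (pt (s, t))‖)) := by
    rw [ae_all_iff]
    intro m
    exact IsUnifLocDoublingMeasure.ae_tendsto_average (μ := (volume : Measure ℝ)) (hJ _).locallyIntegrable 1
  filter_upwards [h1, h2, ae_integrable_fiber hG] with s hs1 hs2 hs3 hs
  have hself : Tendsto (fun ρ : ℝ => ρ) (𝓝[>] (0 : ℝ)) (𝓝[>] 0) := tendsto_id
  have hmem : ∀ᶠ ρ : ℝ in 𝓝[>] (0 : ℝ), s ∈ Metric.closedBall s (1 * ρ) := by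
    filter_upwards [self_mem_nhdsWithin] with ρ (hρ : 0 < ρ)
    simp [hρ.le]
  have hs1' := hs1 (fun _ => s) (fun ρ : ℝ => ρ) hself hmem
  have hs2' := fun m => hs2 m (fun _ => s) (fun ρ : ℝ => ρ) hself hmem
  have hτs : τ' s = τ s := indicator_of_mem (Ioo_subset_Icc_self hs) _
  rw [hτs] at hs1'
  rw [HasTraceAt, tendsto_order]
  have hnn : ∀ ρ : ℝ, 0 ≤ (ρ ^ 2)⁻¹ * ∫ y in U ∩ Metric.ball (pt (s, κ s)) ρ, |v y - τ s| :=
    fun ρ => mul_nonneg (inv_nonneg.2 (sq_nonneg _)) (integral_nonneg fun _ => abs_nonneg _)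
  refine ⟨fun c hc => Eventually.of_forall fun ρ => hc.trans_le (hnn ρ), fun c hc => ?_⟩
  obtain ⟨m, hm⟩ := ((tendsto_integral_strip (κ := κ) hs3).eventually
    (gt_mem_nhds (show (0 : ℝ) < c / 4 by linarith))).exists
  -- An integral over an interval of length 2ρ times 2ρ / ρ² is four times the mean value; hence
  -- also the threshold c / 4 above.
  have hlim := (hs1'.add (hs2' m)).const_mul 4
  rw [zero_add] at hlim
  have hev := hlim.eventually (gt_mem_nhds (show _ < c by linarith))
  have hsm1 : ∀ᶠ ρ : ℝ in 𝓝[>] (0 : ℝ), (1 + (L : ℝ)) * ρ ≤ 1 / ((m : ℝ) + 1) := by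
    have hc : Tendsto (fun ρ : ℝ => (1 + (L : ℝ)) * ρ) (𝓝[>] 0) (𝓝 0) := by
      have : Continuous fun ρ : ℝ => (1 + (L : ℝ)) * ρ := by fun_prop
      simpa using (this.tendsto 0).mono_left nhdsWithin_le_nhds
    filter_upwards [hc.eventually (gt_mem_nhds (show (0 : ℝ) < 1 / ((m : ℝ) + 1) by positivity))]
      with ρ h using h.le
  have hsm2 : ∀ᶠ ρ : ℝ in 𝓝[>] (0 : ℝ), a' ≤ s - ρ ∧ s + ρ ≤ b' := by
    have : ∀ᶠ ρ : ℝ in 𝓝 (0 : ℝ), ρ < s - a' ∧ ρ < b' - s :=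
      (gt_mem_nhds (by linarith [hs.1])).and (gt_mem_nhds (by linarith [hs.2]))
    filter_upwards [nhdsWithin_le_nhds this] with ρ h
    exact ⟨by linarith, by linarith⟩
  filter_upwards [hev, hsm1, hsm2, self_mem_nhdsWithin] with ρ e1 e2 e3 (hρ : 0 < ρ)
  refine lt_of_le_of_lt ?_ e1
  have hsub : Icc (s - ρ) (s + ρ) ⊆ Icc a' b' := Icc_subset_Icc e3.1 e3.2
  have hle := setIntegral_le_square hUm hG hκ hv hρ e2 (hτ.mono_set hsub)
  have hi1 : IntegrableOn (fun r => ‖τ r - τ s‖) (Icc (s - ρ) (s + ρ)) :=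
    ((hτ.mono_set hsub).sub (integrableOn_const (by simp) (by simp))).norm
  rw [integral_add hi1 (hJ _).integrableOn] at hle
  have hcong : ∫ r in Icc (s - ρ) (s + ρ), ‖τ' r - τ s‖ = ∫ r in Icc (s - ρ) (s + ρ), ‖τ r - τ s‖ :=
    setIntegral_congr_fun measurableSet_Icc fun r hr => by
      simp only [hτ', indicator_of_mem (hsub hr)]
  rw [setAverage_eq, setAverage_eq, Real.closedBall_eq_Icc, hcong,
    Real.volume_real_Icc_of_le (by linarith)]
  refine (mul_le_mul_of_nonneg_left hle (inv_nonneg.2 (sq_nonneg ρ))).trans_eq ?_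
  rw [show s + ρ - (s - ρ) = 2 * ρ by ring, smul_eq_mul, smul_eq_mul]
  generalize (∫ r in Icc (s - ρ) (s + ρ), ‖τ r - τ s‖) = X
  generalize (∫ r in Icc (s - ρ) (s + ρ), ∫ t, ‖strip κ (1 / ((m : ℝ) + 1)) G (pt (r, t))‖) = Y
  field_simp
  ring

/-- Existence of the trace at almost every point of a Lipschitz graph. -/
theorem ae_hasTraceAt {U : Set Plane} (hUm : MeasurableSet U) {v : Plane → ℝ} {τ : ℝ → ℝ}
    {G : Plane → ℝ} (hG : Integrable G) {κ : ℝ → ℝ} {L : ℝ≥0} (hκ : LipschitzWith L κ)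
    (hv : ∀ᵐ x ∂(volume.restrict U), |v x - τ (x 0)|
      ≤ ∫ t, ‖strip κ |x 1 - κ (x 0)| G (pt (x 0, t))‖)
    {a b : ℝ} (hτ : ∀ a' b', a < a' → b' < b → IntegrableOn τ (Icc a' b')) :
    ∀ᵐ s, s ∈ Ioo a b → HasTraceAt U v (pt (s, κ s)) (τ s) := by
  -- Exhaustion of (a, b) by compact intervals, since τ need not be integrable up to the ends.
  have h : ∀ᵐ s : ℝ, ∀ n : ℕ, s ∈ Ioo (a + 1 / ((n : ℝ) + 1)) (b - 1 / ((n : ℝ) + 1)) →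
      HasTraceAt U v (pt (s, κ s)) (τ s) := by
    rw [ae_all_iff]
    intro n
    have : (0 : ℝ) < 1 / ((n : ℝ) + 1) := by positivity
    exact ae_hasTraceAt_of_mem hUm hG hκ hv (hτ _ _ (by linarith) (by linarith))
  filter_upwards [h] with s hs hmem
  obtain ⟨n, hn⟩ := exists_nat_one_div_lt (show 0 < min (s - a) (b - s) from
    lt_min (by linarith [hmem.1]) (by linarith [hmem.2]))
  rw [lt_min_iff] at hn
  exact hs n ⟨by linarith, by linarith⟩

/-! ### Normals and the boundary condition along graphs. -/

/-- The projection to x_1 is 1-Lipschitz, so it maps ℋ¹-null sets to Lebesgue null sets. -/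
theorem ae_graph_of_ae_hausdorff {F : Set Plane} (hF : MeasurableSet F) {P : Plane → Prop}
    (h : ∀ᵐ x ∂((Measure.hausdorffMeasure 1 : Measure Plane).restrict F), P x)
    {I : Set ℝ} {κ : ℝ → ℝ} (hI : ∀ s ∈ I, pt (s, κ s) ∈ F) :
    ∀ᵐ s : ℝ, s ∈ I → P (pt (s, κ s)) := by
  rw [ae_restrict_iff' hF, ae_iff] at h
  have hl : LipschitzWith 1 fun x : Plane => x 0 :=
    LipschitzWith.of_dist_le_mul fun x y => by
      rw [Real.dist_eq, NNReal.coe_one, one_mul]; exact abs_coord_sub_le_dist x y 0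
  have h1 := (hl.lipschitzOnWith (s := {x | ¬(x ∈ F → P x)})).hausdorffMeasure_image_le
    (d := 1) zero_le_one
  rw [h, mul_zero, hausdorffMeasure_real] at h1
  rw [ae_iff]
  refine measure_mono_null ?_ (le_antisymm h1 bot_le)
  intro s hs
  rw [mem_ofPred_eq, Classical.not_imp] at hs
  exact ⟨pt (s, κ s), fun h => hs.2 (h (hI s hs.1)), rfl⟩

theorem volume_band {g : ℝ → ℝ} (hg : Continuous g) (α β h : ℝ) :
    volume {y : Plane | y 0 ∈ Icc α β ∧ |y 1 - g (y 0)| ≤ h}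
      = ENNReal.ofReal (2 * h) * ENNReal.ofReal (β - α) := by
  have hm : MeasurableSet {y : Plane | y 0 ∈ Icc α β ∧ |y 1 - g (y 0)| ≤ h} :=
    ((continuous_coord 0).measurable measurableSet_Icc).inter (measurableSet_strip hg h)
  rw [← measurePreserving_pt.measure_preimage hm.nullMeasurableSet, Measure.volume_eq_prod,
    Measure.prod_apply (continuous_pt.measurable hm)]
  have : ∀ s : ℝ, volume (Prod.mk s ⁻¹' (pt ⁻¹' {y : Plane | y 0 ∈ Icc α β ∧ |y 1 - g (y 0)| ≤ h}))
      = (Icc α β).indicator (fun _ => ENNReal.ofReal (2 * h)) s := by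
    intro s
    by_cases hs : s ∈ Icc α β
    · rw [indicator_of_mem hs]
      have e : Prod.mk s ⁻¹' (pt ⁻¹' {y : Plane | y 0 ∈ Icc α β ∧ |y 1 - g (y 0)| ≤ h})
          = Icc (g s - h) (g s + h) := by
        ext t
        simp only [mem_preimage, mem_ofPred_eq, pt_zero, pt_one, abs_le, mem_Icc]
        constructor
        · rintro ⟨-, h1, h2⟩
          constructor <;> linarith
        · rintro ⟨h1, h2⟩
          exact ⟨hs, by linarith, by linarith⟩
      rw [e, Real.volume_Icc]
      congr 1; ring
    · rw [indicator_of_notMem hs]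
      have e : Prod.mk s ⁻¹' (pt ⁻¹' {y : Plane | y 0 ∈ Icc α β ∧ |y 1 - g (y 0)| ≤ h}) = ∅ := by
        ext t
        simp only [mem_preimage, mem_ofPred_eq, pt_zero, hs, false_and, mem_empty_iff_false]
      rw [e, measure_empty]
  simp_rw [this]
  rw [lintegral_indicator_const measurableSet_Icc, Real.volume_Icc]

/-- The band about the line has area 4 ε ρ², and ε is arbitrary. -/
theorem tendsto_of_subset_band {κ' s z : ℝ} {S : ℝ → Set Plane}
    (hS : ∀ ε : ℝ, 0 < ε → ∀ᶠ ρ in 𝓝[>] (0 : ℝ),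
      S ρ ⊆ {y : Plane | y 0 ∈ Icc (s - ρ) (s + ρ) ∧ |y 1 - (z + κ' * (y 0 - s))| ≤ ε * ρ}) :
    Tendsto (fun ρ : ℝ => (ρ ^ 2)⁻¹ * volume.real (S ρ)) (𝓝[>] 0) (𝓝 0) := by
  rw [tendsto_order]
  refine ⟨fun c hc => Eventually.of_forall fun ρ => hc.trans_le
    (mul_nonneg (inv_nonneg.2 (sq_nonneg _)) measureReal_nonneg), fun c hc => ?_⟩
  filter_upwards [hS (c / 8) (by linarith), self_mem_nhdsWithin] with ρ h (hρ : 0 < ρ)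
  have hv := volume_band (g := fun r => z + κ' * (r - s)) (by fun_prop) (s - ρ) (s + ρ) (c / 8 * ρ)
  have h1 := measureReal_mono (μ := volume) h (by
    rw [hv]; exact ENNReal.mul_ne_top ENNReal.ofReal_ne_top ENNReal.ofReal_ne_top)
  replace h1 := h1.trans_eq (congrArg ENNReal.toReal hv)
  rw [ENNReal.toReal_mul,
    ENNReal.toReal_ofReal (by positivity),
    ENNReal.toReal_ofReal (by linarith)] at h1
  calc (ρ ^ 2)⁻¹ * volume.real (S ρ) ≤ (ρ ^ 2)⁻¹ * (2 * (c / 8 * ρ) * (s + ρ - (s - ρ))) :=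
        mul_le_mul_of_nonneg_left h1 (inv_nonneg.2 (sq_nonneg _))
    _ = c / 2 := by
        rw [show s + ρ - (s - ρ) = 2 * ρ by ring]; field_simp; ring
    _ < c := by linarith

theorem inner_plane (x y : Plane) : inner ℝ x y = x 0 * y 0 + x 1 * y 1 := by
  simp [PiLp.inner_apply, Fin.sum_univ_two, mul_comm]

/-- The outer normal at a point of differentiability of a graph which locally bounds `U`. -/
theorem isOuterNormal_graph {U : Set Plane} {κ : ℝ → ℝ} {s κ' σ : ℝ} (hσ : |σ| = 1)
    (hκ : HasDerivAt κ κ' s)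
    (hU : ∀ᶠ y in 𝓝 (pt (s, κ s)), y ∈ U ↔ 0 < σ * (y 1 - κ (y 0))) :
    IsOuterNormal U (pt (s, κ s)) ((σ * (√(1 + κ' ^ 2))⁻¹) • pt (κ', -1)) := by
  have hN : 0 < √(1 + κ' ^ 2) := Real.sqrt_pos.2 (by positivity)
  have hin : ∀ y : Plane, inner ℝ (y - pt (s, κ s)) ((σ * (√(1 + κ' ^ 2))⁻¹) • pt (κ', -1))
      = (√(1 + κ' ^ 2))⁻¹ * (σ * -(y 1 - (κ s + κ' * (y 0 - s)))) := by
    intro y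
    rw [inner_plane]
    simp
    ring
  have hσ2 : σ * σ = 1 := by rw [← abs_mul_abs_self, hσ, one_mul]
  -- In a small ball the graph stays within ε ρ of its tangent line, and U is described there by the
  -- graph.
  have hd : ∀ ε : ℝ, 0 < ε → ∀ᶠ ρ in 𝓝[>] (0 : ℝ), ∀ y ∈ Metric.ball (pt (s, κ s)) ρ,
      (y ∈ U ↔ 0 < σ * (y 1 - κ (y 0))) ∧ y 0 ∈ Icc (s - ρ) (s + ρ) ∧
      |κ (y 0) - (κ s + κ' * (y 0 - s))| ≤ ε * ρ := by
    intro ε hε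
    have h1 := (hasDerivAt_iff_isLittleO.1 hκ).def hε
    rw [Metric.eventually_nhds_iff] at h1 hU
    obtain ⟨δ, hδ, h1⟩ := h1
    obtain ⟨δ', hδ', hU⟩ := hU
    filter_upwards [nhdsWithin_le_nhds (gt_mem_nhds hδ), nhdsWithin_le_nhds (gt_mem_nhds hδ')]
      with ρ h2 h3 y hy
    have h4 : |y 0 - s| ≤ dist y (pt (s, κ s)) := abs_coord_sub_le_dist y (pt (s, κ s)) 0
    have h5 := Metric.mem_ball.1 hy
    have h6 := h1 (y := y 0) (by rw [Real.dist_eq]; linarith)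
    refine ⟨hU (by linarith), ?_, ?_⟩
    · have := abs_le.1 (h4.trans h5.le)
      exact ⟨by linarith, by linarith⟩
    · rw [Real.norm_eq_abs, Real.norm_eq_abs, smul_eq_mul] at h6
      rw [show κ (y 0) - (κ s + κ' * (y 0 - s)) = κ (y 0) - κ s - (y 0 - s) * κ' by ring]
      exact h6.trans (mul_le_mul_of_nonneg_left (h4.trans h5.le) hε.le)
  refine ⟨?_, ?_, ?_⟩
  · rw [norm_smul, norm_mul, Real.norm_eq_abs, hσ, one_mul, norm_inv, Real.norm_of_nonneg hN.le,
      EuclideanSpace.norm_eq, Fin.sum_univ_two]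
    simp only [pt_zero, pt_one, Real.norm_eq_abs, sq_abs]
    rw [show κ' ^ 2 + (-1) ^ 2 = 1 + κ' ^ 2 by ring]
    exact inv_mul_cancel₀ hN.ne'
  -- A point of U on the outer side of the tangent lies between the tangent and the graph, hence in
  -- the band; the other limit is the mirror image.
  · refine tendsto_of_subset_band (κ' := κ') (s := s) (z := κ s) fun ε hε => ?_
    filter_upwards [hd ε hε] with ρ h y hy
    obtain ⟨⟨hyB, hyU⟩, hyI⟩ := hy
    obtain ⟨h1, h2, h3⟩ := h y hyB
    refine ⟨h2, ?_⟩
    rw [mem_ofPred_eq, hin] at hyI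
    have h4 := pos_of_mul_pos_right hyI (inv_pos.2 hN).le
    have h5 := h1.1 hyU
    generalize y 1 = p at *
    generalize κ s + κ' * (y 0 - s) = q at *
    generalize κ (y 0) = k at *
    rcases abs_eq (zero_le_one' ℝ) |>.1 hσ with rfl | rfl
    · rw [abs_le] at h3 ⊢; constructor <;> linarith
    · rw [abs_le] at h3 ⊢; constructor <;> linarith
  · refine tendsto_of_subset_band (κ' := κ') (s := s) (z := κ s) fun ε hε => ?_
    filter_upwards [hd ε hε] with ρ h y hy
    obtain ⟨⟨hyB, hyU⟩, hyI⟩ := hy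
    obtain ⟨h1, h2, h3⟩ := h y hyB
    refine ⟨h2, ?_⟩
    rw [mem_ofPred_eq, hin] at hyI
    have h4 : σ * -(y 1 - (κ s + κ' * (y 0 - s))) < 0 := by
      by_contra! hc
      exact absurd hyI (not_lt.2 (mul_nonneg (inv_pos.2 hN).le hc))
    have h5 := not_lt.1 (fun hc => hyU (h1.2 hc))
    generalize y 1 = p at *
    generalize κ s + κ' * (y 0 - s) = q at *
    generalize κ (y 0) = k at *
    rcases abs_eq (zero_le_one' ℝ) |>.1 hσ with rfl | rfl
    · rw [abs_le] at h3 ⊢; constructor <;> linarith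
    · rw [abs_le] at h3 ⊢; constructor <;> linarith

/-- Almost every point of a Lipschitz graph in the boundary is such that every trace there
coincides with the boundary datum. -/
theorem ae_trace_eq {U : Set Plane} {w u₀ : Plane → ℝ} (h : VerticalBoundaryCondition U w u₀)
    {κ : ℝ → ℝ} {L : ℝ≥0} (hκ : LipschitzWith L κ) {σ : ℝ} (hσ : |σ| = 1) {I : Set ℝ}
    (hU : ∀ s ∈ I, ∀ᶠ y in 𝓝 (pt (s, κ s)), y ∈ U ↔ 0 < σ * (y 1 - κ (y 0))) :
    ∀ᵐ s : ℝ, s ∈ I → ∀ t, HasTraceAt U w (pt (s, κ s)) t → t = u₀ (pt (s, κ s)) := by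
  have hσ0 : σ ≠ 0 := by rintro rfl; simp at hσ
  have hfr : ∀ s ∈ I, pt (s, κ s) ∈ frontier U := by
    intro s hs
    have hnot : pt (s, κ s) ∉ U := by
      have := (hU s hs).self_of_nhds
      simp only [pt_zero, pt_one, sub_self, mul_zero, lt_irrefl, iff_false] at this
      exact this
    refine ⟨?_, fun hi => hnot (interior_subset hi)⟩
    have ht : Tendsto (fun r : ℝ => pt (s, κ s + σ * r)) (𝓝[>] 0) (𝓝 (pt (s, κ s))) := by
      have hc : Continuous fun r : ℝ => pt (s, κ s + σ * r) := continuous_pt.comp (by fun_prop)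
      have := (hc.tendsto 0).mono_left (nhdsWithin_le_nhds (s := Ioi 0))
      simpa using this
    refine mem_closure_of_tendsto ht ?_
    filter_upwards [ht.eventually (hU s hs), self_mem_nhdsWithin] with r hr (hr0 : 0 < r)
    rw [hr, pt_one, pt_zero, add_sub_cancel_left, ← mul_assoc, ← abs_mul_abs_self, hσ]
    linarith
  filter_upwards [ae_graph_of_ae_hausdorff isClosed_frontier.measurableSet h hfr,
    hκ.ae_differentiableAt] with s hs hd hsI t ht
  have h1 := hs hsI t _ ht (isOuterNormal_graph hσ hd.hasDerivAt (hU s hsI))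
  rcases mul_eq_zero.1 h1 with h2 | h2
  · linarith
  -- The second component of the normal of a graph is -σ / √(1 + κ'²) and never vanishes.
  · exfalso
    have hN : 0 < √(1 + deriv κ s ^ 2) := Real.sqrt_pos.2 (by positivity)
    simp [hσ0, hN.ne'] at h2

/-! ### Lipschitz functions and their weak derivatives. -/

section Lipschitz

variable {f : Plane → ℝ} {L : ℝ≥0}

theorem measurable_pderiv (f : Plane → ℝ) (i : Fin 2) : Measurable (pderiv i f) :=
  measurable_fderiv_apply_const ℝ f _

theorem norm_pderiv_le (hf : LipschitzWith L f) (i : Fin 2) (x : Plane) : ‖pderiv i f x‖ ≤ L := by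
  refine ((fderiv ℝ f x).le_opNorm _).trans ?_
  rw [show ‖EuclideanSpace.single i (1 : ℝ)‖ = 1 by simp, mul_one]
  exact norm_fderiv_le_of_lipschitz ℝ hf

theorem locallyIntegrable_pderiv (hf : LipschitzWith L f) (i : Fin 2) :
    LocallyIntegrable (pderiv i f) := by
  rw [locallyIntegrable_iff]
  intro K hK
  refine Measure.integrableOn_of_bounded (M := L) hK.measure_lt_top.ne
    (measurable_pderiv f i).aestronglyMeasurable ?_
  exact Eventually.of_forall fun x => norm_pderiv_le hf i x

theorem lipschitz_of_isTest {U : Set Plane} {φ : Plane → ℝ} (hφ : IsTest U φ) :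
    ∃ D : ℝ≥0, LipschitzWith D φ :=
  ContDiff.lipschitzWith_of_hasCompactSupport hφ.hasCompactSupport hφ.smooth (by simp)

/-- By Rademacher's theorem the directional derivatives of f coincide almost everywhere with
`pderiv`, and integration by parts is available for these. -/
theorem integral_mul_pderiv (hf : LipschitzWith L f) (i : Fin 2) {φ : Plane → ℝ}
    {U : Set Plane} (hφ : IsTest U φ) :
    ∫ x, f x * pderiv i φ x = -∫ x, pderiv i f x * φ x := by
  obtain ⟨D, hD⟩ := lipschitz_of_isTest hφ
  have h := LipschitzWith.integral_lineDeriv_mul_eq (μ := volume) hf hD hφ.hasCompactSupport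
    (EuclideanSpace.single i (1 : ℝ))
  have h1 : ∫ x, lineDeriv ℝ f x (EuclideanSpace.single i (1 : ℝ)) * φ x
      = ∫ x, pderiv i f x * φ x := by
    refine integral_congr_ae ?_
    filter_upwards [hf.ae_differentiableAt] with x hx
    simp only [hx.lineDeriv_eq_fderiv, pderiv]
  have h2 : ∀ x, lineDeriv ℝ φ x (-EuclideanSpace.single i (1 : ℝ)) = -pderiv i φ x := by
    intro x
    rw [((hφ.smooth.differentiable (by simp)) x).lineDeriv_eq_fderiv, map_neg, pderiv]
  rw [h1] at h
  simp_rw [h2] at h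
  rw [h, ← integral_neg]
  congr 1; ext x; ring

theorem setIntegral_isTest {U : Set Plane} {φ : Plane → ℝ} (hφ : IsTest U φ) (g : Plane → ℝ) :
    ∫ x in U, g x * φ x = ∫ x, g x * φ x :=
  setIntegral_eq_integral_of_forall_compl_eq_zero fun x hx => by
    rw [image_eq_zero_of_notMem_tsupport fun h => hx (hφ.tsupport_subset h), mul_zero]

theorem setIntegral_isTest_pderiv {U : Set Plane} {φ : Plane → ℝ} (hφ : IsTest U φ) (i : Fin 2)
    (g : Plane → ℝ) : ∫ x in U, g x * pderiv i φ x = ∫ x, g x * pderiv i φ x :=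
  setIntegral_eq_integral_of_forall_compl_eq_zero fun x hx => by
    rw [pderiv_eq_zero_of_notMem_tsupport (fun h => hx (hφ.tsupport_subset h)), mul_zero]

theorem isWeakPartial_of_lipschitz (hf : LipschitzWith L f) (U : Set Plane) (i : Fin 2) :
    IsWeakPartial U i f (pderiv i f) where
  locallyIntegrable := hf.continuous.locallyIntegrable.locallyIntegrableOn U
  locallyIntegrable_deriv := (locallyIntegrable_pderiv hf i).locallyIntegrableOn U
  integral_eq φ hφ := by
    rw [setIntegral_isTest hφ, setIntegral_isTest_pderiv hφ, integral_mul_pderiv hf i hφ]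

end Lipschitz

/-! ### The difference w - u₀ as a vertical primitive. -/

section Domain

variable {a b : ℝ} {κ₁ κ₂ : ℝ → ℝ}

theorem isOpen_between (h₁ : Continuous κ₁) (h₂ : Continuous κ₂) {I : Set ℝ} (hI : IsOpen I) :
    IsOpen (between I κ₁ κ₂) :=
  (hI.preimage (continuous_coord 0)).inter
    ((isOpen_lt (h₁.comp (continuous_coord 0)) (continuous_coord 1)).inter
      (isOpen_lt (continuous_coord 1) (h₂.comp (continuous_coord 0))))

theorem isBounded_between (h₁ : Continuous κ₁) (h₂ : Continuous κ₂) (a b : ℝ) :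
    Bornology.IsBounded {x : Plane | x 0 ∈ Icc a b ∧ κ₁ (x 0) ≤ x 1 ∧ x 1 ≤ κ₂ (x 0)} := by
  obtain ⟨C₁, hC₁⟩ := (isCompact_Icc (a := a) (b := b)).exists_bound_of_continuousOn h₁.continuousOn
  obtain ⟨C₂, hC₂⟩ := (isCompact_Icc (a := a) (b := b)).exists_bound_of_continuousOn h₂.continuousOn
  refine (Metric.isBounded_closedBall (x := (0 : Plane)) (r := |a| + |b| + (C₁ + C₂))).subset ?_
  rintro x ⟨h0, h1, h2⟩
  rw [Metric.mem_closedBall, dist_zero_right]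
  have e1 := abs_le.1 (hC₁ _ h0)
  have e2 := abs_le.1 (hC₂ _ h0)
  have e3 : |x 0| ≤ |a| + |b| := by
    rw [abs_le]
    constructor
    · linarith [h0.1, neg_abs_le a, abs_nonneg b]
    · linarith [h0.2, le_abs_self b, abs_nonneg a]
  have e4 : |x 1| ≤ C₁ + C₂ := by
    rw [abs_le]; constructor <;> linarith
  linarith [norm_le_abs_add_abs x]

theorem between_subset : between (Ioo a b) κ₁ κ₂
    ⊆ {x : Plane | x 0 ∈ Icc a b ∧ κ₁ (x 0) ≤ x 1 ∧ x 1 ≤ κ₂ (x 0)} :=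
  fun _ hx => ⟨Ioo_subset_Icc_self hx.1, hx.2.1.le, hx.2.2.le⟩

theorem volume_between_lt_top (h₁ : Continuous κ₁) (h₂ : Continuous κ₂) :
    volume (between (Ioo a b) κ₁ κ₂) < ⊤ :=
  ((isBounded_between h₁ h₂ a b).subset between_subset).measure_lt_top

/-- On the ball u₀ oscillates by at most L ρ, and the ball has area π ρ², so the additional error is
L π ρ after division by ρ². -/
theorem hasTraceAt_add_lipschitz {U : Set Plane} {v w u₀ : Plane → ℝ}
    {L : ℝ≥0} (hu₀ : LipschitzWith L u₀) (hv : IntegrableOn v U)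
    (hvw : ∀ᵐ x ∂(volume.restrict U), v x = w x - u₀ x) {x : Plane} {t : ℝ}
    (h : HasTraceAt U v x t) : HasTraceAt U w x (t + u₀ x) := by
  have hlim : Tendsto (fun ρ : ℝ => (ρ ^ 2)⁻¹ * (∫ y in U ∩ Metric.ball x ρ, |v y - t|)
      + L * Real.pi * ρ) (𝓝[>] 0) (𝓝 0) := by
    have hc : Continuous fun ρ : ℝ => (L : ℝ) * Real.pi * ρ := by fun_prop
    have := h.add ((hc.tendsto 0).mono_left (nhdsWithin_le_nhds (s := Ioi 0)))
    simpa using this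
  refine squeeze_zero' (Eventually.of_forall fun ρ => mul_nonneg (inv_nonneg.2 (sq_nonneg _))
    (integral_nonneg fun _ => abs_nonneg _)) ?_ hlim
  filter_upwards [self_mem_nhdsWithin] with ρ (hρ : 0 < ρ)
  have hfin : volume (U ∩ Metric.ball x ρ) < ⊤ :=
    (measure_mono inter_subset_right).trans_lt measure_ball_lt_top
  have hi : IntegrableOn (fun y => |v y - t|) (U ∩ Metric.ball x ρ) :=
    ((hv.mono_set inter_subset_left).sub (integrableOn_const hfin.ne (by simp))).abs
  have hc : IntegrableOn (fun _ : Plane => (L : ℝ) * ρ) (U ∩ Metric.ball x ρ) :=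
    integrableOn_const hfin.ne enorm_ne_top
  have h1 : ∫ y in U ∩ Metric.ball x ρ, |w y - (t + u₀ x)|
      ≤ ∫ y in U ∩ Metric.ball x ρ, (|v y - t| + L * ρ) := by
    refine integral_mono_of_nonneg (Eventually.of_forall fun _ => abs_nonneg _) (hi.add hc) ?_
    have h2 : ∀ᵐ y ∂(volume.restrict (U ∩ Metric.ball x ρ)), v y = w y - u₀ y :=
      ae_mono (Measure.restrict_mono inter_subset_left le_rfl) hvw
    have h3 : ∀ᵐ y ∂(volume.restrict (U ∩ Metric.ball x ρ)), y ∈ Metric.ball x ρ :=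
      ae_mono (Measure.restrict_mono inter_subset_right le_rfl)
        (ae_restrict_mem Metric.isOpen_ball.measurableSet)
    filter_upwards [h2, h3] with y hy hyB
    have h4 := hu₀.dist_le_mul y x
    rw [Real.dist_eq] at h4
    have h5 : (L : ℝ) * dist y x ≤ L * ρ :=
      mul_le_mul_of_nonneg_left (Metric.mem_ball.1 hyB).le L.2
    have h6 := abs_add_le (v y - t) (u₀ y - u₀ x)
    rw [hy] at h6 ⊢
    rw [show w y - (t + u₀ x) = w y - u₀ y - t + (u₀ y - u₀ x) by ring]
    linarith
  rw [integral_add hi hc, setIntegral_const, smul_eq_mul] at h1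
  have h7 : volume.real (U ∩ Metric.ball x ρ) ≤ ρ ^ 2 * Real.pi := by
    refine (measureReal_mono inter_subset_right measure_ball_lt_top.ne).trans_eq ?_
    rw [measureReal_def, EuclideanSpace.volume_ball_fin_two, ENNReal.toReal_mul,
      ENNReal.toReal_pow, ENNReal.toReal_ofReal hρ.le, ENNReal.toReal_ofReal Real.pi_nonneg]
  have h8 := mul_le_mul_of_nonneg_left (h1.trans (add_le_add le_rfl
    (mul_le_mul_of_nonneg_right h7 (mul_nonneg L.2 hρ.le)))) (inv_nonneg.2 (sq_nonneg ρ))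
  refine h8.trans_eq ?_
  field_simp

/-- A function which is constant along the vertical sections of the domain is a function of
`x_1` which is integrable on compact intervals. -/
theorem exists_fiber_value (h₁ : Continuous κ₁) (h₂ : Continuous κ₂)
    (hκ : ∀ s ∈ Ioo a b, κ₁ s < κ₂ s) {W : Plane → ℝ}
    (hW : LocallyIntegrable W)
    (hw : ∀ φ, IsTest (between (Ioo a b) κ₁ κ₂) φ → ∫ x, W x * pderiv 1 φ x = 0) :
    ∃ c : ℝ → ℝ, (∀ a' b', a < a' → b' < b → IntegrableOn c (Icc a' b')) ∧
      ∀ᵐ x ∂(volume.restrict (between (Ioo a b) κ₁ κ₂)), W x = c (x 0) := by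
  set Ω := between (Ioo a b) κ₁ κ₂ with hΩ
  have hΩo : IsOpen Ω := isOpen_between h₁ h₂ isOpen_Ioo
  have hΩm : MeasurableSet Ω := hΩo.measurableSet
  have hconv : ∀ x ∈ Ω, ∀ y ∈ Ω, x 0 = y 0 → ∀ t ∈ Icc (x 1) (y 1), pt (x 0, t) ∈ Ω := by
    rintro x ⟨hx0, hx1, -⟩ y ⟨-, -, hy2⟩ h t ht
    rw [← h] at hy2
    exact ⟨hx0, hx1.trans_le ht.1, ht.2.trans_lt hy2⟩
  obtain ⟨E, hE, hEW⟩ := ae_fiber_const hΩo hconv hW hw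
  have hWi : Integrable (Ω.indicator W) := by
    rw [integrable_indicator_iff hΩm]
    obtain ⟨R, hR⟩ := (isBounded_between h₁ h₂ a b).subset_closedBall (0 : Plane)
    exact (hW.integrableOn_isCompact (isCompact_closedBall (0 : Plane) R)).mono_set
      (between_subset.trans hR)
  have hWi2 : Integrable fun s : ℝ => ∫ t, Ω.indicator W (pt (s, t)) := by
    have := integrable_comp_pt hWi
    rw [Measure.volume_eq_prod] at this
    exact this.integral_prod_left
  -- The value on a section is its mean value, which makes measurability and integrability visible.
  -- Integrability is local because the graphs may meet over a and b.
  refine ⟨fun s => (κ₂ s - κ₁ s)⁻¹ * ∫ t, Ω.indicator W (pt (s, t)), ?_, ?_⟩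
  · intro a' b' ha' hb'
    refine IntegrableOn.continuousOn_mul (ContinuousOn.inv₀ (by fun_prop) fun s hs => ?_)
      hWi2.integrableOn isCompact_Icc
    have := hκ s ⟨ha'.trans_le hs.1, hs.2.trans_lt hb'⟩
    linarith
  · rw [ae_restrict_iff' hΩm]
    have hE2 : ∀ᵐ p : ℝ × ℝ, ∀ᵐ t : ℝ, pt (p.1, t) ∈ E := by
      rw [Measure.volume_eq_prod]
      refine Measure.quasiMeasurePreserving_fst.ae (p := fun s => ∀ᵐ t : ℝ, pt (s, t) ∈ E) ?_
      have := ae_plane_iff.1 hE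
      rw [Measure.volume_eq_prod] at this
      exact Measure.ae_ae_of_ae_prod this
    rw [ae_plane_iff]
    filter_upwards [hE2, ae_plane_iff.1 hE] with p hp hpE hpΩ
    have hs : κ₁ p.1 < κ₂ p.1 := hκ _ hpΩ.1
    have : ∫ t, Ω.indicator W (pt (p.1, t)) = ∫ t, (Ioo (κ₁ p.1) (κ₂ p.1)).indicator
        (fun _ => W (pt p)) t := by
      refine integral_congr_ae ?_
      filter_upwards [hp] with t ht
      by_cases hm : t ∈ Ioo (κ₁ p.1) (κ₂ p.1)
      · have hmΩ : pt (p.1, t) ∈ Ω := ⟨hpΩ.1, hm.1, hm.2⟩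
        rw [indicator_of_mem hm, indicator_of_mem hmΩ]
        exact hEW _ ⟨hmΩ, ht⟩ _ ⟨hpΩ, hpE⟩ rfl
      · have hmΩ : pt (p.1, t) ∉ Ω := fun h => hm ⟨h.2.1, h.2.2⟩
        rw [indicator_of_notMem hm, indicator_of_notMem hmΩ]
    simp only [pt_zero]
    rw [this, integral_indicator measurableSet_Ioo, setIntegral_const, smul_eq_mul,
      Real.volume_real_Ioo_of_le hs.le, inv_mul_cancel_left₀ (by linarith)]

/-- A function with the prescribed boundary values on both graphs is the primitive of its
derivative, which has mean value zero on almost every section. -/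
theorem exists_primitive (h₁' : ∃ L : ℝ≥0, LipschitzWith L κ₁) (h₂' : ∃ L : ℝ≥0, LipschitzWith L κ₂)
    (hκ : ∀ s ∈ Ioo a b, κ₁ s < κ₂ s) {Ω : Set Plane} (hΩ : Ω = between (Ioo a b) κ₁ κ₂)
    {u₀ : Plane → ℝ} {L : ℝ≥0} (hu₀ : LipschitzWith L u₀) {w d : Plane → ℝ}
    (hw : IntegrableOn w Ω) (hd : IntegrableOn d Ω) (hwd : IsWeakPartial Ω 1 w d)
    (hbd : VerticalBoundaryCondition Ω w u₀) :
    ∃ G : Plane → ℝ, Measurable G ∧ Integrable G ∧ (∀ x, x ∉ Ω → G x = 0) ∧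
      (∀ᵐ x ∂(volume.restrict Ω), G x = d x - pderiv 1 u₀ x) ∧
      (∀ᵐ x ∂(volume.restrict Ω), w x - u₀ x = vint G x) ∧
      ∀ᵐ s : ℝ, ∫ t, G (pt (s, t)) = 0 := by
  obtain ⟨L₁, hL₁⟩ := h₁'
  obtain ⟨L₂, hL₂⟩ := h₂'
  have h₁ := hL₁.continuous
  have h₂ := hL₂.continuous
  have hΩo : IsOpen Ω := by rw [hΩ]; exact isOpen_between h₁ h₂ isOpen_Ioo
  have hΩm : MeasurableSet Ω := hΩo.measurableSet
  have hΩf : volume Ω < ⊤ := by rw [hΩ]; exact volume_between_lt_top h₁ h₂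
  have hΩb : ∃ R, Ω ⊆ Metric.closedBall (0 : Plane) R := by
    obtain ⟨R, hR⟩ := (isBounded_between h₁ h₂ a b).subset_closedBall (0 : Plane)
    exact ⟨R, by rw [hΩ]; exact between_subset.trans hR⟩
  obtain ⟨R, hR⟩ := hΩb
  have hvi : IntegrableOn (fun x => w x - u₀ x) Ω :=
    hw.sub ((hu₀.continuous.locallyIntegrable.integrableOn_isCompact
      (isCompact_closedBall (0 : Plane) R)).mono_set hR)
  have hGi : IntegrableOn (fun x => d x - pderiv 1 u₀ x) Ω :=
    hd.sub (((locallyIntegrable_pderiv hu₀ 1).integrableOn_isCompact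
      (isCompact_closedBall (0 : Plane) R)).mono_set hR)
  obtain ⟨v, hvm, hv⟩ := hvi.aestronglyMeasurable
  obtain ⟨g, hgm, hg⟩ := hGi.aestronglyMeasurable
  set G := Ω.indicator g with hGdef
  set V := Ω.indicator v with hVdef
  have hGm : Measurable G := hgm.measurable.indicator hΩm
  have hGint : Integrable G := (integrable_indicator_iff hΩm).2 (hGi.congr hg)
  have hVint : Integrable V := (integrable_indicator_iff hΩm).2 (hvi.congr hv)
  have hG0 : ∀ x, x ∉ Ω → G x = 0 := fun x hx => indicator_of_notMem hx _
  have hGae : ∀ᵐ x ∂(volume.restrict Ω), G x = d x - pderiv 1 u₀ x := by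
    filter_upwards [hg, ae_restrict_mem hΩm] with x hx hm
    rw [hGdef, indicator_of_mem hm, hx]
  have hVae : ∀ᵐ x ∂(volume.restrict Ω), V x = w x - u₀ x := by
    filter_upwards [hv, ae_restrict_mem hΩm] with x hx hm
    rw [hVdef, indicator_of_mem hm, hx]
  have hloc := locallyIntegrable_vint hGm hGint
  have hWloc : LocallyIntegrable (V - vint G) := hVint.locallyIntegrable.sub hloc
  -- Both V and `vint G` have the weak derivative G in Ω, so their difference depends on x_1 alone
  -- there.
  have hWeak : ∀ φ, IsTest Ω φ → ∫ x, (V - vint G) x * pderiv 1 φ x = 0 := by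
    intro φ hφ
    have hpc := continuous_pderiv hφ.smooth 1
    have hps := hasCompactSupport_pderiv hφ.hasCompactSupport 1
    have e1 : ∫ x, V x * pderiv 1 φ x = -∫ x, G x * φ x := by
      rw [← setIntegral_isTest_pderiv hφ, ← setIntegral_isTest hφ]
      have e2 : ∫ x in Ω, V x * pderiv 1 φ x
          = ∫ x in Ω, (w x * pderiv 1 φ x - u₀ x * pderiv 1 φ x) :=
        integral_congr_ae (by filter_upwards [hVae] with x hx; rw [hx]; ring)
      have e3 : ∫ x in Ω, G x * φ x = ∫ x in Ω, (d x * φ x - pderiv 1 u₀ x * φ x) :=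
        integral_congr_ae (by filter_upwards [hGae] with x hx; rw [hx]; ring)
      obtain ⟨C, hC⟩ := bounded_of_isTest hφ
      obtain ⟨C', hC'⟩ := hpc.bounded_above_of_compact_support hps
      have hub := (hu₀.continuous.locallyIntegrable (μ := volume)).integrableOn_isCompact
        (isCompact_closedBall (0 : Plane) R) |>.mono_set hR
      have hdb := ((locallyIntegrable_pderiv hu₀ 1).integrableOn_isCompact
        (isCompact_closedBall (0 : Plane) R)).mono_set hR
      rw [e2, e3, integral_sub, integral_sub, hwd.integral_eq φ hφ,
        (isWeakPartial_of_lipschitz hu₀ Ω 1).integral_eq φ hφ]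
      · ring
      · exact hd.mul_bdd (c := C) hφ.smooth.continuous.aestronglyMeasurable (Eventually.of_forall hC)
      · exact hdb.mul_bdd (c := C) hφ.smooth.continuous.aestronglyMeasurable
          (Eventually.of_forall hC)
      · exact hw.mul_bdd (c := C') hpc.aestronglyMeasurable (Eventually.of_forall hC')
      · exact hub.mul_bdd (c := C') hpc.aestronglyMeasurable (Eventually.of_forall hC')
    have i1 : Integrable fun x => V x * pderiv 1 φ x := by
      simpa only [smul_eq_mul, mul_comm] using
        hVint.locallyIntegrable.integrable_smul_left_of_hasCompactSupport hpc hps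
    have i2 : Integrable fun x => vint G x * pderiv 1 φ x := by
      simpa only [smul_eq_mul, mul_comm] using
        hloc.integrable_smul_left_of_hasCompactSupport hpc hps
    simp only [Pi.sub_apply, sub_mul]
    rw [integral_sub i1 i2, e1, integral_vint_mul_pderiv hGm hGint hφ, sub_self]
  obtain ⟨c, hc, hWc⟩ := exists_fiber_value h₁ h₂ hκ hWloc (by rw [← hΩ]; exact hWeak)
  rw [← hΩ] at hWc
  have hfib : ∀ᵐ x : Plane, Integrable fun t => G (pt (x 0, t)) := by
    rw [ae_plane_iff, Measure.volume_eq_prod]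
    exact Measure.quasiMeasurePreserving_fst.ae (ae_integrable_fiber hGint)
  have hmem : ∀ x, x ∈ Ω ↔ x 0 ∈ Ioo a b ∧ κ₁ (x 0) < x 1 ∧ x 1 < κ₂ (x 0) := by
    intro x; rw [hΩ]; rfl
  have hmemev : ∀ s ∈ Ioo a b, ∀ z, ∀ᶠ y : Plane in 𝓝 (pt (s, z)), y 0 ∈ Ioo a b := fun s hs z =>
    (continuous_coord 0).continuousAt.eventually (isOpen_Ioo.mem_nhds (by simpa using hs))
  -- Between the lower graph and x the difference V - c is the integral of G over that part of the
  -- section. Hence c is the trace of w - u₀ on the lower graph, and the boundary condition gives c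
  -- = 0.
  have hlow : ∀ᵐ s : ℝ, s ∈ Ioo a b → c s = 0 := by
    have ht := ae_hasTraceAt hΩm hGint hL₁ (v := V) (τ := c) (a := a) (b := b) (by
      filter_upwards [hWc, ae_restrict_of_ae hfib, ae_restrict_mem hΩm] with x hx hfx hxΩ
      have e : V x - c (x 0) = vint G x := by
        rw [← hx, Pi.sub_apply]; ring
      rw [e, vint, ← Real.norm_eq_abs]
      refine (norm_integral_le_integral_norm _).trans ?_
      rw [← integral_indicator measurableSet_Iio]
      refine integral_mono_of_nonneg (Eventually.of_forall fun t =>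
        indicator_nonneg (fun _ _ => norm_nonneg _) t) ?_ (Eventually.of_forall fun t => ?_)
      · simp_rw [norm_strip_pt]
        exact hfx.norm.indicator (isClosed_le (by fun_prop) continuous_const).measurableSet
      · dsimp only
        rw [norm_strip_pt]
        by_cases h0 : G (pt (x 0, t)) = 0
        · simp [indicator, h0]
        · have hin : pt (x 0, t) ∈ Ω := by by_contra h; exact h0 (hG0 _ h)
          have h3 := ((hmem _).1 hin).2.1
          simp only [pt_zero, pt_one] at h3
          by_cases h4 : t ∈ Iio (x 1)
          · rw [indicator_of_mem h4, indicator_of_mem]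
            show |t - κ₁ (x 0)| ≤ |x 1 - κ₁ (x 0)|
            have : t < x 1 := h4
            rw [abs_of_pos (by linarith), abs_of_pos (by linarith)]
            linarith
          · rw [indicator_of_notMem h4]
            exact indicator_nonneg (fun _ _ => norm_nonneg _) _) hc
    have hb := ae_trace_eq hbd hL₁ (σ := 1) (by simp) (I := Ioo a b) (by
      intro s hs
      have h3 : ∀ᶠ y : Plane in 𝓝 (pt (s, κ₁ s)), y 1 < κ₂ (y 0) :=
        (isOpen_lt (continuous_coord 1) (h₂.comp (continuous_coord 0))).mem_nhds (by
          simpa using hκ s hs)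
      filter_upwards [hmemev s hs _, h3] with y e1 e2
      rw [hmem, one_mul, sub_pos]
      exact ⟨fun h => h.2.1, fun h => ⟨e1, h, e2⟩⟩)
    filter_upwards [ht, hb] with s h5 h6 hs
    have := h6 hs _ (hasTraceAt_add_lipschitz hu₀ hVint.integrableOn hVae (h5 hs))
    linarith
  have hMi : Integrable fun s : ℝ => ∫ t, G (pt (s, t)) := by
    have := integrable_comp_pt hGint
    rw [Measure.volume_eq_prod] at this
    exact this.integral_prod_left
  -- Seen from the upper graph the trace is c plus the full integral of the section, and the missing
  -- part is the integral above x. With c = 0 the integral of the section vanishes.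
  have hup : ∀ᵐ s : ℝ, s ∈ Ioo a b → c s + ∫ t, G (pt (s, t)) = 0 := by
    have ht := ae_hasTraceAt hΩm hGint hL₂ (v := V) (τ := fun s => c s + ∫ t, G (pt (s, t)))
      (a := a) (b := b) (by
      filter_upwards [hWc, ae_restrict_of_ae hfib, ae_restrict_mem hΩm] with x hx hfx hxΩ
      have e : V x - (c (x 0) + ∫ t, G (pt (x 0, t))) = -∫ t in (Iio (x 1))ᶜ, G (pt (x 0, t)) := by
        rw [← hx, Pi.sub_apply, ← integral_add_compl (measurableSet_Iio (a := x 1)) hfx, vint]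
        ring
      rw [e, abs_neg, ← Real.norm_eq_abs]
      refine (norm_integral_le_integral_norm _).trans ?_
      rw [← integral_indicator measurableSet_Iio.compl]
      refine integral_mono_of_nonneg (Eventually.of_forall fun t =>
        indicator_nonneg (fun _ _ => norm_nonneg _) t) ?_ (Eventually.of_forall fun t => ?_)
      · simp_rw [norm_strip_pt]
        exact hfx.norm.indicator (isClosed_le (by fun_prop) continuous_const).measurableSet
      · dsimp only
        rw [norm_strip_pt]
        by_cases h0 : G (pt (x 0, t)) = 0
        · simp [indicator, h0]
        · have hin : pt (x 0, t) ∈ Ω := by by_contra h; exact h0 (hG0 _ h)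
          have h3 := ((hmem _).1 hin).2.2
          simp only [pt_zero, pt_one] at h3
          by_cases h4 : t ∈ Iio (x 1)
          · rw [indicator_of_notMem (not_not.2 h4)]
            exact indicator_nonneg (fun _ _ => norm_nonneg _) _
          · rw [indicator_of_mem (by exact h4), indicator_of_mem]
            show |t - κ₂ (x 0)| ≤ |x 1 - κ₂ (x 0)|
            have : x 1 ≤ t := not_lt.1 h4
            rw [abs_of_neg (by linarith), abs_of_neg (by linarith)]
            linarith) (fun a' b' ha' hb' => (hc a' b' ha' hb').add hMi.integrableOn)
    have hb := ae_trace_eq hbd hL₂ (σ := -1) (by simp) (I := Ioo a b) (by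
      intro s hs
      have h3 : ∀ᶠ y : Plane in 𝓝 (pt (s, κ₂ s)), κ₁ (y 0) < y 1 :=
        (isOpen_lt (h₁.comp (continuous_coord 0)) (continuous_coord 1)).mem_nhds (by
          simpa using hκ s hs)
      filter_upwards [hmemev s hs _, h3] with y e1 e2
      rw [hmem, neg_one_mul, neg_sub, sub_pos]
      exact ⟨fun h => h.2.2, fun h => ⟨e1, e2, h⟩⟩)
    filter_upwards [ht, hb] with s h5 h6 hs
    have := h6 hs _ (hasTraceAt_add_lipschitz hu₀ hVint.integrableOn hVae (h5 hs))
    linarith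
  refine ⟨G, hGm, hGint, hG0, hGae, ?_, ?_⟩
  · have hlow2 : ∀ᵐ x : Plane, x 0 ∈ Ioo a b → c (x 0) = 0 := by
      rw [ae_plane_iff, Measure.volume_eq_prod]
      exact Measure.quasiMeasurePreserving_fst.ae hlow
    filter_upwards [hVae, hWc, ae_restrict_of_ae hlow2, ae_restrict_mem hΩm] with x e1 e2 e3 e4
    rw [e3 ((hmem x).1 e4).1, Pi.sub_apply] at e2
    linarith
  · filter_upwards [hlow, hup] with s e1 e2
    by_cases hs : s ∈ Ioo a b
    · linarith [e1 hs, e2 hs]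
    · have : ∀ t, G (pt (s, t)) = 0 := fun t => hG0 _ fun h => hs ((hmem _).1 h).1
      simp [this]

end Domain

/-! ### Cutoff functions near the graphs. -/

/-- A smooth step which vanishes on `(-∞, 2]` and equals `1` on `[3, ∞)`. -/
noncomputable def step (t : ℝ) : ℝ := Real.smoothTransition (t - 2)

theorem contDiff_step : ContDiff ℝ ((⊤ : ℕ∞) : WithTop ℕ∞) step :=
  Real.smoothTransition.contDiff.comp (contDiff_id.sub contDiff_const)

theorem step_nonneg (t : ℝ) : 0 ≤ step t := Real.smoothTransition.nonneg _

theorem step_le_one (t : ℝ) : step t ≤ 1 := Real.smoothTransition.le_one _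

theorem step_eq_zero {t : ℝ} (ht : t ≤ 2) : step t = 0 :=
  Real.smoothTransition.zero_of_nonpos (by linarith)

theorem step_eq_one {t : ℝ} (ht : 3 ≤ t) : step t = 1 :=
  Real.smoothTransition.one_of_one_le (by linarith)

theorem hasDerivAt_step (t : ℝ) : HasDerivAt step (deriv step t) t :=
  (contDiff_step.differentiable (by simp) t).hasDerivAt

theorem deriv_step_eq_zero_of_lt {t : ℝ} (ht : t < 2) : deriv step t = 0 := by
  have : step =ᶠ[𝓝 t] fun _ => 0 := by
    filter_upwards [gt_mem_nhds ht] with y hy using step_eq_zero hy.le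
  rw [this.deriv_eq, deriv_const]

theorem deriv_step_eq_zero_of_gt {t : ℝ} (ht : 3 < t) : deriv step t = 0 := by
  have : step =ᶠ[𝓝 t] fun _ => 1 := by
    filter_upwards [lt_mem_nhds ht] with y hy using step_eq_one hy.le
  rw [this.deriv_eq, deriv_const]

theorem deriv_step_nonneg (t : ℝ) : 0 ≤ deriv step t :=
  (Real.smoothTransition.monotone.comp fun _ _ h => by simpa using h : Monotone step).deriv_nonneg

theorem exists_deriv_step_le : ∃ M : ℝ, 0 < M ∧ ∀ t, deriv step t ≤ M := by
  have hc : Continuous (deriv step) := contDiff_step.continuous_deriv (by simp)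
  obtain ⟨M, hM⟩ := (isCompact_Icc (a := (2 : ℝ)) (b := 3)).exists_bound_of_continuousOn
    hc.continuousOn
  refine ⟨max M 1, by positivity, fun t => ?_⟩
  rcases lt_or_ge t 2 with h | h
  · rw [deriv_step_eq_zero_of_lt h]; positivity
  rcases lt_or_ge 3 t with h' | h'
  · rw [deriv_step_eq_zero_of_gt h']; positivity
  · exact ((le_abs_self _).trans (hM t ⟨h, h'⟩)).trans (le_max_left _ _)

/-- A Lipschitz function on the line is uniformly close to smooth functions with the same
Lipschitz constant. -/
theorem exists_smooth_approx {κ : ℝ → ℝ} {L : ℝ≥0} (hκ : LipschitzWith L κ) {ε : ℝ} (hε : 0 < ε) :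
    ∃ k : ℝ → ℝ, ContDiff ℝ ((⊤ : ℕ∞) : WithTop ℕ∞) k ∧ (∀ s, |k s - κ s| ≤ ε) ∧
      ∀ s, |deriv k s| ≤ L := by
  -- A mollification radius ε / (L + 1) moves κ by at most L ε / (L + 1) ≤ ε; the 1 avoids division
  -- by zero when L = 0.
  have hr : 0 < ε / (L + 1) := by positivity
  set φ : ContDiffBump (0 : ℝ) := ⟨ε / (L + 1) / 2, ε / (L + 1), half_pos hr, half_lt_self hr⟩
  set k := convolution (φ.normed volume) κ (ContinuousLinearMap.lsmul ℝ ℝ) volume with hk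
  have hsm : ContDiff ℝ ((⊤ : ℕ∞) : WithTop ℕ∞) k :=
    φ.hasCompactSupport_normed.contDiff_convolution_left _ φ.contDiff_normed
      hκ.continuous.locallyIntegrable
  have hint : ∀ s, Integrable fun t => φ.normed volume t * κ (s - t) := fun s =>
    (φ.continuous_normed.mul (hκ.continuous.comp (by fun_prop))).integrable_of_hasCompactSupport
      φ.hasCompactSupport_normed.mul_right
  have hL : LipschitzWith L k := by
    refine LipschitzWith.of_dist_le_mul fun s s' => ?_
    have e : k s - k s' = ∫ t, φ.normed volume t * (κ (s - t) - κ (s' - t)) := by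
      simp only [hk, convolution_def, ContinuousLinearMap.lsmul_apply, smul_eq_mul, mul_sub]
      exact (integral_sub (hint s) (hint s')).symm
    rw [dist_eq_norm, e]
    have h1 : ∀ t, ‖φ.normed volume t * (κ (s - t) - κ (s' - t))‖
        ≤ φ.normed volume t * (L * dist s s') := by
      intro t
      rw [norm_mul, Real.norm_of_nonneg (φ.nonneg_normed t)]
      refine mul_le_mul_of_nonneg_left ?_ (φ.nonneg_normed t)
      have := hκ.dist_le_mul (s - t) (s' - t)
      rwa [dist_sub_right, dist_eq_norm] at this
    refine (norm_integral_le_of_norm_le (φ.integrable_normed.mul_const _)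
      (Eventually.of_forall h1)).trans_eq ?_
    rw [integral_mul_const, φ.integral_normed, one_mul]
  refine ⟨k, hsm, fun s => ?_, fun s => ?_⟩
  · have := φ.dist_normed_convolution_le (μ := volume) (g := κ) (x₀ := s) (ε := ε)
      hκ.continuous.aestronglyMeasurable (fun t ht => by
        refine (hκ.dist_le_mul t s).trans ?_
        have h2 : dist t s ≤ ε / (L + 1) := (Metric.mem_ball.1 ht).le
        refine (mul_le_mul_of_nonneg_left h2 L.coe_nonneg).trans ?_
        rw [mul_div_assoc', div_le_iff₀ (by positivity)]
        nlinarith [NNReal.coe_nonneg L])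
    rwa [Real.dist_eq] at this
  · rw [← Real.norm_eq_abs]
    exact norm_deriv_le_of_lipschitz hL

theorem pderiv_mul {f g : Plane → ℝ} {x : Plane} (hf : DifferentiableAt ℝ f x)
    (hg : DifferentiableAt ℝ g x) (i : Fin 2) :
    pderiv i (fun y => f y * g y) x = f x * pderiv i g x + pderiv i f x * g x := by
  rw [pderiv, fderiv_fun_mul hf hg]
  simp [pderiv]
  ring

/-- The cutoff function near a graph. -/
noncomputable def graphCut (k : ℝ → ℝ) (σ ε : ℝ) (x : Plane) : ℝ := step (σ * (x 1 - k (x 0)) / ε)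

theorem contDiff_graphCut {k : ℝ → ℝ} (hk : ContDiff ℝ ((⊤ : ℕ∞) : WithTop ℕ∞) k) (σ ε : ℝ) :
    ContDiff ℝ ((⊤ : ℕ∞) : WithTop ℕ∞) (graphCut k σ ε) := by
  have h0 : ContDiff ℝ ((⊤ : ℕ∞) : WithTop ℕ∞) fun x : Plane => x 0 := by fun_prop
  have h1 : ContDiff ℝ ((⊤ : ℕ∞) : WithTop ℕ∞) fun x : Plane => x 1 := by fun_prop
  exact contDiff_step.comp ((contDiff_const.mul (h1.sub (hk.comp h0))).div_const ε)

theorem hasFDerivAt_graphCut {k : ℝ → ℝ} (hk : ContDiff ℝ ((⊤ : ℕ∞) : WithTop ℕ∞) k) (σ ε : ℝ)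
    (x : Plane) : HasFDerivAt (graphCut k σ ε) ((deriv step (σ * (x 1 - k (x 0)) / ε) * (σ / ε)) •
      ((EuclideanSpace.proj 1 : Plane →L[ℝ] ℝ)
        - deriv k (x 0) • (EuclideanSpace.proj 0 : Plane →L[ℝ] ℝ))) x := by
  have h0 : HasFDerivAt (fun x : Plane => x 0) (EuclideanSpace.proj 0 : Plane →L[ℝ] ℝ) x :=
    (EuclideanSpace.proj (0 : Fin 2) : Plane →L[ℝ] ℝ).hasFDerivAt
  have h1 : HasFDerivAt (fun x : Plane => x 1) (EuclideanSpace.proj 1 : Plane →L[ℝ] ℝ) x :=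
    (EuclideanSpace.proj (1 : Fin 2) : Plane →L[ℝ] ℝ).hasFDerivAt
  have h2 := ((hk.differentiable (by simp) (x 0)).hasDerivAt).comp_hasFDerivAt x h0
  have h3 := (h1.sub h2).const_mul (σ / ε)
  have h4 : HasFDerivAt (fun x : Plane => σ * (x 1 - k (x 0)) / ε) ((σ / ε) •
      ((EuclideanSpace.proj 1 : Plane →L[ℝ] ℝ)
        - deriv k (x 0) • (EuclideanSpace.proj 0 : Plane →L[ℝ] ℝ))) x := by
    refine h3.congr_of_eventuallyEq (Eventually.of_forall fun y => ?_)
    simp only [Pi.sub_apply, Function.comp_apply]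
    ring
  have h5 := (hasDerivAt_step (σ * (x 1 - k (x 0)) / ε)).comp_hasFDerivAt x h4
  rw [smul_smul] at h5
  exact h5

theorem pderiv_one_graphCut {k : ℝ → ℝ} (hk : ContDiff ℝ ((⊤ : ℕ∞) : WithTop ℕ∞) k) (σ ε : ℝ)
    (x : Plane) : pderiv 1 (graphCut k σ ε) x = deriv step (σ * (x 1 - k (x 0)) / ε) * (σ / ε) := by
  rw [pderiv, (hasFDerivAt_graphCut hk σ ε x).fderiv]
  simp

theorem pderiv_zero_graphCut {k : ℝ → ℝ} (hk : ContDiff ℝ ((⊤ : ℕ∞) : WithTop ℕ∞) k) (σ ε : ℝ)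
    (x : Plane) : pderiv 0 (graphCut k σ ε) x
      = -(deriv k (x 0) * (deriv step (σ * (x 1 - k (x 0)) / ε) * (σ / ε))) := by
  rw [pderiv, (hasFDerivAt_graphCut hk σ ε x).fderiv]
  simp
  ring

/-- Cutoff functions which vanish near both graphs, with the bounds on their derivatives. -/
theorem exists_cutoff {κ₁ κ₂ : ℝ → ℝ} {L₁ L₂ : ℝ≥0} (h₁ : LipschitzWith L₁ κ₁)
    (h₂ : LipschitzWith L₂ κ₂) : ∃ M C : ℝ, 0 < M ∧ 0 < C ∧ ∀ ε : ℝ, 0 < ε →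
    ∃ β m₁ m₂ : Plane → ℝ, ContDiff ℝ ((⊤ : ℕ∞) : WithTop ℕ∞) β ∧ (∀ x, 0 ≤ β x) ∧
      (∀ x, β x ≤ 1) ∧ (∀ x, β x ≠ 0 → κ₁ (x 0) + ε ≤ x 1 ∧ x 1 ≤ κ₂ (x 0) - ε) ∧
      (∀ x, 0 ≤ m₁ x ∧ m₁ x ≤ M) ∧ (∀ x, 0 ≤ m₂ x ∧ m₂ x ≤ M) ∧
      (∀ x, m₁ x ≠ 0 → 0 ≤ x 1 - κ₁ (x 0) ∧ x 1 - κ₁ (x 0) ≤ 4 * ε) ∧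
      (∀ x, m₂ x ≠ 0 → 0 ≤ κ₂ (x 0) - x 1 ∧ κ₂ (x 0) - x 1 ≤ 4 * ε) ∧
      (∀ x, 4 * ε < x 1 - κ₁ (x 0) → 4 * ε < κ₂ (x 0) - x 1 → β x = 1) ∧
      (∀ x, pderiv 1 β x = (m₁ x - m₂ x) / (4 * ε)) ∧
      ∀ i x, |pderiv i β x| ≤ C * ((m₁ x + m₂ x) / (4 * ε)) := by
  obtain ⟨M, hM, hMs⟩ := exists_deriv_step_le
  refine ⟨4 * M, 1 + L₁ + L₂, by positivity, by positivity, fun ε hε => ?_⟩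
  -- The step runs from 2ε to 3ε above the smoothed graph, which is within ε of the true one. Thus
  -- the transition lies between the distances ε and 4ε from κ₁; likewise below κ₂.
  obtain ⟨k₁, hk₁, hκ₁, hd₁⟩ := exists_smooth_approx h₁ hε
  obtain ⟨k₂, hk₂, hκ₂, hd₂⟩ := exists_smooth_approx h₂ hε
  have hb₁ := contDiff_graphCut hk₁ 1 ε
  have hb₂ := contDiff_graphCut hk₂ (-1) ε
  have hs1 : ∀ x : Plane, 1 * (x 1 - k₁ (x 0)) / ε < 2 ∨ ε ≤ x 1 - κ₁ (x 0) := by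
    intro x
    by_cases h : 1 * (x 1 - k₁ (x 0)) / ε < 2
    · exact Or.inl h
    · rw [not_lt, le_div_iff₀ hε] at h
      have := abs_le.1 (hκ₁ (x 0))
      exact Or.inr (by linarith)
  have hs1' : ∀ x : Plane, 3 < 1 * (x 1 - k₁ (x 0)) / ε ∨ x 1 - κ₁ (x 0) ≤ 4 * ε := by
    intro x
    by_cases h : 3 < 1 * (x 1 - k₁ (x 0)) / ε
    · exact Or.inl h
    · rw [not_lt, div_le_iff₀ hε] at h
      have := abs_le.1 (hκ₁ (x 0))
      exact Or.inr (by linarith)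
  have hs2 : ∀ x : Plane, -1 * (x 1 - k₂ (x 0)) / ε < 2 ∨ ε ≤ κ₂ (x 0) - x 1 := by
    intro x
    by_cases h : -1 * (x 1 - k₂ (x 0)) / ε < 2
    · exact Or.inl h
    · rw [not_lt, le_div_iff₀ hε] at h
      have := abs_le.1 (hκ₂ (x 0))
      exact Or.inr (by linarith)
  have hs2' : ∀ x : Plane, 3 < -1 * (x 1 - k₂ (x 0)) / ε ∨ κ₂ (x 0) - x 1 ≤ 4 * ε := by
    intro x
    by_cases h : 3 < -1 * (x 1 - k₂ (x 0)) / ε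
    · exact Or.inl h
    · rw [not_lt, div_le_iff₀ hε] at h
      have := abs_le.1 (hκ₂ (x 0))
      exact Or.inr (by linarith)
  have hn1 : ∀ x, 0 ≤ graphCut k₁ 1 ε x ∧ graphCut k₁ 1 ε x ≤ 1 := fun x =>
    ⟨step_nonneg _, step_le_one _⟩
  have hn2 : ∀ x, 0 ≤ graphCut k₂ (-1) ε x ∧ graphCut k₂ (-1) ε x ≤ 1 := fun x =>
    ⟨step_nonneg _, step_le_one _⟩
  have hprod : ∀ (t : ℝ) (y : ℝ), (0 ≤ y ∧ y ≤ 1) →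
      0 ≤ 4 * deriv step t * y ∧ 4 * deriv step t * y ≤ 4 * M := by
    intro t y hy
    have h3 := deriv_step_nonneg t
    have h4 := hMs t
    exact ⟨mul_nonneg (by linarith) hy.1, by nlinarith [hy.1, hy.2]⟩
  -- The factors 4 in m₁ and m₂ turn 1 / ε into 1 / (4ε), the reciprocal of the length over which G
  -- will be averaged.
  refine ⟨fun x => graphCut k₁ 1 ε x * graphCut k₂ (-1) ε x,
    fun x => 4 * deriv step (1 * (x 1 - k₁ (x 0)) / ε) * graphCut k₂ (-1) ε x,
    fun x => 4 * deriv step (-1 * (x 1 - k₂ (x 0)) / ε) * graphCut k₁ 1 ε x,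
    hb₁.mul hb₂, fun x => mul_nonneg (hn1 x).1 (hn2 x).1,
    fun x => mul_le_one₀ (hn1 x).2 (hn2 x).1 (hn2 x).2, fun x hx => ?_,
    fun x => hprod _ _ (hn2 x), fun x => hprod _ _ (hn1 x), fun x hx => ?_, fun x hx => ?_,
    fun x hx1 hx2 => ?_, fun x => ?_, fun i x => ?_⟩
  · constructor
    · rcases hs1 x with h | h
      · exact absurd (by simp only [graphCut]; rw [step_eq_zero h.le, zero_mul]) hx
      · linarith
    · rcases hs2 x with h | h
      · exact absurd (by simp only [graphCut]; rw [step_eq_zero h.le, mul_zero]) hx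
      · linarith
  · constructor
    · rcases hs1 x with h | h
      · exact absurd (by dsimp only; rw [deriv_step_eq_zero_of_lt h, mul_zero, zero_mul]) hx
      · linarith
    · rcases hs1' x with h | h
      · exact absurd (by dsimp only; rw [deriv_step_eq_zero_of_gt h, mul_zero, zero_mul]) hx
      · exact h
  · constructor
    · rcases hs2 x with h | h
      · exact absurd (by dsimp only; rw [deriv_step_eq_zero_of_lt h, mul_zero, zero_mul]) hx
      · linarith
    · rcases hs2' x with h | h
      · exact absurd (by dsimp only; rw [deriv_step_eq_zero_of_gt h, mul_zero, zero_mul]) hx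
      · exact h
  · rcases hs1' x with h | h
    · rcases hs2' x with h' | h'
      · simp only [graphCut]
        rw [step_eq_one h.le, step_eq_one h'.le, one_mul]
      · linarith
    · linarith
  · rw [pderiv_mul (hb₁.differentiable (by simp) x) (hb₂.differentiable (by simp) x),
      pderiv_one_graphCut hk₁, pderiv_one_graphCut hk₂]
    field_simp
    ring
  · set T₁ := deriv step (1 * (x 1 - k₁ (x 0)) / ε) with hT₁
    set T₂ := deriv step (-1 * (x 1 - k₂ (x 0)) / ε) with hT₂
    have hT₁n : 0 ≤ T₁ := deriv_step_nonneg _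
    have hT₂n : 0 ≤ T₂ := deriv_step_nonneg _
    have p1 : |pderiv i (graphCut k₁ 1 ε) x| ≤ (1 + L₁) * (T₁ / ε) := by
      have hpos : 0 ≤ T₁ / ε := by positivity
      fin_cases i
      · show |pderiv 0 (graphCut k₁ 1 ε) x| ≤ _
        rw [pderiv_zero_graphCut hk₁, abs_neg, abs_mul, ← hT₁, mul_one_div, abs_of_nonneg hpos]
        exact mul_le_mul_of_nonneg_right (by linarith [hd₁ (x 0)]) hpos
      · show |pderiv 1 (graphCut k₁ 1 ε) x| ≤ _
        rw [pderiv_one_graphCut hk₁, ← hT₁, mul_one_div, abs_of_nonneg hpos]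
        nlinarith [L₁.2]
    have p2 : |pderiv i (graphCut k₂ (-1) ε) x| ≤ (1 + L₂) * (T₂ / ε) := by
      have hpos : 0 ≤ T₂ / ε := by positivity
      have e : T₂ * (-1 / ε) = -(T₂ / ε) := by ring
      fin_cases i
      · show |pderiv 0 (graphCut k₂ (-1) ε) x| ≤ _
        rw [pderiv_zero_graphCut hk₂, abs_neg, abs_mul, ← hT₂, e, abs_neg, abs_of_nonneg hpos]
        exact mul_le_mul_of_nonneg_right (by linarith [hd₂ (x 0)]) hpos
      · show |pderiv 1 (graphCut k₂ (-1) ε) x| ≤ _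
        rw [pderiv_one_graphCut hk₂, ← hT₂, e, abs_neg, abs_of_nonneg hpos]
        nlinarith [L₂.2]
    rw [pderiv_mul (hb₁.differentiable (by simp) x) (hb₂.differentiable (by simp) x)]
    refine (abs_add_le _ _).trans ?_
    rw [abs_mul, abs_mul, abs_of_nonneg (hn1 x).1, abs_of_nonneg (hn2 x).1]
    have q1 := mul_le_mul_of_nonneg_left p2 (hn1 x).1
    have q2 := mul_le_mul_of_nonneg_right p1 (hn2 x).1
    have e : (1 + (L₁ : ℝ) + L₂) * ((4 * T₁ * graphCut k₂ (-1) ε x + 4 * T₂ * graphCut k₁ 1 ε x)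
        / (4 * ε)) = (1 + L₁ + L₂) * (T₁ / ε * graphCut k₂ (-1) ε x)
          + (1 + L₁ + L₂) * (graphCut k₁ 1 ε x * (T₂ / ε)) := by
      field_simp
    rw [e]
    have r1 : 0 ≤ T₁ / ε * graphCut k₂ (-1) ε x := mul_nonneg (by positivity) (hn2 x).1
    have r2 : 0 ≤ graphCut k₁ 1 ε x * (T₂ / ε) := mul_nonneg (hn1 x).1 (by positivity)
    have hL1 : (0 : ℝ) ≤ L₁ := L₁.2
    have hL2 : (0 : ℝ) ≤ L₂ := L₂.2
    nlinarith [mul_nonneg hL2 r1, mul_nonneg hL1 r2]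

/-! ### Vertical averages and growth of the density. -/

/-- The average of `G` over the vertical segment of length `h` from `x` in the direction `-σ`. -/
noncomputable def avg (G : Plane → ℝ) (σ h : ℝ) (x : Plane) : ℝ :=
  h⁻¹ * ∫ τ in Ioc 0 h, G (pt (x 0, x 1 - σ * τ))

/-- The average of an `ℝ≥0∞`-valued function over a vertical segment. -/
noncomputable def avgE (F : Plane → ℝ≥0∞) (σ h : ℝ) (x : Plane) : ℝ≥0∞ :=
  (ENNReal.ofReal h)⁻¹ * ∫⁻ τ in Ioc 0 h, F (pt (x 0, x 1 - σ * τ))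

theorem measurable_avgE {F : Plane → ℝ≥0∞} (hF : Measurable F) (σ h : ℝ) :
    Measurable (avgE F σ h) := by
  refine Measurable.const_mul ?_ _
  have : Measurable fun p : Plane × ℝ => F (pt (p.1 0, p.1 1 - σ * p.2)) := by
    refine hF.comp (continuous_pt.comp ?_).measurable
    fun_prop
  exact this.lintegral_prod_right'

theorem integrable_comp_affine {g : ℝ → ℝ} (hg : Integrable g) (z : ℝ) {σ : ℝ} (hσ : σ ≠ 0) :
    Integrable fun τ => g (z - σ * τ) :=
  (hg.comp_sub_left z).comp_mul_left' hσ

/-- Jensen's inequality for the uniform probability measure on the segment. -/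
theorem ofReal_comp_avg_le {f : ℝ → ℝ} (hf : ConvexOn ℝ univ f) (hf0 : ∀ t, 0 ≤ f t)
    {G : Plane → ℝ} {x : Plane} (hx : Integrable fun t => G (pt (x 0, t))) {σ h m : ℝ}
    (hσ : σ ≠ 0) (hh : 0 < h) {Φ : Plane → ℝ≥0∞} (hΦ : ∀ y, ENNReal.ofReal (f (m * G y)) ≤ Φ y) :
    ENNReal.ofReal (f (m * avg G σ h x)) ≤ avgE Φ σ h x := by
  set μ : Measure ℝ := (ENNReal.ofReal h)⁻¹ • volume.restrict (Ioc 0 h) with hμ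
  have h0 : ENNReal.ofReal h ≠ 0 := by simpa using hh
  have : IsProbabilityMeasure μ := by
    constructor
    rw [hμ, Measure.smul_apply, Measure.restrict_apply_univ, Real.volume_Ioc, sub_zero, smul_eq_mul,
      ENNReal.inv_mul_cancel h0 ENNReal.ofReal_ne_top]
  have hi : Integrable (fun τ => m * G (pt (x 0, x 1 - σ * τ))) μ := by
    refine Integrable.smul_measure ?_ (ENNReal.inv_ne_top.2 h0)
    exact ((integrable_comp_affine hx (x 1) hσ).const_mul m).integrableOn
  have h1 := jensen_lintegral hf hf0 hi
  have h2 : ∫ τ, m * G (pt (x 0, x 1 - σ * τ)) ∂μ = m * avg G σ h x := by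
    rw [hμ, integral_smul_measure, integral_const_mul, avg, ENNReal.toReal_inv,
      ENNReal.toReal_ofReal hh.le, smul_eq_mul]
    ring
  rw [h2] at h1
  refine h1.trans ?_
  rw [hμ, lintegral_smul_measure, smul_eq_mul, avgE]
  gcongr
  exact hΦ _

/-- From a point at distance at most h on the side given by σ, the segment of length h in the
direction -σ stays within distance h of the graph. After Tonelli each translation preserves the
integral over that strip, so averaging does not increase it. -/
theorem setLIntegral_avgE_le {F : Plane → ℝ≥0∞} (hF : Measurable F) {σ h : ℝ} (hσ : |σ| = 1)
    (hh : 0 < h) {κ : ℝ → ℝ} (hκ : Continuous κ) {I : Set ℝ} (hI : MeasurableSet I) :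
    ∫⁻ x in {x : Plane | x 0 ∈ I ∧ 0 ≤ σ * (x 1 - κ (x 0)) ∧ σ * (x 1 - κ (x 0)) ≤ h}, avgE F σ h x
      ≤ ∫⁻ x in {x : Plane | x 0 ∈ I ∧ |x 1 - κ (x 0)| ≤ h}, F x := by
  set A := {x : Plane | x 0 ∈ I ∧ |x 1 - κ (x 0)| ≤ h} with hA
  set A' := {x : Plane | x 0 ∈ I ∧ 0 ≤ σ * (x 1 - κ (x 0)) ∧ σ * (x 1 - κ (x 0)) ≤ h} with hA'
  have hAm : MeasurableSet A := ((continuous_coord 0).measurable hI).inter (measurableSet_strip hκ h)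
  have h0 : ENNReal.ofReal h ≠ 0 := by simpa using hh
  have hFm : Measurable (A.indicator F) := hF.indicator hAm
  have hjoint : Measurable fun p : Plane × ℝ => A.indicator F (pt (p.1 0, p.1 1 - σ * p.2)) := by
    refine hFm.comp (continuous_pt.comp ?_).measurable
    fun_prop
  have hmem : ∀ x ∈ A', ∀ τ ∈ Ioc 0 h, pt (x 0, x 1 - σ * τ) ∈ A := by
    rintro x ⟨hx0, hx1, hx2⟩ τ hτ
    refine ⟨hx0, ?_⟩
    simp only [pt_zero, pt_one]
    rcases abs_eq (zero_le_one' ℝ) |>.1 hσ with rfl | rfl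
    · rw [abs_le]; constructor <;> linarith [hτ.1, hτ.2]
    · rw [abs_le]; constructor <;> linarith [hτ.1, hτ.2]
  have hm' : MeasurableSet A' :=
    ((continuous_coord 0).measurable hI).inter
      ((isClosed_le continuous_const (continuous_const.mul ((continuous_coord 1).sub
        (hκ.comp (continuous_coord 0))))).measurableSet.inter
      (isClosed_le (continuous_const.mul ((continuous_coord 1).sub
        (hκ.comp (continuous_coord 0)))) continuous_const).measurableSet)
  calc ∫⁻ x in A', avgE F σ h x
      ≤ ∫⁻ x in A', (ENNReal.ofReal h)⁻¹ * ∫⁻ τ in Ioc 0 h, A.indicator F (pt (x 0, x 1 - σ * τ)) := by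
        refine setLIntegral_mono' hm' fun x hx => ?_
        rw [avgE]
        refine mul_le_mul_right (setLIntegral_mono' measurableSet_Ioc fun τ hτ => ?_) _
        rw [indicator_of_mem (hmem x hx τ hτ)]
    _ ≤ ∫⁻ x : Plane, (ENNReal.ofReal h)⁻¹ * ∫⁻ τ in Ioc 0 h, A.indicator F (pt (x 0, x 1 - σ * τ)) :=
        setLIntegral_le_lintegral _ _
    _ = (ENNReal.ofReal h)⁻¹ * ∫⁻ τ in Ioc 0 h, ∫⁻ x : Plane, A.indicator F (pt (x 0, x 1 - σ * τ)) := by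
        rw [lintegral_const_mul _ hjoint.lintegral_prod_right',
          lintegral_lintegral_swap hjoint.aemeasurable]
    _ = (ENNReal.ofReal h)⁻¹ * ∫⁻ _ in Ioc 0 h, ∫⁻ x, A.indicator F x := by
        congr 2; ext τ
        have e : ∀ x : Plane, pt (x 0, x 1 - σ * τ) = x - pt (0, σ * τ) := fun x =>
          plane_ext (by simp) (by simp)
        simp_rw [e]
        exact lintegral_sub_right_eq_self (fun x => A.indicator F x) _
    _ = ∫⁻ x in A, F x := by
        rw [setLIntegral_const, Real.volume_Ioc, sub_zero, lintegral_indicator hAm, mul_comm, mul_assoc,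
          ENNReal.mul_inv_cancel h0 ENNReal.ofReal_ne_top, mul_one]

/-- Iterating the quasi-triangle inequality bounds f(2 ^ k z), where 2 ^ k > M, and convexity
interpolates between 0 and 2 ^ k z. The 1 on the right pays for f 0. -/
theorem exists_growth {f : ℝ → ℝ} (hf : ConvexOn ℝ univ f) (hf0 : ∀ t, 0 ≤ f t) {c₃ : ℝ}
    (htri : ∀ t s, f (t + s) ≤ c₃ * (f t + f s)) (M : ℝ) :
    ∃ K : ℝ, 0 < K ∧ ∀ c, 0 ≤ c → c ≤ M → ∀ z, f (c * z) ≤ K * (1 + f z) := by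
  obtain ⟨k, hk⟩ := pow_unbounded_of_one_lt M one_lt_two
  have hpow : ∀ k : ℕ, ∀ z, f (2 ^ k * z) ≤ (2 * |c₃|) ^ k * f z := by
    intro k
    induction k with
    | zero => intro z; simp
    | succ k ih =>
      intro z
      have h1 := htri (2 ^ k * z) (2 ^ k * z)
      have h2 := mul_le_mul_of_nonneg_right (le_abs_self c₃) (add_nonneg (hf0 (2 ^ k * z)) (hf0 (2 ^ k * z)))
      have h3 := mul_le_mul_of_nonneg_left (ih z) (show 0 ≤ 2 * |c₃| by positivity)
      rw [show (2 : ℝ) ^ (k + 1) * z = 2 ^ k * z + 2 ^ k * z by ring]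
      rw [pow_succ']
      linarith
  refine ⟨(2 * |c₃|) ^ k + f 0 + 1, by have := hf0 0; positivity, fun c hc0 hcM z => ?_⟩
  have h2k : (0 : ℝ) < 2 ^ k := by positivity
  have hc1 : c / 2 ^ k ≤ 1 := by rw [div_le_one h2k]; linarith
  have hc2 : 0 ≤ c / 2 ^ k := by positivity
  have h := hf.2 (mem_univ (2 ^ k * z)) (mem_univ 0) hc2 (sub_nonneg.2 hc1) (by ring)
  rw [smul_eq_mul, smul_eq_mul, smul_eq_mul, smul_eq_mul, mul_zero, add_zero, ← mul_assoc,
    div_mul_cancel₀ _ h2k.ne'] at h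
  have h4 := hpow k z
  have h5 := hf0 0
  have h6 := hf0 z
  have h7 := hf0 (2 ^ k * z)
  have h8 : 0 ≤ (2 * |c₃|) ^ k := by positivity
  nlinarith [mul_nonneg h5 h6]

/-! ### Neighbourhoods of the graphs and the dominating function. -/

section Strip

variable {a b : ℝ} {κ₁ κ₂ : ℝ → ℝ}

/-- The part of the vertical strip over `(a,b)` near the graphs. -/
def nearGraphs (a b : ℝ) (κ₁ κ₂ : ℝ → ℝ) (h : ℝ) : Set Plane :=
  {x : Plane | x 0 ∈ Ioo a b ∧ |x 1 - κ₁ (x 0)| ≤ h} ∪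
    {x : Plane | x 0 ∈ Ioo a b ∧ |x 1 - κ₂ (x 0)| ≤ h}

theorem measurableSet_nearGraphs (h₁ : Continuous κ₁) (h₂ : Continuous κ₂) (h : ℝ) :
    MeasurableSet (nearGraphs a b κ₁ κ₂ h) :=
  (((continuous_coord 0).measurable measurableSet_Ioo).inter (measurableSet_strip h₁ h)).union
    (((continuous_coord 0).measurable measurableSet_Ioo).inter (measurableSet_strip h₂ h))

theorem volume_nearGraphs_le (h₁ : Continuous κ₁) (h₂ : Continuous κ₂) (h : ℝ) :
    volume (nearGraphs a b κ₁ κ₂ h) ≤ 2 * (ENNReal.ofReal (2 * h) * ENNReal.ofReal (b - a)) := by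
  refine (measure_union_le _ _).trans ?_
  rw [two_mul]
  refine add_le_add ?_ ?_
  · rw [← volume_band h₁]
    exact measure_mono fun x hx => ⟨Ioo_subset_Icc_self hx.1, hx.2⟩
  · rw [← volume_band h₂]
    exact measure_mono fun x hx => ⟨Ioo_subset_Icc_self hx.1, hx.2⟩

theorem tendsto_volume_nearGraphs (h₁ : Continuous κ₁) (h₂ : Continuous κ₂) :
    Tendsto (fun ε : ℝ => volume (nearGraphs a b κ₁ κ₂ (4 * ε))) (𝓝[>] 0) (𝓝 0) := by
  refine tendsto_of_tendsto_of_tendsto_of_le_of_le tendsto_const_nhds ?_ (fun _ => bot_le)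
    fun ε => volume_nearGraphs_le h₁ h₂ (4 * ε)
  have hc : Tendsto (fun ε : ℝ => ENNReal.ofReal (2 * (4 * ε))) (𝓝[>] 0) (𝓝 0) := by
    have : Continuous fun ε : ℝ => ENNReal.ofReal (2 * (4 * ε)) :=
      ENNReal.continuous_ofReal.comp (by fun_prop)
    have h := (this.tendsto 0).mono_left (nhdsWithin_le_nhds (s := Ioi 0))
    simpa using h
  have := ENNReal.Tendsto.const_mul (a := 2) (ENNReal.Tendsto.mul_const
    (b := ENNReal.ofReal (b - a)) hc (Or.inr ENNReal.ofReal_ne_top)) (Or.inr ENNReal.ofNat_ne_top)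
  simpa using this

theorem nearGraphs_mono {h h' : ℝ} (hh : h ≤ h') :
    nearGraphs a b κ₁ κ₂ h ⊆ nearGraphs a b κ₁ κ₂ h' :=
  union_subset_union (fun _ hx => ⟨hx.1, hx.2.trans hh⟩) fun _ hx => ⟨hx.1, hx.2.trans hh⟩

theorem tendsto_setLIntegral_nearGraphs (h₁ : Continuous κ₁) (h₂ : Continuous κ₂)
    {F : Plane → ℝ≥0∞} (hF : ∫⁻ x in nearGraphs a b κ₁ κ₂ 4, F x ≠ ⊤) :
    Tendsto (fun ε : ℝ => ∫⁻ x in nearGraphs a b κ₁ κ₂ (4 * ε), F x) (𝓝[>] 0) (𝓝 0) := by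
  have h0 : Tendsto (fun ε : ℝ => (volume.restrict (nearGraphs a b κ₁ κ₂ 4))
      (nearGraphs a b κ₁ κ₂ (4 * ε))) (𝓝[>] 0) (𝓝 0) :=
    tendsto_of_tendsto_of_tendsto_of_le_of_le tendsto_const_nhds
      (tendsto_volume_nearGraphs h₁ h₂) (fun _ => bot_le) fun ε => Measure.restrict_apply_le _ _
  have h3 := tendsto_setLIntegral_zero hF h0
  refine h3.congr' ?_
  have : ∀ᶠ ε : ℝ in 𝓝[>] 0, ε < 1 := nhdsWithin_le_nhds (gt_mem_nhds one_pos)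
  filter_upwards [this] with ε hε
  rw [Measure.restrict_restrict (measurableSet_nearGraphs h₁ h₂ _),
    inter_eq_self_of_subset_left (nearGraphs_mono (by linarith))]

/-- A function which dominates the averages near the graphs. -/
noncomputable def dominator (a b : ℝ) (κ₁ κ₂ : ℝ → ℝ) (Ψ : Plane → ℝ≥0∞) (h : ℝ) (x : Plane) :
    ℝ≥0∞ :=
  {x : Plane | x 0 ∈ Ioo a b ∧ 0 ≤ 1 * (x 1 - κ₁ (x 0)) ∧ 1 * (x 1 - κ₁ (x 0)) ≤ h}.indicator
      (avgE Ψ 1 h) x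
    + {x : Plane | x 0 ∈ Ioo a b ∧ 0 ≤ -1 * (x 1 - κ₂ (x 0)) ∧ -1 * (x 1 - κ₂ (x 0)) ≤ h}.indicator
      (avgE Ψ (-1) h) x
    + Ψ x

theorem measurableSet_halfStrip {κ : ℝ → ℝ} (hκ : Continuous κ) (σ h : ℝ) :
    MeasurableSet {x : Plane | x 0 ∈ Ioo a b ∧ 0 ≤ σ * (x 1 - κ (x 0)) ∧ σ * (x 1 - κ (x 0)) ≤ h} :=
  ((continuous_coord 0).measurable measurableSet_Ioo).inter
      ((isClosed_le continuous_const (continuous_const.mul ((continuous_coord 1).sub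
        (hκ.comp (continuous_coord 0))))).measurableSet.inter
      (isClosed_le (continuous_const.mul ((continuous_coord 1).sub
        (hκ.comp (continuous_coord 0)))) continuous_const).measurableSet)

/-- Each of the three summands costs at most one integral of Ψ over the same neighbourhood, so the
dominating function is small in L¹ whenever the neighbourhood is thin. -/
theorem setLIntegral_dominator_le (h₁ : Continuous κ₁) (h₂ : Continuous κ₂) {Ψ : Plane → ℝ≥0∞}
    (hΨ : Measurable Ψ) {h : ℝ} (hh : 0 < h) :
    ∫⁻ x in nearGraphs a b κ₁ κ₂ h, dominator a b κ₁ κ₂ Ψ h x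
      ≤ 3 * ∫⁻ x in nearGraphs a b κ₁ κ₂ h, Ψ x := by
  unfold dominator
  have m1 := (measurable_avgE hΨ 1 h).indicator (measurableSet_halfStrip (a := a) (b := b) h₁ 1 h)
  have m2 := (measurable_avgE hΨ (-1) h).indicator
    (measurableSet_halfStrip (a := a) (b := b) h₂ (-1) h)
  rw [lintegral_add_right _ hΨ, lintegral_add_left m1,
    show (3 : ℝ≥0∞) = 1 + 1 + 1 by norm_num, add_mul, add_mul, one_mul]
  refine add_le_add (add_le_add ?_ ?_) le_rfl
  · refine (setLIntegral_le_lintegral _ _).trans ?_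
    rw [lintegral_indicator (measurableSet_halfStrip h₁ 1 h)]
    refine (setLIntegral_avgE_le hΨ (by simp) hh h₁ measurableSet_Ioo).trans ?_
    exact lintegral_mono_set subset_union_left
  · refine (setLIntegral_le_lintegral _ _).trans ?_
    rw [lintegral_indicator (measurableSet_halfStrip h₂ (-1) h)]
    refine (setLIntegral_avgE_le hΨ (by simp) hh h₂ measurableSet_Ioo).trans ?_
    exact lintegral_mono_set subset_union_right

/-- Where m₁ ≠ 0 the point lies in the half strip on which the dominating function contains the
corresponding average. Where m₁ = 0 only f 0 has to be bounded, which the summand Ψ does. The same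
holds for m₂. -/
theorem ofReal_comp_avg_le_dominator {f : ℝ → ℝ} (hf : ConvexOn ℝ univ f) (hf0 : ∀ t, 0 ≤ f t)
    {G : Plane → ℝ} {x : Plane} (hx : Integrable fun t => G (pt (x 0, t))) (hx0 : x 0 ∈ Ioo a b)
    {h M K : ℝ} (hh : 0 < h) (hK0 : 0 < K)
    (hK : ∀ c, 0 ≤ c → c ≤ M → ∀ z, f (c * z) ≤ K * (1 + f z))
    {m₁ m₂ : ℝ} (hm₁ : 0 ≤ m₁ ∧ m₁ ≤ M) (hm₂ : 0 ≤ m₂ ∧ m₂ ≤ M)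
    (h1 : m₁ ≠ 0 → 0 ≤ x 1 - κ₁ (x 0) ∧ x 1 - κ₁ (x 0) ≤ h)
    (h2 : m₂ ≠ 0 → 0 ≤ κ₂ (x 0) - x 1 ∧ κ₂ (x 0) - x 1 ≤ h) :
    ENNReal.ofReal (f (m₁ * avg G 1 h x)) ≤ ENNReal.ofReal K *
        dominator a b κ₁ κ₂ (fun y => ENNReal.ofReal (1 + f (G y))) h x ∧
      ENNReal.ofReal (f (m₂ * avg G (-1) h x)) ≤ ENNReal.ofReal K *
        dominator a b κ₁ κ₂ (fun y => ENNReal.ofReal (1 + f (G y))) h x := by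
  set Ψ : Plane → ℝ≥0∞ := fun y => ENNReal.ofReal (1 + f (G y)) with hΨ
  have hKΨ : ∀ c, 0 ≤ c → c ≤ M → ∀ y, ENNReal.ofReal (f (c * G y)) ≤ ENNReal.ofReal K * Ψ y := by
    intro c hc0 hcM y
    rw [hΨ, ← ENNReal.ofReal_mul hK0.le]
    exact ENNReal.ofReal_le_ofReal (hK c hc0 hcM _)
  have hzero : ∀ z : ℝ, ENNReal.ofReal (f (0 * z)) ≤ ENNReal.ofReal K * dominator a b κ₁ κ₂ Ψ h x := by
    intro z
    have := hKΨ 0 le_rfl (hm₁.1.trans hm₁.2) x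
    rw [zero_mul] at this ⊢
    exact this.trans (mul_le_mul_right le_add_self _)
  have hconst : ∀ σ, avgE (fun y => ENNReal.ofReal K * Ψ y) σ h x
      = ENNReal.ofReal K * avgE Ψ σ h x := by
    intro σ
    rw [avgE, avgE, lintegral_const_mul' _ _ ENNReal.ofReal_ne_top]
    ring
  constructor
  · by_cases hm : m₁ = 0
    · rw [hm]; exact hzero _
    · have h3 := ofReal_comp_avg_le hf hf0 hx one_ne_zero hh (hKΨ m₁ hm₁.1 hm₁.2)
      rw [hconst] at h3
      refine h3.trans (mul_le_mul_right ?_ _)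
      have hmem : x ∈ {x : Plane | x 0 ∈ Ioo a b ∧ 0 ≤ 1 * (x 1 - κ₁ (x 0)) ∧
          1 * (x 1 - κ₁ (x 0)) ≤ h} := by
        refine ⟨hx0, ?_, ?_⟩
        · linarith [(h1 hm).1]
        · linarith [(h1 hm).2]
      rw [dominator, indicator_of_mem hmem, add_assoc]
      exact le_self_add
  · by_cases hm : m₂ = 0
    · rw [hm]; exact hzero _
    · have h3 := ofReal_comp_avg_le hf hf0 hx (neg_ne_zero.2 one_ne_zero) hh (hKΨ m₂ hm₂.1 hm₂.2)
      rw [hconst] at h3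
      refine h3.trans (mul_le_mul_right ?_ _)
      have hmem : x ∈ {x : Plane | x 0 ∈ Ioo a b ∧ 0 ≤ -1 * (x 1 - κ₂ (x 0)) ∧
          -1 * (x 1 - κ₂ (x 0)) ≤ h} := by
        refine ⟨hx0, ?_, ?_⟩
        · linarith [(h2 hm).1]
        · linarith [(h2 hm).2]
      rw [dominator, indicator_of_mem hmem, add_comm ({x : Plane | _}.indicator _ x), add_assoc]
      exact le_self_add

/-- A segment of length h going down from x passes the lower graph, below which G vanishes, so
integrating over it is integrating from -∞. -/
theorem vint_eq_avg_one {G : Plane → ℝ} {h : ℝ} (hh : 0 < h) {x : Plane}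
    (hG : ∀ t, t ≤ κ₁ (x 0) → G (pt (x 0, t)) = 0) (hx : x 1 - κ₁ (x 0) ≤ h) :
    vint G x = h * avg G 1 h x := by
  rw [avg, mul_inv_cancel_left₀ hh.ne', ← intervalIntegral.integral_of_le hh.le]
  simp only [one_mul]
  rw [intervalIntegral.integral_comp_sub_left (fun t => G (pt (x 0, t))), sub_zero,
    intervalIntegral.integral_of_le (by linarith), vint, ← integral_Iic_eq_integral_Iio]
  refine setIntegral_eq_of_subset_of_forall_sdiff_eq_zero measurableSet_Iic Ioc_subset_Iic_self ?_
  rintro t ⟨ht1, ht2⟩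
  refine hG t ?_
  by_contra! h3
  exact ht2 ⟨by linarith, ht1⟩

/-- The integral of the section vanishes, so the integral below x is minus the integral above it,
and a segment of length h going up passes the upper graph. -/
theorem vint_eq_avg_neg_one {G : Plane → ℝ} {h : ℝ} (hh : 0 < h) {x : Plane}
    (hG : ∀ t, κ₂ (x 0) ≤ t → G (pt (x 0, t)) = 0) (hx : κ₂ (x 0) - x 1 ≤ h)
    (hi : Integrable fun t => G (pt (x 0, t))) (h0 : ∫ t, G (pt (x 0, t)) = 0) :
    vint G x = -(h * avg G (-1) h x) := by
  have h1 : vint G x = -∫ t in Ici (x 1), G (pt (x 0, t)) := by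
    have := integral_add_compl (measurableSet_Iio (a := x 1)) hi
    rw [h0, compl_Iio] at this
    rw [vint]; linarith
  rw [h1, avg, mul_inv_cancel_left₀ hh.ne', ← intervalIntegral.integral_of_le hh.le]
  simp only [neg_mul, one_mul, sub_neg_eq_add]
  rw [intervalIntegral.integral_comp_add_left (fun t => G (pt (x 0, t))), add_zero,
    intervalIntegral.integral_of_le (by linarith), integral_Ici_eq_integral_Ioi, neg_inj]
  refine setIntegral_eq_of_subset_of_forall_sdiff_eq_zero measurableSet_Ioi Ioc_subset_Ioi_self ?_
  rintro t ⟨ht1, ht2⟩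
  refine hG t ?_
  by_contra! h3
  exact ht2 ⟨ht1, by linarith⟩

end Strip

/-! ### Cutting off near the graphs. -/

section CutoffApprox

variable {a b : ℝ} {κ₁ κ₂ : ℝ → ℝ} {Ω : Set Plane} {G : Plane → ℝ}

theorem convexOn_abs : ConvexOn ℝ univ fun t : ℝ => |t| := by
  refine ⟨convex_univ, fun x _ y _ α β hα hβ _ => ?_⟩
  simp only [smul_eq_mul]
  refine (abs_add_le _ _).trans_eq ?_
  rw [abs_mul, abs_mul, abs_of_nonneg hα, abs_of_nonneg hβ]

theorem ae_fiber_good (hG : Integrable G) (hGs : ∀ᵐ s : ℝ, ∫ t, G (pt (s, t)) = 0) :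
    ∀ᵐ x : Plane, Integrable (fun t => G (pt (x 0, t))) ∧ ∫ t, G (pt (x 0, t)) = 0 := by
  rw [ae_plane_iff, Measure.volume_eq_prod]
  exact Measure.quasiMeasurePreserving_fst.ae ((ae_integrable_fiber hG).and hGs)

theorem vint_eq_zero_of_notMem (hΩ : Ω = between (Ioo a b) κ₁ κ₂) (hG0 : ∀ x, x ∉ Ω → G x = 0)
    {x : Plane} (hx : x 0 ∉ Ioo a b) : vint G x = 0 := by
  have : ∀ t, G (pt (x 0, t)) = 0 := fun t => hG0 _ (by rw [hΩ]; exact fun h => hx h.1)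
  simp [vint, this]

/-- Below the lower graph nothing has been integrated yet, and above the upper graph the whole
section has, with integral zero. -/
theorem ae_vint_eq_zero (hΩ : Ω = between (Ioo a b) κ₁ κ₂) (hG : Integrable G)
    (hG0 : ∀ x, x ∉ Ω → G x = 0) (hGs : ∀ᵐ s : ℝ, ∫ t, G (pt (s, t)) = 0) :
    ∀ᵐ x : Plane, x ∉ Ω → vint G x = 0 := by
  filter_upwards [ae_fiber_good hG hGs] with x ⟨hi, h0⟩ hx
  by_cases hx0 : x 0 ∈ Ioo a b
  · have hcase : x 1 ≤ κ₁ (x 0) ∨ κ₂ (x 0) ≤ x 1 := by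
      by_contra! h
      exact hx (by rw [hΩ]; exact ⟨hx0, h⟩)
    rcases hcase with h | h
    · refine setIntegral_eq_zero_of_forall_eq_zero fun t ht => hG0 _ ?_
      rw [hΩ]
      exact fun h' => absurd (h'.2.1 : κ₁ (x 0) < t) (not_lt.2 ((mem_Iio.1 ht).le.trans h))
    · rw [vint, ← h0]
      refine setIntegral_eq_integral_of_forall_compl_eq_zero fun t ht => hG0 _ ?_
      rw [hΩ]
      exact fun h' => absurd (h'.2.2 : t < κ₂ (x 0)) (not_lt.2 (h.trans (not_lt.1 ht)))
  · exact vint_eq_zero_of_notMem hΩ hG0 hx0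

theorem integrable_vint (h₁ : Continuous κ₁) (h₂ : Continuous κ₂)
    (hΩ : Ω = between (Ioo a b) κ₁ κ₂) (hGm : Measurable G) (hG : Integrable G)
    (hG0 : ∀ x, x ∉ Ω → G x = 0) (hGs : ∀ᵐ s : ℝ, ∫ t, G (pt (s, t)) = 0) :
    Integrable (vint G) := by
  have hΩm : MeasurableSet Ω := by rw [hΩ]; exact (isOpen_between h₁ h₂ isOpen_Ioo).measurableSet
  have h1 : IntegrableOn (vint G) Ω := by
    obtain ⟨R, hR⟩ := (isBounded_between h₁ h₂ a b).subset_closedBall (0 : Plane)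
    refine ((locallyIntegrable_vint hGm hG).integrableOn_isCompact
      (isCompact_closedBall (0 : Plane) R)).mono_set ?_
    rw [hΩ]; exact between_subset.trans hR
  refine ((integrable_indicator_iff hΩm).2 h1).congr ?_
  filter_upwards [ae_vint_eq_zero hΩ hG hG0 hGs] with x hx
  by_cases h : x ∈ Ω
  · rw [indicator_of_mem h]
  · rw [indicator_of_notMem h, hx h]

theorem ofReal_tri {f : ℝ → ℝ} (hf0 : ∀ t, 0 ≤ f t) {c₃ : ℝ}
    (htri : ∀ t s, f (t + s) ≤ c₃ * (f t + f s)) (t s : ℝ) :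
    ENNReal.ofReal (f (t + s))
      ≤ ENNReal.ofReal |c₃| * (ENNReal.ofReal (f t) + ENNReal.ofReal (f s)) := by
  rw [← ENNReal.ofReal_add (hf0 t) (hf0 s), ← ENNReal.ofReal_mul (abs_nonneg _)]
  exact ENNReal.ofReal_le_ofReal ((htri t s).trans
    (mul_le_mul_of_nonneg_right (le_abs_self c₃) (add_nonneg (hf0 t) (hf0 s))))

/-- Near the graphs the area is finite, and off Ω the integrand is the constant 1 + f 0. -/
theorem setLIntegral_one_add_ne_top {f : ℝ → ℝ} (hf0 : ∀ t, 0 ≤ f t)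
    (h₁ : Continuous κ₁) (h₂ : Continuous κ₂)
    (hG0 : ∀ x, x ∉ Ω → G x = 0) (hΩm : MeasurableSet Ω)
    (hfin : ∫⁻ x in Ω, ENNReal.ofReal (f (G x)) ≠ ⊤) :
    ∫⁻ x in nearGraphs a b κ₁ κ₂ 4, ENNReal.ofReal (1 + f (G x)) ≠ ⊤ := by
  have hv : volume (nearGraphs a b κ₁ κ₂ 4) ≠ ⊤ :=
    ((volume_nearGraphs_le h₁ h₂ 4).trans_lt (ENNReal.mul_lt_top ENNReal.ofNat_lt_top
      (ENNReal.mul_lt_top ENNReal.ofReal_lt_top ENNReal.ofReal_lt_top))).ne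
  have hle : ∀ x, ENNReal.ofReal (1 + f (G x))
      ≤ ENNReal.ofReal (1 + f 0) + Ω.indicator (fun x => ENNReal.ofReal (f (G x))) x := by
    intro x
    by_cases h : x ∈ Ω
    · rw [indicator_of_mem h, ENNReal.ofReal_add zero_le_one (hf0 _)]
      exact add_le_add (ENNReal.ofReal_le_ofReal (by linarith [hf0 0])) le_rfl
    · rw [hG0 x h]; exact le_self_add
  refine ne_top_of_le_ne_top ?_ (lintegral_mono hle)
  rw [lintegral_add_left measurable_const, setLIntegral_const]
  refine ENNReal.add_ne_top.2 ⟨ENNReal.mul_ne_top ENNReal.ofReal_ne_top hv, ?_⟩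
  refine ne_top_of_le_ne_top hfin ((setLIntegral_le_lintegral _ _).trans_eq ?_)
  rw [lintegral_indicator hΩm]

/-- The term v ∂β is a bounded combination of vertical averages of G, so both its L¹ norm and its
energy are dominated by integrals over a neighbourhood of the graphs of width 4η. These tend to zero
by absolute continuity. Here q stands for ∂_2 u₀; f(q + ·) is reduced to f by the quasi-triangle
inequality. -/
theorem exists_cutoff_approx {L₁ L₂ : ℝ≥0} (h₁ : LipschitzWith L₁ κ₁) (h₂ : LipschitzWith L₂ κ₂)
    (hΩ : Ω = between (Ioo a b) κ₁ κ₂) (hGm : Measurable G) (hG : Integrable G)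
    (hG0 : ∀ x, x ∉ Ω → G x = 0) (hGs : ∀ᵐ s : ℝ, ∫ t, G (pt (s, t)) = 0)
    {f : ℝ → ℝ} (hf : ConvexOn ℝ univ f) (hf0 : ∀ t, 0 ≤ f t) {c₃ : ℝ}
    (htri : ∀ t s, f (t + s) ≤ c₃ * (f t + f s)) {q : Plane → ℝ} {Q : ℝ}
    (hq : ∀ x, ‖q x‖ ≤ Q) {ε : ℝ≥0∞} (hε : 0 < ε) :
    ∃ (β : Plane → ℝ) (δ : ℝ), 0 < δ ∧ ContDiff ℝ ((⊤ : ℕ∞) : WithTop ℕ∞) β ∧ (∀ x, 0 ≤ β x) ∧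
      (∀ x, β x ≤ 1) ∧ (∀ x, β x ≠ 0 → κ₁ (x 0) + δ ≤ x 1 ∧ x 1 ≤ κ₂ (x 0) - δ) ∧
      (∀ i, ∫⁻ x, ‖vint G x * pderiv i β x‖ₑ ≤ ε) ∧
      (∫⁻ x, ‖β x * vint G x - vint G x‖ₑ ≤ ε) ∧
      (∫⁻ x, ‖β x * G x + vint G x * pderiv 1 β x - G x‖ₑ ≤ ε) ∧
      (∫⁻ x in Ω, ENNReal.ofReal (1 - β x) ≤ ε) ∧
      (∫⁻ x in Ω, ENNReal.ofReal (f (q x + G x)) ≠ ⊤ →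
        ∫⁻ x in Ω, ENNReal.ofReal (f (β x * G x + vint G x * pderiv 1 β x)) ≠ ⊤ ∧
        ∫⁻ x in Ω, ENNReal.ofReal (f (q x + (β x * G x + vint G x * pderiv 1 β x)))
          ≤ (∫⁻ x in Ω, ENNReal.ofReal (f (q x + G x))) + ε) := by
  have hc₁ := h₁.continuous
  have hc₂ := h₂.continuous
  have hΩo : IsOpen Ω := by rw [hΩ]; exact isOpen_between hc₁ hc₂ isOpen_Ioo
  have hΩm : MeasurableSet Ω := hΩo.measurableSet
  have hΩf : volume Ω ≠ ⊤ := by rw [hΩ]; exact (volume_between_lt_top hc₁ hc₂).ne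
  have hfc : Continuous f := continuousOn_univ.1 (hf.continuousOn isOpen_univ)
  obtain ⟨M, C, hM, hC, hcut⟩ := exists_cutoff h₁ h₂
  obtain ⟨K, hK0, hK⟩ := exists_growth hf hf0 htri (max M 1)
  -- The L¹ estimate is the energy estimate for the convex function |·|.
  obtain ⟨K', hK'0, hK'⟩ := exists_growth (f := fun t : ℝ => |t|) (c₃ := 1) convexOn_abs (fun t => abs_nonneg t)
    (fun t s => by rw [one_mul]; exact abs_add_le t s) (max M 1)
  obtain ⟨Cq, hCq0, hCq⟩ : ∃ Cq : ℝ, 0 ≤ Cq ∧ ∀ t, ‖t‖ ≤ Q → f t ≤ Cq := by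
    obtain ⟨Cq, hCq⟩ := (isCompact_closedBall (0 : ℝ) Q).exists_bound_of_continuousOn
      hfc.continuousOn
    refine ⟨max Cq 0, le_max_right _ _, fun t ht => ?_⟩
    exact ((le_abs_self _).trans (hCq t (by simpa using ht))).trans (le_max_left _ _)
  -- the quantities which have to be small
  have hsmall : ∀ F : Plane → ℝ≥0∞, ∫⁻ x in nearGraphs a b κ₁ κ₂ 4, F x ≠ ⊤ → ∀ c : ℝ≥0∞, c ≠ ⊤ →
      ∀ ε' : ℝ≥0∞, 0 < ε' →
      ∀ᶠ η : ℝ in 𝓝[>] 0, c * ∫⁻ x in nearGraphs a b κ₁ κ₂ (4 * η), F x ≤ ε' := by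
    intro F hF c hc ε' hε'
    have h := ENNReal.Tendsto.const_mul (tendsto_setLIntegral_nearGraphs hc₁ hc₂ hF) (Or.inr hc)
    rw [mul_zero] at h
    exact (h.eventually (gt_mem_nhds hε')).mono fun η h => h.le
  have hε2 : 0 < ε / 2 := ENNReal.half_pos hε.ne'
  set Ψ' : Plane → ℝ≥0∞ := fun y => ENNReal.ofReal (1 + |G y|) with hΨ'
  set Ψ : Plane → ℝ≥0∞ := fun y => ENNReal.ofReal (1 + f (G y)) with hΨ
  have hΨ'm : Measurable Ψ' := (measurable_const.add hGm.abs).ennreal_ofReal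
  have hΨm : Measurable Ψ := (measurable_const.add (hfc.measurable.comp hGm)).ennreal_ofReal
  have hvi := integrable_vint hc₁ hc₂ hΩ hGm hG hG0 hGs
  have hG1 : ∫⁻ x, ‖G x‖ₑ ≠ ⊤ := hG.2.ne
  have e1 := hsmall Ψ' (setLIntegral_one_add_ne_top (fun t => abs_nonneg t) hc₁ hc₂
    hG0 hΩm (by
      refine ne_top_of_le_ne_top hG1 ((setLIntegral_le_lintegral _ _).trans_eq ?_)
      simp_rw [← Real.norm_eq_abs, ofReal_norm]))
    (ENNReal.ofReal C * (ENNReal.ofReal K' * 2) * 3) (by finiteness) (ε / 2) hε2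
  have e2 := hsmall (fun x => ‖vint G x‖ₑ)
    (ne_top_of_le_ne_top hvi.2.ne (setLIntegral_le_lintegral _ _)) 1 ENNReal.one_ne_top ε hε
  have e3 := hsmall (fun x => ‖G x‖ₑ)
    (ne_top_of_le_ne_top hG1 (setLIntegral_le_lintegral _ _)) 1 ENNReal.one_ne_top (ε / 2) hε2
  have e4 := hsmall (fun _ => 1) (by
    rw [setLIntegral_const, one_mul]
    exact ((volume_nearGraphs_le hc₁ hc₂ 4).trans_lt (ENNReal.mul_lt_top ENNReal.ofNat_lt_top
      (ENNReal.mul_lt_top ENNReal.ofReal_lt_top ENNReal.ofReal_lt_top))).ne)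
    1 ENNReal.one_ne_top ε hε
  -- The constants of repeated quasi-triangle inequalities: cH is for the three terms β G and the
  -- two averages, and cq adds the bounded term q.
  set k := ENNReal.ofReal K with hk
  set c := ENNReal.ofReal |c₃| with hcdef
  set cH := c * (k + c * (k + k)) with hcH
  have hcHtop : cH ≠ ⊤ := by
    simp only [hcH, hcdef, hk]; finiteness
  set cq := c * (ENNReal.ofReal Cq + cH) with hcq
  have hcqtop : cq ≠ ⊤ := by
    simp only [hcq, hcdef]; finiteness
  -- Finiteness is transferred from q + G to G by writing G = (q + G) + (-q).
  have hGfin : ∫⁻ x in Ω, ENNReal.ofReal (f (q x + G x)) ≠ ⊤ →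
      ∫⁻ x in Ω, ENNReal.ofReal (f (G x)) ≠ ⊤ := by
    intro hfin
    have hle : ∀ x, ENNReal.ofReal (f (G x))
        ≤ c * (ENNReal.ofReal (f (q x + G x)) + ENNReal.ofReal Cq) := by
      intro x
      have := ofReal_tri hf0 htri (q x + G x) (-q x)
      rw [show q x + G x + -q x = G x by ring] at this
      refine this.trans ?_
      gcongr
      exact hCq _ (by rw [norm_neg]; exact hq x)
    refine ne_top_of_le_ne_top ?_ (lintegral_mono hle)
    rw [lintegral_const_mul' _ _ ENNReal.ofReal_ne_top, lintegral_add_right _ measurable_const,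
      setLIntegral_const]
    exact ENNReal.mul_ne_top ENNReal.ofReal_ne_top (ENNReal.add_ne_top.2
      ⟨hfin, ENNReal.mul_ne_top ENNReal.ofReal_ne_top hΩf⟩)
  have e5 : ∀ᶠ η : ℝ in 𝓝[>] 0, ∫⁻ x in Ω, ENNReal.ofReal (f (q x + G x)) ≠ ⊤ →
      cq * 3 * ∫⁻ x in nearGraphs a b κ₁ κ₂ (4 * η), Ψ x ≤ ε := by
    by_cases hfin : ∫⁻ x in Ω, ENNReal.ofReal (f (q x + G x)) ≠ ⊤
    · have := hsmall Ψ (setLIntegral_one_add_ne_top hf0 hc₁ hc₂ hG0 hΩm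
        (hGfin hfin)) (cq * 3) (by finiteness) ε hε
      filter_upwards [this] with η h _ using h
    · exact Eventually.of_forall fun η h => absurd h hfin
  have e6 : ∀ᶠ η : ℝ in 𝓝[>] 0, η < 1 := nhdsWithin_le_nhds (gt_mem_nhds one_pos)
  obtain ⟨η, r1, r2, r3, r4, r5, r6, hη⟩ := (e1.and (e2.and (e3.and (e4.and (e5.and
    (e6.and self_mem_nhdsWithin)))))).exists
  have hη : 0 < η := hη
  obtain ⟨β, m₁, m₂, hβ, hβ0, hβ1, hβs, hm₁, hm₂, hm₁s, hm₂s, hβ_one, hd1, hdi⟩ := hcut η hη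
  have hh : 0 < 4 * η := by linarith
  set N := nearGraphs a b κ₁ κ₂ (4 * η) with hN
  have hNm : MeasurableSet N := measurableSet_nearGraphs hc₁ hc₂ _
  have hm₁' : ∀ x, 0 ≤ m₁ x ∧ m₁ x ≤ max M 1 := fun x =>
    ⟨(hm₁ x).1, (hm₁ x).2.trans (le_max_left _ _)⟩
  have hm₂' : ∀ x, 0 ≤ m₂ x ∧ m₂ x ≤ max M 1 := fun x =>
    ⟨(hm₂ x).1, (hm₂ x).2.trans (le_max_left _ _)⟩
  have hm₁N : ∀ x, x 0 ∈ Ioo a b → x ∉ N → m₁ x = 0 := by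
    intro x hx0 hx
    by_contra h
    have := hm₁s x h
    exact hx (Or.inl ⟨hx0, by rw [abs_of_nonneg this.1]; exact this.2⟩)
  have hm₂N : ∀ x, x 0 ∈ Ioo a b → x ∉ N → m₂ x = 0 := by
    intro x hx0 hx
    by_contra h
    have := hm₂s x h
    exact hx (Or.inr ⟨hx0, by rw [abs_sub_comm, abs_of_nonneg this.1]; exact this.2⟩)
  have hΩ0 : ∀ x ∈ Ω, x 0 ∈ Ioo a b := fun x hx => by rw [hΩ] at hx; exact hx.1
  have hβN : ∀ x ∈ Ω, x ∉ N → β x = 1 := by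
    intro x hx hxN
    have hx' := hx
    rw [hΩ] at hx'
    refine hβ_one x ?_ ?_
    · by_contra! h
      exact hxN (Or.inl ⟨hx'.1, by rw [abs_of_pos (by linarith [hx'.2.1])]; exact h⟩)
    · by_contra! h
      exact hxN (Or.inr ⟨hx'.1, by rw [abs_sub_comm, abs_of_pos (by linarith [hx'.2.2])]; exact h⟩)
  have hdN : ∀ i x, x 0 ∈ Ioo a b → x ∉ N → pderiv i β x = 0 := by
    intro i x hx0 hx
    have := hdi i x
    rw [hm₁N x hx0 hx, hm₂N x hx0 hx, add_zero, zero_div, mul_zero] at this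
    exact abs_nonpos_iff.1 this
  have hvdN : ∀ i x, x ∉ N → vint G x * pderiv i β x = 0 := by
    intro i x hx
    by_cases hx0 : x 0 ∈ Ioo a b
    · rw [hdN i x hx0 hx, mul_zero]
    · rw [vint_eq_zero_of_notMem hΩ hG0 hx0, zero_mul]
  have hGlow : ∀ x : Plane, ∀ t, t ≤ κ₁ (x 0) → G (pt (x 0, t)) = 0 := fun x t ht => hG0 _ (by
    rw [hΩ]; exact fun h => absurd (h.2.1 : κ₁ (x 0) < t) (not_lt.2 ht))
  have hGup : ∀ x : Plane, ∀ t, κ₂ (x 0) ≤ t → G (pt (x 0, t)) = 0 := fun x t ht => hG0 _ (by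
    rw [hΩ]; exact fun h => absurd (h.2.2 : t < κ₂ (x 0)) (not_lt.2 ht))
  have hgood := ae_fiber_good hG hGs
  -- the derivative of the cutoff function in terms of averages
  have hp1 : ∀ᵐ x : Plane, m₁ x * (vint G x / (4 * η)) = m₁ x * avg G 1 (4 * η) x ∧
      m₂ x * (vint G x / (4 * η)) = -(m₂ x * avg G (-1) (4 * η) x) := by
    filter_upwards [hgood] with x ⟨hi, h0⟩
    constructor
    · by_cases h : m₁ x = 0
      · rw [h, zero_mul, zero_mul]
      · rw [vint_eq_avg_one hh (hGlow x) (hm₁s x h).2]; field_simp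
    · by_cases h : m₂ x = 0
      · rw [h, zero_mul, zero_mul, neg_zero]
      · rw [vint_eq_avg_neg_one hh (hGup x) (hm₂s x h).2 hi h0]; field_simp
  have hp2 : ∀ᵐ x : Plane, vint G x * pderiv 1 β x
      = m₁ x * avg G 1 (4 * η) x + m₂ x * avg G (-1) (4 * η) x := by
    filter_upwards [hp1] with x ⟨hx1, hx2⟩
    rw [hd1, ← hx1, ← neg_neg (m₂ x * avg G (-1) (4 * η) x), ← hx2]; ring
  have hp3 : ∀ i, ∀ᵐ x : Plane, x ∈ N → ‖vint G x * pderiv i β x‖ₑ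
      ≤ ENNReal.ofReal C * (ENNReal.ofReal K' * 2) * dominator a b κ₁ κ₂ Ψ' (4 * η) x := by
    intro i
    filter_upwards [hp1, hgood] with x ⟨hx1, hx2⟩ ⟨hi, h0⟩ hxN
    have hx0 : x 0 ∈ Ioo a b := hxN.elim (fun h => h.1) fun h => h.1
    obtain ⟨d1, d2⟩ := ofReal_comp_avg_le_dominator (f := fun t : ℝ => |t|) (a := a) (b := b)
      (κ₁ := κ₁) (κ₂ := κ₂) convexOn_abs
      (fun t => abs_nonneg t) hi hx0 hh hK'0 hK' (hm₁' x) (hm₂' x) (hm₁s x) (hm₂s x)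
    have hb : |vint G x * pderiv i β x|
        ≤ C * (|m₁ x * avg G 1 (4 * η) x| + |m₂ x * avg G (-1) (4 * η) x|) := by
      rw [← hx1, ← abs_neg (m₂ x * avg G (-1) (4 * η) x), ← hx2, abs_mul, abs_mul, abs_mul,
        abs_of_nonneg (hm₁ x).1, abs_of_nonneg (hm₂ x).1, abs_div, abs_of_pos hh]
      refine (mul_le_mul_of_nonneg_left (hdi i x) (abs_nonneg _)).trans_eq ?_
      ring
    rw [← ofReal_norm, Real.norm_eq_abs]
    refine (ENNReal.ofReal_le_ofReal hb).trans ?_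
    rw [ENNReal.ofReal_mul hC.le, ENNReal.ofReal_add (abs_nonneg _) (abs_nonneg _), mul_assoc]
    refine mul_le_mul_right ((add_le_add d1 d2).trans_eq ?_) _
    ring
  -- Half of ε is kept because this bound is later added to the one for (β - 1) G.
  have hI1 : ∀ i, ∫⁻ x, ‖vint G x * pderiv i β x‖ₑ ≤ ε / 2 := by
    intro i
    have h1 : ∫⁻ x, ‖vint G x * pderiv i β x‖ₑ = ∫⁻ x in N, ‖vint G x * pderiv i β x‖ₑ := by
      rw [← lintegral_indicator hNm]
      refine lintegral_congr fun x => ?_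
      by_cases hx : x ∈ N
      · rw [indicator_of_mem hx]
      · rw [indicator_of_notMem hx, hvdN i x hx, enorm_zero]
    rw [h1]
    refine (setLIntegral_mono_ae' hNm (hp3 i)).trans ?_
    rw [lintegral_const_mul' _ _ (by finiteness)]
    refine le_trans ?_ r1
    rw [mul_assoc _ (3 : ℝ≥0∞)]
    exact mul_le_mul_right (setLIntegral_dominator_le hc₁ hc₂ hΨ'm hh) _
  have hv0 := ae_vint_eq_zero hΩ hG hG0 hGs
  have hone : ∀ x, |β x - 1| ≤ 1 := fun x =>
    abs_le.2 ⟨by linarith [hβ0 x], by linarith [hβ1 x]⟩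
  refine ⟨β, η, hη, hβ, hβ0, hβ1, hβs, fun i => (hI1 i).trans ENNReal.half_le_self, ?_, ?_, ?_, ?_⟩
  · rw [one_mul] at r2
    refine le_trans ?_ r2
    rw [← lintegral_indicator hNm]
    refine lintegral_mono_ae ?_
    filter_upwards [hv0] with x hx
    by_cases hxN : x ∈ N
    · rw [indicator_of_mem hxN, show β x * vint G x - vint G x = (β x - 1) * vint G x by ring,
        enorm_mul]
      refine mul_le_of_le_one_left (zero_le) ?_
      rw [← ofReal_norm, ENNReal.ofReal_le_one]; exact hone x
    · by_cases hxΩ : x ∈ Ω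
      · rw [hβN x hxΩ hxN, one_mul, sub_self, enorm_zero]; exact zero_le
      · rw [hx hxΩ, mul_zero, sub_zero, enorm_zero]; exact zero_le
  · rw [one_mul] at r3
    have h1 : ∀ x, ‖β x * G x + vint G x * pderiv 1 β x - G x‖ₑ
        ≤ N.indicator (fun x => ‖G x‖ₑ) x + ‖vint G x * pderiv 1 β x‖ₑ := by
      intro x
      rw [show β x * G x + vint G x * pderiv 1 β x - G x
        = (β x - 1) * G x + vint G x * pderiv 1 β x by ring]
      refine (enorm_add_le _ _).trans (add_le_add ?_ le_rfl)
      by_cases hxN : x ∈ N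
      · rw [indicator_of_mem hxN, enorm_mul]
        refine mul_le_of_le_one_left (zero_le) ?_
        rw [← ofReal_norm, ENNReal.ofReal_le_one]; exact hone x
      · by_cases hxΩ : x ∈ Ω
        · rw [hβN x hxΩ hxN, sub_self, zero_mul, enorm_zero]; exact zero_le
        · rw [hG0 x hxΩ, mul_zero, enorm_zero]; exact zero_le
    refine (lintegral_mono h1).trans ?_
    rw [lintegral_add_left (hGm.enorm.indicator hNm), lintegral_indicator hNm]
    exact (add_le_add r3 (hI1 1)).trans_eq (ENNReal.add_halves ε)
  · rw [one_mul] at r4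
    refine le_trans ?_ r4
    rw [← lintegral_indicator hNm, ← lintegral_indicator hΩm]
    refine lintegral_mono fun x => ?_
    by_cases hxΩ : x ∈ Ω
    · rw [indicator_of_mem hxΩ]
      by_cases hxN : x ∈ N
      · rw [indicator_of_mem hxN, ENNReal.ofReal_le_one]; linarith [hβ0 x]
      · rw [hβN x hxΩ hxN, sub_self, ENNReal.ofReal_zero]; exact zero_le
    · rw [indicator_of_notMem hxΩ]; exact zero_le
  · intro hfin
    set D := dominator a b κ₁ κ₂ Ψ (4 * η) with hD
    have hΨD : ∀ x, Ψ x ≤ D x := fun x => le_add_self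
    have hH : ∀ᵐ x : Plane, x ∈ N →
        ENNReal.ofReal (f (β x * G x + vint G x * pderiv 1 β x)) ≤ cH * D x := by
      filter_upwards [hp2, hgood] with x hx ⟨hi, h0⟩ hxN
      have hx0 : x 0 ∈ Ioo a b := hxN.elim (fun h => h.1) fun h => h.1
      obtain ⟨d1, d2⟩ := ofReal_comp_avg_le_dominator (a := a) (b := b) (κ₁ := κ₁) (κ₂ := κ₂)
        hf hf0 hi hx0 hh hK0 hK (hm₁' x) (hm₂' x) (hm₁s x) (hm₂s x)
      rw [hx]
      have d3 : ENNReal.ofReal (f (β x * G x)) ≤ k * D x := by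
        refine le_trans ?_ (mul_le_mul_right (hΨD x) _)
        rw [hΨ, hk, ← ENNReal.ofReal_mul hK0.le]
        exact ENNReal.ofReal_le_ofReal (hK _ (hβ0 x) ((hβ1 x).trans (le_max_right _ _)) _)
      calc _ ≤ c * (ENNReal.ofReal (f (β x * G x)) + ENNReal.ofReal (f (m₁ x * avg G 1 (4 * η) x
              + m₂ x * avg G (-1) (4 * η) x))) := ofReal_tri hf0 htri _ _
        _ ≤ c * (k * D x + c * (k * D x + k * D x)) := by
            refine mul_le_mul_right (add_le_add d3 ?_) _
            exact (ofReal_tri hf0 htri _ _).trans (mul_le_mul_right (add_le_add d1 d2) _)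
        _ = cH * D x := by rw [hcH]; ring
    have hDfin : ∫⁻ x in N, D x ≤ 3 * ∫⁻ x in N, Ψ x := setLIntegral_dominator_le hc₁ hc₂ hΨm hh
    have hoff : ∀ x ∈ Ω, x ∉ N → β x * G x + vint G x * pderiv 1 β x = G x := by
      intro x hxΩ hxN
      rw [hβN x hxΩ hxN, hvdN 1 x hxN, one_mul, add_zero]
    have hΨN : ∫⁻ x in N, Ψ x ≠ ⊤ := by
      refine ne_top_of_le_ne_top (setLIntegral_one_add_ne_top (a := a) (b := b) hf0
        hc₁ hc₂ hG0 hΩm (hGfin hfin)) (lintegral_mono_set ?_)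
      exact nearGraphs_mono (by linarith)
    -- In Ω nothing changes off N, so the only additional cost is the integral over N.
    have hsplit : ∀ F F' : Plane → ℝ≥0∞, (∀ x ∈ Ω, x ∉ N → F x = F' x) →
        ∫⁻ x in Ω, F x ≤ (∫⁻ x in Ω, F' x) + ∫⁻ x in N, F x := by
      intro F F' hFF
      rw [← lintegral_inter_add_sdiff F Ω hNm, add_comm]
      refine add_le_add ?_ (lintegral_mono_set inter_subset_right)
      refine le_trans ?_ (lintegral_mono_set (sdiff_subset (s := Ω) (t := N)))
      exact setLIntegral_mono' (hΩm.diff hNm) fun x hx => (hFF x hx.1 hx.2).le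
    constructor
    · refine ne_top_of_le_ne_top ?_ (hsplit _ (fun x => ENNReal.ofReal (f (G x)))
        fun x h1 h2 => by rw [hoff x h1 h2])
      refine ENNReal.add_ne_top.2 ⟨hGfin hfin, ?_⟩
      refine ne_top_of_le_ne_top ?_ (setLIntegral_mono_ae' hNm hH)
      rw [lintegral_const_mul' _ _ hcHtop]
      exact ENNReal.mul_ne_top hcHtop (ne_top_of_le_ne_top
        (ENNReal.mul_ne_top ENNReal.ofNat_ne_top hΨN) hDfin)
    · refine (hsplit _ (fun x => ENNReal.ofReal (f (q x + G x)))
        fun x h1 h2 => by rw [hoff x h1 h2]).trans (add_le_add le_rfl ?_)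
      refine le_trans ?_ (r5 hfin)
      rw [mul_assoc]
      refine le_trans ?_ (mul_le_mul_right hDfin _)
      rw [← lintegral_const_mul' _ _ hcqtop]
      refine setLIntegral_mono_ae' hNm ?_
      filter_upwards [hH] with x hx hxN
      have h1 : ENNReal.ofReal (f (q x)) ≤ ENNReal.ofReal Cq * D x := by
        have : (1 : ℝ≥0∞) ≤ D x := by
          refine le_trans ?_ (hΨD x)
          rw [hΨ, ENNReal.one_le_ofReal]
          linarith [hf0 (G x)]
        calc ENNReal.ofReal (f (q x)) ≤ ENNReal.ofReal Cq * 1 := by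
              rw [mul_one]; exact ENNReal.ofReal_le_ofReal (hCq _ (hq x))
          _ ≤ _ := mul_le_mul_right this _
      calc _ ≤ c * (ENNReal.ofReal (f (q x))
              + ENNReal.ofReal (f (β x * G x + vint G x * pderiv 1 β x))) :=
            ofReal_tri hf0 htri _ _
        _ ≤ c * (ENNReal.ofReal Cq * D x + cH * D x) :=
            mul_le_mul_right (add_le_add h1 (hx hxN)) _
        _ = cq * D x := by rw [hcq]; ring

end CutoffApprox

/-! ### Derivatives under dilation and control of the support. -/

section Dilation

theorem hasFDerivAt_dil (c l : ℝ) (x : Plane) :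
    HasFDerivAt (dil c l) (ContinuousLinearMap.id ℝ Plane + (l - 1) •
      (EuclideanSpace.proj (0 : Fin 2) : Plane →L[ℝ] ℝ).smulRight
        (EuclideanSpace.single (0 : Fin 2) (1 : ℝ))) x := by
  have e : dil c l = fun x => x + ((l - 1) * (x 0 - c)) • EuclideanSpace.single (0 : Fin 2) (1 : ℝ) := by
    ext x i
    fin_cases i
    · simp [dil, pt]; ring
    · simp [dil, pt]
  rw [e]
  have h0 : HasFDerivAt (fun x : Plane => x 0)
      (EuclideanSpace.proj (0 : Fin 2) : Plane →L[ℝ] ℝ) x :=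
    (EuclideanSpace.proj (0 : Fin 2) : Plane →L[ℝ] ℝ).hasFDerivAt
  have h1 := (((h0.sub_const c).const_mul (l - 1)).smul_const
    (EuclideanSpace.single (0 : Fin 2) (1 : ℝ)))
  refine ((hasFDerivAt_id x).add h1).congr_fderiv ?_
  ext v i
  simp

theorem pderiv_zero_comp_dil {g : Plane → ℝ} (hg : Differentiable ℝ g) (c l : ℝ) (x : Plane) :
    pderiv 0 (fun x => g (dil c l x)) x = l * pderiv 0 g (dil c l x) := by
  have h := ((hg (dil c l x)).hasFDerivAt.comp x (hasFDerivAt_dil c l x)).fderiv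
  have h' : fderiv ℝ (fun x => g (dil c l x)) x = _ := h
  rw [pderiv, h', pderiv]
  simp
  ring

theorem pderiv_one_comp_dil {g : Plane → ℝ} (hg : Differentiable ℝ g) (c l : ℝ) (x : Plane) :
    pderiv 1 (fun x => g (dil c l x)) x = pderiv 1 g (dil c l x) := by
  have h := ((hg (dil c l x)).hasFDerivAt.comp x (hasFDerivAt_dil c l x)).fderiv
  have h' : fderiv ℝ (fun x => g (dil c l x)) x = _ := h
  rw [pderiv, h', pderiv]
  simp

theorem contDiff_dil (c l : ℝ) : ContDiff ℝ ((⊤ : ℕ∞) : WithTop ℕ∞) (dil c l) := by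
  have e : dil c l = fun x => x + ((l - 1) * (x 0 - c)) • EuclideanSpace.single (0 : Fin 2) (1 : ℝ) := by
    ext x i
    fin_cases i
    · simp [dil, pt]; ring
    · simp [dil, pt]
  rw [e]
  fun_prop

end Dilation

section Graphs

variable {a b : ℝ} {κ₁ κ₂ : ℝ → ℝ} {δ : ℝ}

theorem isCompact_core (h₁ : Continuous κ₁) (h₂ : Continuous κ₂) (a b : ℝ) (δ : ℝ) :
    IsCompact {x : Plane | x 0 ∈ Icc a b ∧ κ₁ (x 0) + δ ≤ x 1 ∧ x 1 ≤ κ₂ (x 0) - δ} := by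
  refine Metric.isCompact_of_isClosed_isBounded ?_ ?_
  · exact (isClosed_Icc.preimage (continuous_coord 0)).inter
      ((isClosed_le ((h₁.comp (continuous_coord 0)).add continuous_const) (continuous_coord 1)).inter
        (isClosed_le (continuous_coord 1) ((h₂.comp (continuous_coord 0)).sub continuous_const)))
  · exact isBounded_between (κ₁ := fun s => κ₁ s + δ) (κ₂ := fun s => κ₂ s - δ)
      (h₁.add continuous_const) (h₂.sub continuous_const) a b

/-- Mollifying on the scale `r` and contracting horizontally moves the support into `Ω`. -/
theorem isTest_moll_dil {L : ℝ≥0} (hab : a < b) (h₁ : LipschitzWith L κ₁)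
    (h₂ : LipschitzWith L κ₂) {V : Plane → ℝ} (hV : Integrable V)
    (hVs : ∀ x, V x ≠ 0 → x 0 ∈ Icc a b ∧ κ₁ (x 0) + δ ≤ x 1 ∧ x 1 ≤ κ₂ (x 0) - δ)
    (ρ : ContDiffBump (0 : Plane)) {r : ℝ} (hr : ρ.rOut = r) (hrδ : (3 * L + 1) * r < δ) :
    IsTest (between (Ioo a b) κ₁ κ₂)
      (fun x => moll ρ V (dil ((a + b) / 2) (1 + 4 * r / (b - a)) x)) := by
  set C : Set Plane := {x | x 0 ∈ Icc a b ∧ κ₁ (x 0) + δ ≤ x 1 ∧ x 1 ≤ κ₂ (x 0) - δ} with hC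
  have hCc : IsCompact C := isCompact_core h₁.continuous h₂.continuous a b δ
  have hr0 : 0 < r := hr ▸ ρ.rOut_pos
  set l := 1 + 4 * r / (b - a) with hl
  set c := (a + b) / 2 with hc
  have hl1 : 1 ≤ l := by
    have : 0 < 4 * r / (b - a) := div_pos (by linarith) (by linarith)
    linarith
  -- The dilation moves each vertical side outwards by 2r, more than the r by which mollification
  -- enlarges the support.
  have hlr : (l - 1) * (b - a) = 4 * r := by
    rw [hl]; field_simp [sub_ne_zero.2 hab.ne']; ring
  have hsub : tsupport (fun x => moll ρ V (dil c l x)) ⊆ dil c l ⁻¹' Metric.cthickening r C := by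
    refine (tsupport_comp_subset_preimage (moll ρ V) (continuous_dil c l)).trans (preimage_mono ?_)
    rw [← hr]
    exact tsupport_moll_subset ρ fun y hy => by
      by_contra h
      exact hy (hVs y h)
  refine ⟨(contDiff_moll ρ hV.locallyIntegrable).comp (contDiff_dil c l), ?_, ?_⟩
  · refine Metric.isCompact_of_isClosed_isBounded (isClosed_tsupport _) ?_
    obtain ⟨R, hR⟩ := hCc.isBounded.cthickening (δ := r) |>.subset_closedBall (0 : Plane)
    refine (Metric.isBounded_closedBall (x := (0 : Plane)) (r := 2 * |c| + 2 * R)).subset ?_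
    intro x hx
    have := hR (hsub hx)
    rw [mem_closedBall_zero_iff] at this ⊢
    exact norm_le_of_norm_dil_le hl1 this
  · intro x hx
    have hx' := hsub hx
    rw [mem_preimage, hCc.cthickening_eq_biUnion_closedBall hr0.le, mem_iUnion₂] at hx'
    obtain ⟨y, ⟨hy0, hy1, hy2⟩, hxy⟩ := hx'
    rw [Metric.mem_closedBall] at hxy
    have d0 := abs_le.1 ((abs_coord_sub_le_dist _ _ 0).trans hxy)
    have d1 := abs_le.1 ((abs_coord_sub_le_dist _ _ 1).trans hxy)
    have e0 : dil c l x 0 = c + l * (x 0 - c) := rfl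
    have e1 : dil c l x 1 = x 1 := rfl
    rw [e0] at d0
    rw [e1] at d1
    have hx0 : x 0 ∈ Ioo a b := by
      constructor
      · by_contra! h
        have : (l - 1) * (x 0 - c) ≤ -(2 * r) := by nlinarith
        linarith [hy0.1]
      · by_contra! h
        have : 2 * r ≤ (l - 1) * (x 0 - c) := by nlinarith
        linarith [hy0.2]
    -- At most 2r comes from the dilation and r from the mollification. The graphs change by at most
    -- 3 L r over this distance, and x 1 differs from y 1 by at most r, whence (3 L + 1) r < δ.
    have hxy0 : |x 0 - y 0| ≤ 3 * r := by
      have u1 : (l - 1) * (x 0 - c) ≤ 2 * r := by nlinarith [hx0.2]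
      have u2 : -(2 * r) ≤ (l - 1) * (x 0 - c) := by nlinarith [hx0.1]
      rw [abs_le]; constructor <;> linarith
    have k1 := h₁.dist_le_mul (x 0) (y 0)
    have k2 := h₂.dist_le_mul (x 0) (y 0)
    rw [Real.dist_eq, Real.dist_eq] at k1 k2
    have hL : (L : ℝ) * |x 0 - y 0| ≤ L * (3 * r) := mul_le_mul_of_nonneg_left hxy0 L.coe_nonneg
    have k1' := abs_le.1 (k1.trans hL)
    have k2' := abs_le.1 (k2.trans hL)
    exact ⟨hx0, by linarith, by linarith⟩

end Graphs

/-! ### Product rule for weak derivatives. -/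

section Product

theorem integrable_mul_hasCompactSupport {h φ : Plane → ℝ} (hh : Integrable h)
    (hφ : Continuous φ) (hc : HasCompactSupport φ) : Integrable fun x => h x * φ x := by
  obtain ⟨C, hC⟩ := hφ.bounded_above_of_compact_support hc
  exact hh.mul_bdd hφ.aestronglyMeasurable (Eventually.of_forall hC)

theorem IsTest.mul_left {β φ : Plane → ℝ} {U : Set Plane}
    (hβ : ContDiff ℝ ((⊤ : ℕ∞) : WithTop ℕ∞) β) (hφ : IsTest U φ) :
    IsTest U fun x => β x * φ x :=
  ⟨hβ.mul hφ.smooth, hφ.hasCompactSupport.mul_left,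
    (closure_mono (Function.support_mul_subset_right β φ)).trans hφ.tsupport_subset⟩

/-- The product rule for the weak derivative. -/
theorem weak_pderiv_mul {v G β : Plane → ℝ} {i : Fin 2} (hv : Integrable v) (hG : Integrable G)
    (hw : ∀ φ, IsTest univ φ → ∫ x, v x * pderiv i φ x = -∫ x, G x * φ x)
    (hβ : ContDiff ℝ ((⊤ : ℕ∞) : WithTop ℕ∞) β) {φ : Plane → ℝ} (hφ : IsTest univ φ) :
    ∫ x, β x * v x * pderiv i φ x = -∫ x, (β x * G x + v x * pderiv i β x) * φ x := by
  have hβφ := hφ.mul_left hβ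
  have h1 := hw _ hβφ
  have hd : ∀ x, pderiv i (fun x => β x * φ x) x = β x * pderiv i φ x + φ x * pderiv i β x :=
    fun x => by
    rw [pderiv_mul (hβ.differentiable (by simp) x) (hφ.smooth.differentiable (by simp) x) i]; ring
  simp_rw [hd] at h1
  have i1 : Integrable fun x => v x * (β x * pderiv i φ x) :=
    integrable_mul_hasCompactSupport hv (hβ.continuous.mul (continuous_pderiv hφ.smooth i))
      (hasCompactSupport_pderiv hφ.hasCompactSupport i).mul_left
  have i2 : Integrable fun x => v x * (φ x * pderiv i β x) :=
    integrable_mul_hasCompactSupport hv (hφ.smooth.continuous.mul (continuous_pderiv hβ i))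
      hφ.hasCompactSupport.mul_right
  have i3 : Integrable fun x => G x * (β x * φ x) :=
    integrable_mul_hasCompactSupport hG hβφ.smooth.continuous hβφ.hasCompactSupport
  have e1 : ∫ x, v x * (β x * pderiv i φ x + φ x * pderiv i β x)
      = (∫ x, v x * (β x * pderiv i φ x)) + ∫ x, v x * (φ x * pderiv i β x) := by
    rw [← integral_add i1 i2]
    congr 1; ext x; ring
  have e2 : ∫ x, (β x * G x + v x * pderiv i β x) * φ x
      = (∫ x, G x * (β x * φ x)) + ∫ x, v x * (φ x * pderiv i β x) := by
    rw [← integral_add i3 i2]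
    congr 1; ext x; ring
  have e3 : ∫ x, β x * v x * pderiv i φ x = ∫ x, v x * (β x * pderiv i φ x) := by
    congr 1; ext x; ring
  rw [e1] at h1
  rw [e2, e3]
  linarith

end Product

/-! ### The energy under mollification and dilation. -/

section Energy

variable {Ω : Set Plane} {f : ℝ → ℝ} {c₃ : ℝ} {q H : Plane → ℝ} {Q : ℝ}

/-- The term q is not mollified, so Jensen's inequality is applied to H alone after the
quasi-triangle inequality. This bounds the integrands by a sequence converging in L¹, and
`eventually_lintegral_le_of_dominated` then recovers the limit with constant 1. -/
theorem eventually_energy_moll_dil_le (hΩm : MeasurableSet Ω) (hΩf : volume Ω ≠ ⊤)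
    (hf : ConvexOn ℝ univ f) (hf0 : ∀ t, 0 ≤ f t)
    (htri : ∀ t s, f (t + s) ≤ c₃ * (f t + f s)) (hqm : Measurable q) (hq : ∀ x, ‖q x‖ ≤ Q)
    {ρ : ℕ → ContDiffBump (0 : Plane)} {c : ℝ} {l : ℕ → ℝ}
    (hρ : Tendsto (fun j => (ρ j).rOut) atTop (𝓝 0)) (hl1 : ∀ j, 1 ≤ l j)
    (hl : Tendsto l atTop (𝓝 1)) (hH : Integrable H) (hH0 : ∀ x, x ∉ Ω → H x = 0)
    (hfin : ∫⁻ x in Ω, ENNReal.ofReal (f (H x)) ≠ ⊤) {ε : ℝ≥0∞} (hε : 0 < ε) :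
    ∀ᶠ j in atTop, ∫⁻ x in Ω, ENNReal.ofReal (f (q x + moll (ρ j) H (dil c (l j) x)))
      ≤ (∫⁻ x in Ω, ENNReal.ofReal (f (q x + H x))) + ε := by
  have hfc : Continuous f := continuousOn_univ.1 (hf.continuousOn isOpen_univ)
  obtain ⟨Cq, hCq0, hCq⟩ : ∃ Cq : ℝ, 0 ≤ Cq ∧ ∀ t, ‖t‖ ≤ Q → f t ≤ Cq := by
    obtain ⟨Cq, hCq⟩ := (isCompact_closedBall (0 : ℝ) Q).exists_bound_of_continuousOn
      hfc.continuousOn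
    refine ⟨max Cq 0, le_max_right _ _, fun t ht => ?_⟩
    exact ((le_abs_self _).trans (hCq t (by simpa using ht))).trans (le_max_left _ _)
  have hfHm : AEStronglyMeasurable (fun x => f (H x)) :=
    hfc.comp_aestronglyMeasurable hH.aestronglyMeasurable
  have hfH : IntegrableOn (fun x => f (H x)) Ω := by
    refine ⟨hfHm.restrict, ?_⟩
    rw [hasFiniteIntegral_iff_ofReal (Eventually.of_forall fun x => hf0 _)]
    exact lt_top_iff_ne_top.2 hfin
  -- Where H vanishes f ∘ H equals f 0, so f ∘ H may fail to be integrable on the plane; the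
  -- restriction to Ω is integrable and the correction f 0 is kept as a constant.
  set F := Ω.indicator (fun x => f (H x)) with hF
  have hFi : Integrable F := (integrable_indicator_iff hΩm).2 hfH
  have hF0 : ∀ x, 0 ≤ F x := fun x => indicator_nonneg (fun x _ => hf0 _) x
  have hfF : ∀ x, f (H x) ≤ F x + f 0 := by
    intro x
    by_cases hx : x ∈ Ω
    · rw [hF, indicator_of_mem hx]; linarith [hf0 0]
    · rw [hH0 x hx]; linarith [hF0 x]
  have hfHl : LocallyIntegrable fun x => f (H x) := by
    refine ((hFi.locallyIntegrable.add (locallyIntegrable_const (f 0)))).mono hfHm ?_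
    refine Eventually.of_forall fun x => ?_
    rw [Real.norm_of_nonneg (hf0 _)]
    exact (hfF x).trans (le_abs_self _)
  have hjen : ∀ j x, f (moll (ρ j) H x) ≤ moll (ρ j) F x + f 0 := by
    intro j x
    have hi := integrable_mollMeasure (ρ j) hfHl x
    have hi2 := integrable_mollMeasure (ρ j) hFi.locallyIntegrable x
    rw [moll_eq_integral, moll_eq_integral]
    refine (hf.map_integral_le hfc.continuousOn isClosed_univ (by simp)
      (integrable_mollMeasure (ρ j) hH.locallyIntegrable x) hi).trans ?_
    refine (integral_mono hi (hi2.add (integrable_const (f 0))) hfF).trans_eq ?_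
    simp only [Pi.add_apply]
    rw [integral_add hi2 (integrable_const _)]
    simp
  set k := ENNReal.ofReal |c₃| with hk
  have hlim := tendsto_moll_dil (c := c) hρ hl1 hl hH
  have hlimF := tendsto_moll_dil (c := c) hρ hl1 hl hFi
  have hTm : ∀ j, ∀ {h : Plane → ℝ}, Integrable h →
      Measurable fun x => moll (ρ j) h (dil c (l j) x) := fun j h hh =>
    ((contDiff_moll (ρ j) hh.locallyIntegrable).continuous.comp (continuous_dil _ _)).measurable
  refine eventually_lintegral_le_of_dominated (μ := volume.restrict Ω) hfc
    (d := fun j x => q x + moll (ρ j) H (dil c (l j) x)) (d₀ := fun x => q x + H x)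
    (h := fun j x => k * (ENNReal.ofReal (Cq + f 0) +
      ENNReal.ofReal (moll (ρ j) F (dil c (l j) x))))
    (h₀ := fun x => k * (ENNReal.ofReal (Cq + f 0) + ENNReal.ofReal (F x)))
    ?_ ?_ ?_ ?_ ?_ ?_ ?_ ?_ hε
  · exact fun j => (hqm.add (hTm j hH)).aestronglyMeasurable
  · exact (hqm.aestronglyMeasurable.add hH.aestronglyMeasurable).restrict
  · refine tendsto_of_tendsto_of_tendsto_of_le_of_le tendsto_const_nhds hlim
      (fun _ => zero_le) fun j => ?_
    refine (setLIntegral_le_lintegral _ _).trans (lintegral_mono fun x => ?_)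
    rw [add_sub_add_left_eq_sub]
  · exact ((hFi.aestronglyMeasurable.aemeasurable.ennreal_ofReal.const_add _).const_mul _).restrict
  · refine Eventually.of_forall fun j => Eventually.of_forall fun x => ?_
    refine (ofReal_tri hf0 htri _ _).trans (mul_le_mul_right ?_ _)
    rw [← ENNReal.ofReal_add (hf0 _) (hf0 _)]
    refine (ENNReal.ofReal_le_ofReal (add_le_add (hCq _ (hq x)) (hjen j _))).trans ?_
    rw [show Cq + (moll (ρ j) F (dil c (l j) x) + f 0)
      = (Cq + f 0) + moll (ρ j) F (dil c (l j) x) by ring]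
    exact ENNReal.ofReal_add_le
  · have h2 : Tendsto (fun j => k * ∫⁻ x, ‖moll (ρ j) F (dil c (l j) x) - F x‖ₑ) atTop (𝓝 0) := by
      have := ENNReal.Tendsto.const_mul (a := k) hlimF (Or.inr ENNReal.ofReal_ne_top)
      rwa [mul_zero] at this
    refine tendsto_of_tendsto_of_tendsto_of_le_of_le tendsto_const_nhds h2
      (fun _ => zero_le) fun j => ?_
    rw [← lintegral_const_mul' _ _ ENNReal.ofReal_ne_top]
    refine (setLIntegral_le_lintegral _ _).trans (lintegral_mono fun x => ?_)
    rw [tsub_le_iff_left, ← mul_add]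
    refine mul_le_mul_right ?_ _
    rw [add_assoc]
    refine add_le_add le_rfl ?_
    rw [← ofReal_norm, ← ENNReal.ofReal_add (hF0 x) (norm_nonneg _)]
    refine ENNReal.ofReal_le_ofReal ?_
    have := le_abs_self (moll (ρ j) F (dil c (l j) x) - F x)
    rw [Real.norm_eq_abs]; linarith
  · rw [lintegral_const_mul' _ _ ENNReal.ofReal_ne_top, lintegral_add_left measurable_const,
      setLIntegral_const]
    refine ENNReal.mul_ne_top ENNReal.ofReal_ne_top (ENNReal.add_ne_top.2
      ⟨ENNReal.mul_ne_top ENNReal.ofReal_ne_top hΩf, ?_⟩)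
    refine ne_top_of_le_ne_top hFi.2.ne ((setLIntegral_le_lintegral _ _).trans
      (lintegral_mono fun x => ?_))
    rw [← ofReal_norm]
    exact ENNReal.ofReal_le_ofReal (le_abs_self _)
  · have hle : ∀ x, ENNReal.ofReal (f (q x + H x))
        ≤ k * (ENNReal.ofReal Cq + ENNReal.ofReal (f (H x))) := fun x =>
      (ofReal_tri hf0 htri _ _).trans (mul_le_mul_right (add_le_add
        (ENNReal.ofReal_le_ofReal (hCq _ (hq x))) le_rfl) _)
    refine ne_top_of_le_ne_top ?_ (lintegral_mono hle)
    rw [lintegral_const_mul' _ _ ENNReal.ofReal_ne_top, lintegral_add_left measurable_const,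
      setLIntegral_const]
    exact ENNReal.mul_ne_top ENNReal.ofReal_ne_top (ENNReal.add_ne_top.2
      ⟨ENNReal.mul_ne_top ENNReal.ofReal_ne_top hΩf, hfin⟩)

end Energy

/-! ### The conjugate integrand and mollified dual fields. -/

section Gap

/-- The convex function `1 - √(1 - |ξ|²)` on the unit disc, in coordinates. -/
noncomputable def gap (p q : ℝ) : ℝ := 1 - √(1 - (p ^ 2 + q ^ 2))

theorem gap_nonneg (p q : ℝ) : 0 ≤ gap p q := by
  rw [gap, sub_nonneg, Real.sqrt_le_one]
  nlinarith [sq_nonneg p, sq_nonneg q]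

theorem gap_le_one (p q : ℝ) : gap p q ≤ 1 := by
  rw [gap]; linarith [Real.sqrt_nonneg (1 - (p ^ 2 + q ^ 2))]

@[simp] theorem gap_zero : gap 0 0 = 0 := by simp [gap]

theorem gap_mono {p q p' q' : ℝ} (h : p ^ 2 + q ^ 2 ≤ p' ^ 2 + q' ^ 2) : gap p q ≤ gap p' q' := by
  rw [gap, gap]
  have := Real.sqrt_le_sqrt (x := 1 - (p' ^ 2 + q' ^ 2)) (y := 1 - (p ^ 2 + q ^ 2)) (by linarith)
  linarith

/-- Along an integrable field the gap is integrable over the whole plane, unlike √(1 - |ξ|²), which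
equals 1 where the field vanishes. -/
theorem gap_le_abs {p q : ℝ} (h : p ^ 2 + q ^ 2 ≤ 1) : gap p q ≤ |p| + |q| := by
  have h1 : gap p q ≤ p ^ 2 + q ^ 2 := by
    have h0 : 0 ≤ 1 - (p ^ 2 + q ^ 2) := by linarith
    have h2 : 1 - (p ^ 2 + q ^ 2) ≤ √(1 - (p ^ 2 + q ^ 2)) := by
      refine Real.le_sqrt_of_sq_le ?_
      nlinarith [sq_nonneg p, sq_nonneg q]
    rw [gap]; linarith
  have hp : |p| ≤ 1 := by rw [← sq_le_one_iff_abs_le_one]; nlinarith [sq_nonneg q]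
  have hq : |q| ≤ 1 := by rw [← sq_le_one_iff_abs_le_one]; nlinarith [sq_nonneg p]
  rw [← sq_abs p, ← sq_abs q] at h1
  nlinarith [abs_nonneg p, abs_nonneg q]

theorem continuous_gap : Continuous fun z : ℝ × ℝ => gap z.1 z.2 := by
  unfold gap; fun_prop

/-- Jensen's inequality for `gap`. -/
theorem gap_integral_le {α : Type*} [MeasurableSpace α] {μ : Measure α} [IsProbabilityMeasure μ]
    {p q : α → ℝ} (hp : AEStronglyMeasurable p μ) (hq : AEStronglyMeasurable q μ)
    (h : ∀ x, p x ^ 2 + q x ^ 2 ≤ 1) :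
    gap (∫ x, p x ∂μ) (∫ x, q x ∂μ) ≤ ∫ x, gap (p x) (q x) ∂μ := by
  have hb : ∀ x, |p x| ≤ 1 ∧ |q x| ≤ 1 := fun x =>
    ⟨by rw [← sq_le_one_iff_abs_le_one]; nlinarith [h x, sq_nonneg (q x)],
      by rw [← sq_le_one_iff_abs_le_one]; nlinarith [h x, sq_nonneg (p x)]⟩
  have hpi : Integrable p μ := Integrable.of_bound hp 1 (Eventually.of_forall fun x => (hb x).1)
  have hqi : Integrable q μ := Integrable.of_bound hq 1 (Eventually.of_forall fun x => (hb x).2)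
  set s : α → ℝ := fun x => √(1 - (p x ^ 2 + q x ^ 2)) with hs
  have hsm : AEStronglyMeasurable s μ := by
    have : Continuous fun z : ℝ × ℝ => √(1 - (z.1 ^ 2 + z.2 ^ 2)) := by fun_prop
    exact this.comp_aestronglyMeasurable (hp.prodMk hq)
  have hsb : ∀ x, ‖s x‖ ≤ 1 := fun x => by
    rw [Real.norm_of_nonneg (Real.sqrt_nonneg _), Real.sqrt_le_one]
    nlinarith [sq_nonneg (p x), sq_nonneg (q x)]
  have hsi : Integrable s μ := Integrable.of_bound hsm 1 (Eventually.of_forall hsb)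
  -- The triple (p, q, √(1 - p² - q²)) lies on the unit sphere of ℝ³, so its mean lies in the unit
  -- ball; the third coordinate of that mean gives the inequality.
  set F : α → EuclideanSpace ℝ (Fin 3) := fun x => !₂[p x, q x, s x] with hF
  have hFn : ∀ x, ‖F x‖ = 1 := by
    intro x
    rw [EuclideanSpace.norm_eq, Fin.sum_univ_three]
    have : s x ^ 2 = 1 - (p x ^ 2 + q x ^ 2) := Real.sq_sqrt (by linarith [h x])
    simp [hF, this]
  have hFi : Integrable F μ := by
    have hc : ∀ i, Integrable (fun x => F x i) μ := by
      intro i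
      fin_cases i
      · exact hpi
      · exact hqi
      · exact hsi
    exact Integrable.of_eval_piLp hc
  have hcoord : ∀ i, (∫ x, F x ∂μ) i = ∫ x, F x i ∂μ := fun i =>
    ((EuclideanSpace.proj i : EuclideanSpace ℝ (Fin 3) →L[ℝ] ℝ).integral_comp_comm hFi).symm
  have hn : ‖∫ x, F x ∂μ‖ ≤ 1 := by
    refine (norm_integral_le_integral_norm _).trans ?_
    simp [hFn]
  rw [EuclideanSpace.norm_eq, Fin.sum_univ_three, Real.sqrt_le_one, hcoord, hcoord, hcoord] at hn
  simp only [Real.norm_eq_abs, sq_abs] at hn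
  have e0 : ∫ x, F x 0 ∂μ = ∫ x, p x ∂μ := rfl
  have e1 : ∫ x, F x 1 ∂μ = ∫ x, q x ∂μ := rfl
  have e2 : ∫ x, F x 2 ∂μ = ∫ x, s x ∂μ := rfl
  rw [e0, e1, e2] at hn
  have h1 : ∫ x, s x ∂μ ≤ √(1 - ((∫ x, p x ∂μ) ^ 2 + (∫ x, q x ∂μ) ^ 2)) :=
    Real.le_sqrt_of_sq_le (by linarith)
  have h2 : ∫ x, gap (p x) (q x) ∂μ = 1 - ∫ x, s x ∂μ := by
    simp only [gap]
    rw [integral_sub (integrable_const _) hsi]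
    simp [hs]
  rw [h2, gap]
  linarith

end Gap

section Moll

variable (ρ : ContDiffBump (0 : Plane))

theorem abs_moll_le {h : Plane → ℝ} {M : ℝ} (hM : ∀ x, |h x| ≤ M) (x : Plane) :
    |moll ρ h x| ≤ M := by
  rw [moll_eq_integral, ← Real.norm_eq_abs]
  refine (norm_integral_le_of_norm_le_const (Eventually.of_forall fun y => hM y)).trans_eq ?_
  simp

/-- For the mean (P, R) one has P² + R² = mean of (P e₀ + R e₁), which is at most √(P² + R²) by the
Cauchy–Schwarz inequality. -/
theorem sq_moll_add_sq_moll_le {e₀ e₁ : Plane → ℝ} (h₀ : Integrable e₀) (h₁ : Integrable e₁)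
    (h : ∀ x, e₀ x ^ 2 + e₁ x ^ 2 ≤ 1) (x : Plane) :
    moll ρ e₀ x ^ 2 + moll ρ e₁ x ^ 2 ≤ 1 := by
  have i0 := integrable_mollMeasure ρ h₀.locallyIntegrable x
  have i1 := integrable_mollMeasure ρ h₁.locallyIntegrable x
  rw [moll_eq_integral, moll_eq_integral]
  set P := ∫ y, e₀ y ∂(mollMeasure ρ x) with hP
  set R := ∫ y, e₁ y ∂(mollMeasure ρ x) with hR
  have h1 : P ^ 2 + R ^ 2 ≤ √(P ^ 2 + R ^ 2) := by
    have h2 : P ^ 2 + R ^ 2 = ∫ y, (P * e₀ y + R * e₁ y) ∂(mollMeasure ρ x) := by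
      rw [integral_add (i0.const_mul P) (i1.const_mul R), integral_const_mul, integral_const_mul]
      ring
    have h3 : ∀ y, P * e₀ y + R * e₁ y ≤ √(P ^ 2 + R ^ 2) := fun y => by
      refine Real.le_sqrt_of_sq_le ?_
      nlinarith [sq_nonneg (P * e₁ y - R * e₀ y), h y, sq_nonneg P, sq_nonneg R,
        mul_nonneg (add_nonneg (sq_nonneg P) (sq_nonneg R)) (sub_nonneg.2 (h y))]
    calc P ^ 2 + R ^ 2 = ∫ y, (P * e₀ y + R * e₁ y) ∂(mollMeasure ρ x) := h2
      _ ≤ ∫ _, √(P ^ 2 + R ^ 2) ∂(mollMeasure ρ x) :=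
          integral_mono ((i0.const_mul P).add (i1.const_mul R)) (integrable_const _) h3
      _ = √(P ^ 2 + R ^ 2) := by simp
  by_contra! hlt
  have h4 : √(P ^ 2 + R ^ 2) < P ^ 2 + R ^ 2 := by
    rw [Real.sqrt_lt' (by linarith)]
    nlinarith
  linarith

theorem integrable_gap {e₀ e₁ : Plane → ℝ} (h₀ : Integrable e₀) (h₁ : Integrable e₁)
    (h : ∀ x, e₀ x ^ 2 + e₁ x ^ 2 ≤ 1) : Integrable fun x => gap (e₀ x) (e₁ x) := by
  have hm := continuous_gap.comp_aestronglyMeasurable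
    (h₀.aestronglyMeasurable.prodMk h₁.aestronglyMeasurable)
  refine Integrable.mono (g := fun x => |e₀ x| + |e₁ x|) (h₀.abs.add h₁.abs) hm
    (Eventually.of_forall fun x => ?_)
  rw [Real.norm_of_nonneg (gap_nonneg _ _)]
  exact (gap_le_abs (h x)).trans (le_abs_self _)

theorem integral_moll {h : Plane → ℝ} (hh : Integrable h) : ∫ x, moll ρ h x = ∫ x, h x := by
  have h1 := integral_convolution (𝕜 := ℝ) (μ := volume) (ν := volume)
    (ContinuousLinearMap.lsmul ℝ ℝ) (ρ.integrable_normed (μ := volume)) hh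
  rw [ρ.integral_normed] at h1
  rw [moll_eq_convolution, h1, ContinuousLinearMap.lsmul_apply, one_smul]

/-- Jensen's inequality pointwise, and then mollification preserves the integral. -/
theorem integral_gap_moll_le {e₀ e₁ : Plane → ℝ} (h₀ : Integrable e₀) (h₁ : Integrable e₁)
    (h : ∀ x, e₀ x ^ 2 + e₁ x ^ 2 ≤ 1) :
    ∫ x, gap (moll ρ e₀ x) (moll ρ e₁ x) ≤ ∫ x, gap (e₀ x) (e₁ x) := by
  have hg := integrable_gap h₀ h₁ h
  rw [← integral_moll ρ hg]
  refine integral_mono (integrable_gap (integrable_moll ρ h₀) (integrable_moll ρ h₁)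
    (sq_moll_add_sq_moll_le ρ h₀ h₁ h)) (integrable_moll ρ hg) fun x => ?_
  simp only [moll_eq_integral]
  exact gap_integral_le (integrable_mollMeasure ρ h₀.locallyIntegrable x).aestronglyMeasurable
    (integrable_mollMeasure ρ h₁.locallyIntegrable x).aestronglyMeasurable h

end Moll

/-! ### Transposing mollification, dilation and cutoff onto the dual field. -/

section Component

/-- The contribution of one component of the dual field `η` of the gradient of `u₀ + φ`, where
`φ` arises from `β v` by mollification and dilation. -/
theorem integral_mul_pderiv_le {Ω : Set Plane} (hΩf : volume Ω ≠ ⊤)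
    {u₀ : Plane → ℝ} {L : ℝ≥0} (hu₀ : LipschitzWith L u₀) {v β : Plane → ℝ} (hv : Integrable v)
    (hβ : ContDiff ℝ ((⊤ : ℕ∞) : WithTop ℕ∞) β) (hβ0 : ∀ x, 0 ≤ β x) (hβ1 : ∀ x, β x ≤ 1)
    {i : Fin 2} (hvβ : Integrable fun x => v x * pderiv i β x) (ρ : ContDiffBump (0 : Plane))
    {c l m : ℝ} (hl : 1 ≤ l) (hm0 : 0 ≤ m) (hm1 : m ≤ 1) {φ : Plane → ℝ} (hφi : Integrable (pderiv i φ))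
    (hφ : ∀ x, pderiv i φ x = l * m * pderiv i (moll ρ fun y => β y * v y) (dil c l x))
    {η : Plane → ℝ} (hηm : Measurable η) (hη1 : ∀ x, |η x| ≤ 1) (hη0 : ∀ x, x ∉ Ω → η x = 0)
    (hζ : IsTest univ fun x => β x * moll ρ (fun y => m * η (dil c l⁻¹ y)) x)
    {B : Set Plane} (hBm : MeasurableSet B) (hBf : volume B ≠ ⊤)
    (hB : ∀ x, x ∉ B → β x * moll ρ (fun y => m * η (dil c l⁻¹ y)) x = 0) :
    ∫ x in Ω, η x * (pderiv i u₀ x + pderiv i φ x)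
      ≤ -(∫ x, (u₀ x + v x) *
          pderiv i (fun x => β x * moll ρ (fun y => m * η (dil c l⁻¹ y)) x) x)
        + (∫ x, |v x * pderiv i β x|)
        + ∫ x in Ω, |pderiv i u₀ x
          - l * m * moll ρ (B.indicator fun y => β y * pderiv i u₀ y) (dil c l x)| := by
  have hl0 : 0 < l := by linarith
  have hηi : Integrable η := by
    have : IntegrableOn η Ω := Measure.integrableOn_of_bounded (M := 1) hΩf
      hηm.aestronglyMeasurable (Eventually.of_forall fun x => hη1 x)
    refine (integrableOn_iff_integrable_of_support_subset fun x hx => ?_).1 this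
    by_contra h
    exact hx (hη0 x h)
  -- The pulled-back field; the factor m absorbs the discrepancy between the chain rule and the
  -- Jacobian of the dilation.
  set η' : Plane → ℝ := fun y => m * η (dil c l⁻¹ y) with hη'
  have hη'i : Integrable η' := (integrable_comp_dil c (inv_pos.2 hl0) hηi).const_mul m
  have hη'1 : ∀ x, |η' x| ≤ 1 := fun x => by
    rw [hη', abs_mul, abs_of_nonneg hm0]
    exact mul_le_one₀ hm1 (abs_nonneg _) (hη1 _)
  set ψ := moll ρ η' with hψ
  have hψ1 : ∀ x, |ψ x| ≤ 1 := abs_moll_le ρ hη'1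
  have hψs := contDiff_moll ρ hη'i.locallyIntegrable
  set V : Plane → ℝ := fun y => β y * v y with hV
  have hβabs : ∀ x, ‖β x‖ ≤ 1 := fun x => by rw [Real.norm_of_nonneg (hβ0 x)]; exact hβ1 x
  have hVi : Integrable V := hv.bdd_mul hβ.continuous.aestronglyMeasurable
    (Eventually.of_forall hβabs)
  -- Restricting to B makes β ∂_i u₀ integrable and costs nothing, because the test function
  -- vanishes off B.
  set h : Plane → ℝ := B.indicator fun y => β y * pderiv i u₀ y with hh
  have hhi : Integrable h := by
    rw [hh, integrable_indicator_iff hBm]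
    refine Measure.integrableOn_of_bounded (M := L) hBf
      (hβ.continuous.measurable.mul (measurable_pderiv u₀ i)).aestronglyMeasurable
      (Eventually.of_forall fun x => ?_)
    rw [norm_mul]
    refine (mul_le_mul (hβabs x) (norm_pderiv_le hu₀ i x) (norm_nonneg _) zero_le_one).trans_eq
      (one_mul _)
  have hdil : ∀ F : Plane → ℝ, m * l * ∫ x, F (dil c l x) * η x = ∫ x, F x * η' x := by
    intro F
    have e := integral_comp_dil c hl0 fun y => F y * η (dil c l⁻¹ y)
    simp only [dil_inv_dil c hl0.ne'] at e
    have e2 : ∫ x, F x * η' x = m * ∫ x, F x * η (dil c l⁻¹ x) := by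
      rw [← integral_const_mul]
      congr 1; ext x; rw [hη']; ring
    rw [e, e2]
    field_simp
  -- the part with `v`
  have a1 : ∫ x, η x * pderiv i φ x = -∫ x, V x * pderiv i ψ x := by
    rw [← integral_pderiv_moll_mul ρ hVi hη'i i, ← hdil, ← integral_const_mul]
    congr 1; ext x; rw [hφ x]; ring
  have hζd : ∀ x, pderiv i (fun x => β x * ψ x) x = β x * pderiv i ψ x + pderiv i β x * ψ x :=
    fun x => pderiv_mul (hβ.differentiable (by simp) x) (hψs.differentiable (by simp) x) i
  have j1 : Integrable fun x => v x * pderiv i (fun x => β x * ψ x) x :=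
    integrable_mul_hasCompactSupport hv (continuous_pderiv hζ.smooth i)
      (hasCompactSupport_pderiv hζ.hasCompactSupport i)
  have j2 : Integrable fun x => v x * pderiv i β x * ψ x :=
    hvβ.mul_bdd (c := 1) hψs.continuous.aestronglyMeasurable (Eventually.of_forall hψ1)
  have a2 : -∫ x, V x * pderiv i ψ x
      -- Moving β inside the derivative leaves the commutator v ∂_i β ψ, which is small by the
      -- choice of β.
      = -(∫ x, v x * pderiv i (fun x => β x * ψ x) x) + ∫ x, v x * pderiv i β x * ψ x := by
    have : ∫ x, V x * pderiv i ψ x = (∫ x, v x * pderiv i (fun x => β x * ψ x) x)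
        - ∫ x, v x * pderiv i β x * ψ x := by
      rw [← integral_sub j1 j2]
      congr 1; ext x; rw [hζd]; ring
    rw [this]; ring
  have a3 : ∫ x, v x * pderiv i β x * ψ x ≤ ∫ x, |v x * pderiv i β x| := by
    refine integral_mono j2 hvβ.abs fun x => (le_abs_self _).trans ?_
    rw [abs_mul]
    exact mul_le_of_le_one_right (abs_nonneg _) (hψ1 x)
  -- the part with `u₀`
  have b1 : -∫ x, u₀ x * pderiv i (fun x => β x * ψ x) x
      = m * l * ∫ x, moll ρ h (dil c l x) * η x := by
    rw [integral_mul_pderiv hu₀ i hζ, neg_neg, hdil, integral_moll_mul ρ hhi hη'i]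
    congr 1; ext x
    by_cases hx : x ∈ B
    · rw [hh, indicator_of_mem hx]; ring
    · rw [hB x hx, hh, indicator_of_notMem hx]; ring
  have hTi : Integrable fun x => moll ρ h (dil c l x) :=
    integrable_comp_dil c hl0 (integrable_moll ρ hhi)
  have k1 : Integrable fun x => η x * pderiv i u₀ x :=
    hηi.mul_bdd (measurable_pderiv u₀ i).aestronglyMeasurable
      (Eventually.of_forall fun x => norm_pderiv_le hu₀ i x)
  have k2 : Integrable fun x => η x * pderiv i φ x :=
    hφi.bdd_mul (c := 1) hηm.aestronglyMeasurable (Eventually.of_forall hη1)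
  have k3 : Integrable fun x => moll ρ h (dil c l x) * η x :=
    hTi.mul_bdd (c := 1) hηm.aestronglyMeasurable (Eventually.of_forall hη1)
  have hset : ∀ F : Plane → ℝ, ∫ x in Ω, η x * F x = ∫ x, η x * F x := fun F =>
    setIntegral_eq_integral_of_forall_compl_eq_zero fun x hx => by rw [hη0 x hx, zero_mul]
  have hDi : IntegrableOn (fun x => pderiv i u₀ x - l * m * moll ρ h (dil c l x)) Ω := by
    refine Integrable.sub ?_ ((hTi.const_mul (l * m)).integrableOn)
    exact Measure.integrableOn_of_bounded (M := L) hΩf (measurable_pderiv u₀ i).aestronglyMeasurable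
      (Eventually.of_forall fun x => norm_pderiv_le hu₀ i x)
  have b2 : (∫ x, η x * pderiv i u₀ x) - m * l * ∫ x, moll ρ h (dil c l x) * η x
      ≤ ∫ x in Ω, |pderiv i u₀ x - l * m * moll ρ h (dil c l x)| := by
    have e : (∫ x, η x * pderiv i u₀ x) - m * l * ∫ x, moll ρ h (dil c l x) * η x
        = ∫ x in Ω, η x * (pderiv i u₀ x - l * m * moll ρ h (dil c l x)) := by
      rw [hset, ← integral_const_mul, ← integral_sub k1 (k3.const_mul _)]
      congr 1; ext x; ring
    rw [e]
    refine integral_mono (hDi.bdd_mul (c := 1) hηm.aestronglyMeasurable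
      (Eventually.of_forall hη1)) hDi.abs fun x => (le_abs_self _).trans ?_
    rw [abs_mul]
    exact mul_le_of_le_one_left (abs_nonneg _) (hη1 x)
  have j3 : Integrable fun x => u₀ x * pderiv i (fun x => β x * ψ x) x :=
    ((hu₀.continuous.mul (continuous_pderiv hζ.smooth i)).integrable_of_hasCompactSupport
      (hasCompactSupport_pderiv hζ.hasCompactSupport i).mul_left)
  have c1 : ∫ x, (u₀ x + v x) * pderiv i (fun x => β x * ψ x) x
      = (∫ x, u₀ x * pderiv i (fun x => β x * ψ x) x)
        + ∫ x, v x * pderiv i (fun x => β x * ψ x) x := by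
    rw [← integral_add j3 j1]
    congr 1; ext x; ring
  have c2 : ∫ x in Ω, η x * (pderiv i u₀ x + pderiv i φ x)
      = (∫ x, η x * pderiv i u₀ x) + ∫ x, η x * pderiv i φ x := by
    rw [hset, ← integral_add k1 k2]
    congr 1; ext x; ring
  rw [c1, c2]
  linarith

end Component

/-! ### Pointwise duality for √(1 + |ξ|²). -/

section Dual

/-- The dual representation of the area integrand. -/
theorem sqrt_eq_dual (p q : ℝ) :
    √(1 + (p ^ 2 + q ^ 2)) = p / √(1 + (p ^ 2 + q ^ 2)) * p + q / √(1 + (p ^ 2 + q ^ 2)) * q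
      + (1 - gap (p / √(1 + (p ^ 2 + q ^ 2))) (q / √(1 + (p ^ 2 + q ^ 2)))) := by
  have h0 : 0 < 1 + (p ^ 2 + q ^ 2) := by positivity
  set S := √(1 + (p ^ 2 + q ^ 2)) with hS
  have hS0 : 0 < S := Real.sqrt_pos.2 h0
  have hS2 : S ^ 2 = 1 + (p ^ 2 + q ^ 2) := Real.sq_sqrt h0.le
  have h1 : 1 - ((p / S) ^ 2 + (q / S) ^ 2) = (1 / S) ^ 2 := by
    field_simp
    linarith
  rw [gap, h1, Real.sqrt_sq (by positivity)]
  field_simp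
  linarith

theorem sq_add_sq_dual_le (p q : ℝ) :
    (p / √(1 + (p ^ 2 + q ^ 2))) ^ 2 + (q / √(1 + (p ^ 2 + q ^ 2))) ^ 2 ≤ 1 := by
  have h0 : 0 < 1 + (p ^ 2 + q ^ 2) := by positivity
  rw [div_pow, div_pow, Real.sq_sqrt h0.le, ← add_div, div_le_one h0]
  linarith

theorem abs_le_one_of_sq_add_sq {p q : ℝ} (h : p ^ 2 + q ^ 2 ≤ 1) : |p| ≤ 1 ∧ |q| ≤ 1 :=
  ⟨by rw [← sq_le_one_iff_abs_le_one]; nlinarith [sq_nonneg q],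
    by rw [← sq_le_one_iff_abs_le_one]; nlinarith [sq_nonneg p]⟩

theorem sqrt_le_one_add_abs (p q : ℝ) : √(1 + (p ^ 2 + q ^ 2)) ≤ 1 + |p| + |q| := by
  refine Real.sqrt_le_iff.2 ⟨by positivity, ?_⟩
  rw [← sq_abs p, ← sq_abs q]
  nlinarith [abs_nonneg p, abs_nonneg q, mul_nonneg (abs_nonneg p) (abs_nonneg q)]

end Dual

section SetIntegral

variable {s : Set Plane} {F G H : Plane → ℝ}

theorem integrableOn_one_sub (hs : volume s ≠ ⊤) (hF : IntegrableOn F s) :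
    IntegrableOn (fun x => 1 - F x) s := by
  have h1 : IntegrableOn (fun _ : Plane => (1 : ℝ)) s := integrableOn_const hs
  exact Integrable.sub h1 hF

theorem setIntegral_one_sub (hs : volume s ≠ ⊤) (hF : IntegrableOn F s) :
    ∫ x in s, (1 - F x) = volume.real s - ∫ x in s, F x := by
  have h1 : IntegrableOn (fun _ : Plane => (1 : ℝ)) s := integrableOn_const hs
  rw [integral_sub h1 hF]
  simp

theorem setIntegral_add_add (hF : IntegrableOn F s) (hG : IntegrableOn G s)
    (hH : IntegrableOn H s) :
    ∫ x in s, (F x + G x + H x) = (∫ x in s, F x) + (∫ x in s, G x) + ∫ x in s, H x := by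
  have h1 : IntegrableOn (fun x => F x + G x) s := Integrable.add hF hG
  rw [integral_add h1 hH, integral_add hF hG]

end SetIntegral

/-! ### Upper bound for the area integral over Ω. -/

section Interior

variable {a b : ℝ} {κ₁ κ₂ : ℝ → ℝ} {δ : ℝ} {β : Plane → ℝ}

/-- The cutoff limits the support vertically; horizontally it is limited by the 2r of e and the
radius r of the kernel. -/
theorem isTest_mul_moll (h₁ : Continuous κ₁) (h₂ : Continuous κ₂)
    (hβ : ContDiff ℝ ((⊤ : ℕ∞) : WithTop ℕ∞) β)
    (hβs : ∀ x, β x ≠ 0 → κ₁ (x 0) + δ ≤ x 1 ∧ x 1 ≤ κ₂ (x 0) - δ)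
    (ρ : ContDiffBump (0 : Plane)) {r : ℝ} (hr : ρ.rOut = r) {e : Plane → ℝ} (he : Integrable e)
    (hes : ∀ y, e y ≠ 0 → a - 2 * r ≤ y 0 ∧ y 0 ≤ b + 2 * r) :
    IsTest {x : Plane | x 0 ∈ Icc (a - 3 * r) (b + 3 * r) ∧ κ₁ (x 0) + δ ≤ x 1 ∧
      x 1 ≤ κ₂ (x 0) - δ} (fun x => β x * moll ρ e x) := by
  have hK := isCompact_core h₁ h₂ (a - 3 * r) (b + 3 * r) δ
  have hsub : tsupport (fun x => β x * moll ρ e x) ⊆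
      {x : Plane | x 0 ∈ Icc (a - 3 * r) (b + 3 * r) ∧ κ₁ (x 0) + δ ≤ x 1 ∧
        x 1 ≤ κ₂ (x 0) - δ} := by
    refine closure_minimal (fun x hx => ?_) hK.isClosed
    have hx1 : β x ≠ 0 := left_ne_zero_of_mul hx
    have hx2 : moll ρ e x ≠ 0 := right_ne_zero_of_mul hx
    refine ⟨?_, hβs x hx1⟩
    by_contra hx0
    refine hx2 (moll_eq_zero ρ (S := {y | e y ≠ 0}) (fun y hy => by simpa using hy) fun y hy => ?_)
    by_contra! hlt
    have d0 := abs_le.1 ((abs_coord_sub_le_dist x y 0).trans (hr ▸ hlt.le))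
    have := hes y hy
    exact hx0 ⟨by linarith, by linarith⟩
  exact ⟨hβ.mul (contDiff_moll ρ he.locallyIntegrable),
    HasCompactSupport.of_support_subset_isCompact hK (subset_closure.trans hsub), hsub⟩

/-- The area integral is written with its pointwise optimal dual field η. Each component is
transposed by `integral_mul_pderiv_le`, and by convexity the gap integral grows by no more than the
Jacobian of the dilation allows. -/
theorem interior_area_le {Ω : Set Plane} (hab : a < b) (h₁ : Continuous κ₁) (h₂ : Continuous κ₂)
    (hΩ : Ω = between (Ioo a b) κ₁ κ₂) {u₀ : Plane → ℝ} {L : ℝ≥0} (hu₀ : LipschitzWith L u₀)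
    {v : Plane → ℝ} (hv : Integrable v)
    (hβ : ContDiff ℝ ((⊤ : ℕ∞) : WithTop ℕ∞) β) (hβ0 : ∀ x, 0 ≤ β x) (hβ1 : ∀ x, β x ≤ 1)
    (hβs : ∀ x, β x ≠ 0 → κ₁ (x 0) + δ ≤ x 1 ∧ x 1 ≤ κ₂ (x 0) - δ)
    (hvβ : ∀ i, Integrable fun x => v x * pderiv i β x) (ρ : ContDiffBump (0 : Plane)) {r : ℝ}
    (hr : ρ.rOut = r) {c l : ℝ} (hc : c = (a + b) / 2) (hl : l = 1 + 4 * r / (b - a))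
    (hφ : IsTest Ω fun x => moll ρ (fun y => β y * v y) (dil c l x))
    {B : Set Plane} (hBm : MeasurableSet B) (hBf : volume B ≠ ⊤)
    (hB : {x : Plane | x 0 ∈ Icc (a - 3 * r) (b + 3 * r) ∧ κ₁ (x 0) + δ ≤ x 1 ∧
        x 1 ≤ κ₂ (x 0) - δ} ⊆ B) :
    ∃ ζ₀ ζ₁ : Plane → ℝ,
      IsTest {x : Plane | x 0 ∈ Icc (a - 3 * r) (b + 3 * r) ∧ κ₁ (x 0) + δ ≤ x 1 ∧
        x 1 ≤ κ₂ (x 0) - δ} ζ₀ ∧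
      IsTest {x : Plane | x 0 ∈ Icc (a - 3 * r) (b + 3 * r) ∧ κ₁ (x 0) + δ ≤ x 1 ∧
        x 1 ≤ κ₂ (x 0) - δ} ζ₁ ∧ (∀ x, ζ₀ x ^ 2 + ζ₁ x ^ 2 ≤ 1) ∧
      ∫ x in Ω, √(1 +
        ((pderiv 0 u₀ x + pderiv 0 (fun x => moll ρ (fun y => β y * v y) (dil c l x)) x) ^ 2
        + (pderiv 1 u₀ x + pderiv 1 (fun x => moll ρ (fun y => β y * v y) (dil c l x)) x) ^ 2))
      ≤ volume.real Ω - (∫ x, (u₀ x + v x) * pderiv 0 ζ₀ x) - (∫ x, (u₀ x + v x) * pderiv 1 ζ₁ x)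
        - (∫ x, gap (ζ₀ x) (ζ₁ x)) + (l - 1) * volume.real Ω
        + (∫ x, |v x * pderiv 0 β x|) + (∫ x, |v x * pderiv 1 β x|)
        + (∫ x in Ω, |pderiv 0 u₀ x
            - l * moll ρ (B.indicator fun y => β y * pderiv 0 u₀ y) (dil c l x)|)
        + ∫ x in Ω, |pderiv 1 u₀ x
            - moll ρ (B.indicator fun y => β y * pderiv 1 u₀ y) (dil c l x)| := by
  have hΩm : MeasurableSet Ω := by rw [hΩ]; exact (isOpen_between h₁ h₂ isOpen_Ioo).measurableSet
  have hΩf : volume Ω ≠ ⊤ := by rw [hΩ]; exact (volume_between_lt_top h₁ h₂).ne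
  have hr0 : 0 < r := hr ▸ ρ.rOut_pos
  have hba : 0 < b - a := by linarith
  have hl1 : 1 ≤ l := by
    have : 0 < 4 * r / (b - a) := div_pos (by linarith) hba
    linarith
  have hl0 : 0 < l := by linarith
  have hlr : l * (b - a) = b - a + 4 * r := by rw [hl]; field_simp
  set φ : Plane → ℝ := fun x => moll ρ (fun y => β y * v y) (dil c l x) with hφdef
  have hφi : ∀ i, Integrable (pderiv i φ) := fun i =>
    (continuous_pderiv hφ.smooth i).integrable_of_hasCompactSupport
      (hasCompactSupport_pderiv hφ.hasCompactSupport i)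
  have hVi : Integrable fun y => β y * v y :=
    hv.bdd_mul (c := 1) hβ.continuous.aestronglyMeasurable
      (Eventually.of_forall fun x => by rw [Real.norm_of_nonneg (hβ0 x)]; exact hβ1 x)
  have hVd : Differentiable ℝ (moll ρ fun y => β y * v y) :=
    (contDiff_moll ρ hVi.locallyIntegrable).differentiable (by simp)
  set p : Plane → ℝ := fun x => pderiv 0 u₀ x + pderiv 0 φ x with hp
  set q : Plane → ℝ := fun x => pderiv 1 u₀ x + pderiv 1 φ x with hq
  have hpm : Measurable p := (measurable_pderiv _ _).add (measurable_pderiv _ _)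
  have hqm : Measurable q := (measurable_pderiv _ _).add (measurable_pderiv _ _)
  set S : Plane → ℝ := fun x => √(1 + (p x ^ 2 + q x ^ 2)) with hS
  have hSm : Measurable S :=
    Real.continuous_sqrt.measurable.comp (((hpm.pow_const 2).add (hqm.pow_const 2)).const_add 1)
  -- The field ξ / √(1 + |ξ|²), with ξ = ∇(u₀ + φ), attains the dual representation of the
  -- integrand.
  set η₀ : Plane → ℝ := Ω.indicator fun x => p x / S x with hη₀
  set η₁ : Plane → ℝ := Ω.indicator fun x => q x / S x with hη₁
  have hη₀m : Measurable η₀ := (hpm.div hSm).indicator hΩm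
  have hη₁m : Measurable η₁ := (hqm.div hSm).indicator hΩm
  have hη00 : ∀ x, x ∉ Ω → η₀ x = 0 := fun x hx => indicator_of_notMem hx _
  have hη10 : ∀ x, x ∉ Ω → η₁ x = 0 := fun x hx => indicator_of_notMem hx _
  have hηsq : ∀ x, η₀ x ^ 2 + η₁ x ^ 2 ≤ 1 := by
    intro x
    by_cases hx : x ∈ Ω
    · rw [hη₀, hη₁, indicator_of_mem hx, indicator_of_mem hx]
      exact sq_add_sq_dual_le _ _
    · rw [hη00 x hx, hη10 x hx]; norm_num
  have hηb := fun x => abs_le_one_of_sq_add_sq (hηsq x)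
  have hint : ∀ {η : Plane → ℝ}, Measurable η → (∀ x, |η x| ≤ 1) → (∀ x, x ∉ Ω → η x = 0) →
      Integrable η := by
    intro η hm hb h0
    have : IntegrableOn η Ω := Measure.integrableOn_of_bounded (M := 1) hΩf
      hm.aestronglyMeasurable (Eventually.of_forall fun x => hb x)
    refine (integrableOn_iff_integrable_of_support_subset fun x hx => ?_).1 this
    by_contra h
    exact hx (h0 x h)
  have hη₀i := hint hη₀m (fun x => (hηb x).1) hη00
  have hη₁i := hint hη₁m (fun x => (hηb x).2) hη10
  have hli0 : 0 < l⁻¹ := inv_pos.2 hl0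
  have hli1 : l⁻¹ ≤ 1 := inv_le_one_of_one_le₀ hl1
  -- In the direction x_1 the factor l of the chain rule cancels the Jacobian; in the direction x_2
  -- the Jacobian l⁻¹ remains. Both factors are at most 1, so the field stays in the unit disc.
  set e₀ : Plane → ℝ := fun y => 1 * η₀ (dil c l⁻¹ y) with he₀
  set e₁ : Plane → ℝ := fun y => l⁻¹ * η₁ (dil c l⁻¹ y) with he₁
  have he₀i : Integrable e₀ := (integrable_comp_dil c hli0 hη₀i).const_mul 1
  have he₁i : Integrable e₁ := (integrable_comp_dil c hli0 hη₁i).const_mul l⁻¹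
  -- The dilation has l (b - a) = b - a + 4r, so the image of (a, b) exceeds it by 2r on each side.
  have hdom : ∀ y, dil c l⁻¹ y ∈ Ω → a - 2 * r ≤ y 0 ∧ y 0 ≤ b + 2 * r := by
    intro y hy
    rw [hΩ] at hy
    have h0 : dil c l⁻¹ y 0 ∈ Ioo a b := hy.1
    set z := dil c l⁻¹ y 0 with hz
    have hy0 : y 0 = c + l * (z - c) := by
      have : dil c l (dil c l⁻¹ y) 0 = y 0 := by rw [dil_dil_inv c hl0.ne']
      rw [← this]; rfl
    rw [hy0]
    have u1 : l * (z - c) ≤ l * ((b - a) / 2) :=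
      mul_le_mul_of_nonneg_left (by rw [hc]; linarith [h0.2]) hl0.le
    have u2 : l * (-((b - a) / 2)) ≤ l * (z - c) :=
      mul_le_mul_of_nonneg_left (by rw [hc]; linarith [h0.1]) hl0.le
    constructor
    · nlinarith
    · nlinarith
  have he₀s : ∀ y, e₀ y ≠ 0 → a - 2 * r ≤ y 0 ∧ y 0 ≤ b + 2 * r := fun y hy => hdom y (by
    by_contra h
    exact hy (by simp only [he₀]; rw [hη00 _ h, mul_zero]))
  have he₁s : ∀ y, e₁ y ≠ 0 → a - 2 * r ≤ y 0 ∧ y 0 ≤ b + 2 * r := fun y hy => hdom y (by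
    by_contra h
    exact hy (by simp only [he₁]; rw [hη10 _ h, mul_zero]))
  have hζ₀ := isTest_mul_moll h₁ h₂ hβ hβs ρ hr he₀i he₀s
  have hζ₁ := isTest_mul_moll h₁ h₂ hβ hβs ρ hr he₁i he₁s
  have hesq' : ∀ y, e₀ y ^ 2 + e₁ y ^ 2
      ≤ η₀ (dil c l⁻¹ y) ^ 2 + η₁ (dil c l⁻¹ y) ^ 2 := by
    intro y
    simp only [he₀, he₁, one_mul, mul_pow]
    have : l⁻¹ ^ 2 ≤ 1 := pow_le_one₀ hli0.le hli1
    nlinarith [sq_nonneg (η₁ (dil c l⁻¹ y))]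
  have hesq : ∀ y, e₀ y ^ 2 + e₁ y ^ 2 ≤ 1 := fun y => (hesq' y).trans (hηsq _)
  have hψsq := sq_moll_add_sq_moll_le ρ he₀i he₁i hesq
  have hζsq' : ∀ x, (β x * moll ρ e₀ x) ^ 2 + (β x * moll ρ e₁ x) ^ 2
      ≤ moll ρ e₀ x ^ 2 + moll ρ e₁ x ^ 2 := by
    intro x
    rw [mul_pow, mul_pow, ← mul_add]
    exact mul_le_of_le_one_left (by positivity) (pow_le_one₀ (hβ0 x) (hβ1 x))
  have huniv : ∀ {K : Set Plane} {ζ : Plane → ℝ}, IsTest K ζ → IsTest univ ζ := fun h =>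
    ⟨h.smooth, h.hasCompactSupport, subset_univ _⟩
  have hoff : ∀ {ζ : Plane → ℝ}, IsTest {x : Plane | x 0 ∈ Icc (a - 3 * r) (b + 3 * r) ∧
      κ₁ (x 0) + δ ≤ x 1 ∧ x 1 ≤ κ₂ (x 0) - δ} ζ → ∀ x, x ∉ B → ζ x = 0 := fun h x hx =>
    image_eq_zero_of_notMem_tsupport fun h' => hx (hB (h.tsupport_subset h'))
  refine ⟨_, _, hζ₀, hζ₁, fun x => (hζsq' x).trans (hψsq x), ?_⟩
  have c0 := integral_mul_pderiv_le hΩf hu₀ hv hβ hβ0 hβ1 (hvβ 0) ρ (c := c) (l := l) (m := 1)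
    hl1 zero_le_one le_rfl (hφi 0) (fun x => by
      rw [mul_one]; exact pderiv_zero_comp_dil hVd c l x) hη₀m (fun x => (hηb x).1) hη00
    (huniv hζ₀) hBm hBf (hoff hζ₀)
  have c1 := integral_mul_pderiv_le hΩf hu₀ hv hβ hβ0 hβ1 (hvβ 1) ρ (c := c) (l := l) (m := l⁻¹)
    hl1 hli0.le hli1 (hφi 1) (fun x => by
      rw [mul_inv_cancel₀ hl0.ne', one_mul]; exact pderiv_one_comp_dil hVd c l x) hη₁m
    (fun x => (hηb x).2) hη10 (huniv hζ₁) hBm hBf (hoff hζ₁)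
  simp only [mul_one] at c0
  simp only [mul_inv_cancel₀ hl0.ne', one_mul] at c1
  have hgi := integrable_gap hη₀i hη₁i hηsq
  have hg1 : ∫ x, gap (η₀ x) (η₁ x) ≤ volume.real Ω := by
    have e : ∫ x, gap (η₀ x) (η₁ x) = ∫ x in Ω, gap (η₀ x) (η₁ x) :=
      (setIntegral_eq_integral_of_forall_compl_eq_zero fun x hx => by
        rw [hη00 x hx, hη10 x hx, gap_zero]).symm
    rw [e]
    refine (setIntegral_mono hgi.integrableOn (integrableOn_const hΩf)
      fun x => gap_le_one _ _).trans_eq ?_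
    simp
  -- The dilation multiplies the gap integral by l, and gap ≤ 1 on Ω turns the excess into (l - 1)
  -- times the area of Ω.
  have hg2 : ∫ x, gap (β x * moll ρ e₀ x) (β x * moll ρ e₁ x)
      ≤ (∫ x, gap (η₀ x) (η₁ x)) + (l - 1) * volume.real Ω := by
    have i0 : Integrable fun x => β x * moll ρ e₀ x :=
      hζ₀.smooth.continuous.integrable_of_hasCompactSupport hζ₀.hasCompactSupport
    have i1 : Integrable fun x => β x * moll ρ e₁ x :=
      hζ₁.smooth.continuous.integrable_of_hasCompactSupport hζ₁.hasCompactSupport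
    have s1 : ∫ x, gap (β x * moll ρ e₀ x) (β x * moll ρ e₁ x)
        ≤ ∫ x, gap (moll ρ e₀ x) (moll ρ e₁ x) :=
      integral_mono (integrable_gap i0 i1 fun x => (hζsq' x).trans (hψsq x))
        (integrable_gap (integrable_moll ρ he₀i) (integrable_moll ρ he₁i) hψsq)
        fun x => gap_mono (hζsq' x)
    have s2 := integral_gap_moll_le ρ he₀i he₁i hesq
    have s3 : ∫ x, gap (e₀ x) (e₁ x) ≤ ∫ x, gap (η₀ (dil c l⁻¹ x)) (η₁ (dil c l⁻¹ x)) :=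
      integral_mono (integrable_gap he₀i he₁i hesq) (integrable_comp_dil c hli0 hgi)
        fun x => gap_mono (hesq' x)
    have s4 := integral_comp_dil c hli0 fun x => gap (η₀ x) (η₁ x)
    rw [inv_inv] at s4
    have s5 : (l - 1) * ∫ x, gap (η₀ x) (η₁ x) ≤ (l - 1) * volume.real Ω :=
      mul_le_mul_of_nonneg_left hg1 (by linarith)
    linarith
  obtain ⟨D, hD⟩ := lipschitz_of_isTest hφ
  have hpi : IntegrableOn p Ω := Measure.integrableOn_of_bounded (M := L + D) hΩf
    hpm.aestronglyMeasurable (Eventually.of_forall fun x =>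
      (norm_add_le _ _).trans (add_le_add (norm_pderiv_le hu₀ 0 x) (norm_pderiv_le hD 0 x)))
  have hqi : IntegrableOn q Ω := Measure.integrableOn_of_bounded (M := L + D) hΩf
    hqm.aestronglyMeasurable (Eventually.of_forall fun x =>
      (norm_add_le _ _).trans (add_le_add (norm_pderiv_le hu₀ 1 x) (norm_pderiv_le hD 1 x)))
  have i0 : IntegrableOn (fun x => η₀ x * p x) Ω := Integrable.bdd_mul (c := 1) hpi
    hη₀m.aestronglyMeasurable (Eventually.of_forall fun x => (hηb x).1)
  have i1 : IntegrableOn (fun x => η₁ x * q x) Ω := Integrable.bdd_mul (c := 1) hqi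
    hη₁m.aestronglyMeasurable (Eventually.of_forall fun x => (hηb x).2)
  have i2 : IntegrableOn (fun x => 1 - gap (η₀ x) (η₁ x)) Ω :=
    integrableOn_one_sub hΩf hgi.integrableOn
  have hmain : ∫ x in Ω, S x = (∫ x in Ω, η₀ x * p x) + (∫ x in Ω, η₁ x * q x)
      + (volume.real Ω - ∫ x, gap (η₀ x) (η₁ x)) := by
    have e : ∫ x in Ω, S x = ∫ x in Ω, (η₀ x * p x + η₁ x * q x + (1 - gap (η₀ x) (η₁ x))) := by
      refine setIntegral_congr_fun hΩm fun x hx => ?_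
      simp only [hη₀, hη₁, indicator_of_mem hx]
      exact sqrt_eq_dual _ _
    have e2 : ∫ x in Ω, (1 - gap (η₀ x) (η₁ x)) = volume.real Ω - ∫ x, gap (η₀ x) (η₁ x) := by
      rw [setIntegral_one_sub hΩf hgi.integrableOn,
        setIntegral_eq_integral_of_forall_compl_eq_zero (f := fun x => gap (η₀ x) (η₁ x))
        fun x hx => by rw [hη00 x hx, hη10 x hx, gap_zero]]
    rw [e, setIntegral_add_add i0 i1 i2, e2]
  have hfinal : ∫ x in Ω, √(1 + ((pderiv 0 u₀ x + pderiv 0 φ x) ^ 2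
      + (pderiv 1 u₀ x + pderiv 1 φ x) ^ 2)) = ∫ x in Ω, S x := rfl
  rw [hfinal, hmain]
  linarith

end Interior

/-! ### An almost optimal dual field for u₀ outside the domain. -/

section Exterior

/-- The optimal field is only measurable. It is truncated to a compact subset of E and mollified
there; as ∇u₀ is bounded, dominated convergence shows that little is lost. -/
theorem exists_exterior_field {E : Set Plane} (hE : IsOpen E) (hEf : volume E ≠ ⊤)
    {u₀ : Plane → ℝ} {L : ℝ≥0} (hu₀ : LipschitzWith L u₀) {ε : ℝ} (hε : 0 < ε) :
    ∃ ζ₀ ζ₁ : Plane → ℝ, IsTest E ζ₀ ∧ IsTest E ζ₁ ∧ (∀ x, ζ₀ x ^ 2 + ζ₁ x ^ 2 ≤ 1) ∧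
      ∫ x in E, √(1 + (pderiv 0 u₀ x ^ 2 + pderiv 1 u₀ x ^ 2))
        ≤ (∫ x, pderiv 0 u₀ x * ζ₀ x) + (∫ x, pderiv 1 u₀ x * ζ₁ x)
          + volume.real E - (∫ x, gap (ζ₀ x) (ζ₁ x)) + ε := by
  set p := pderiv 0 u₀ with hp
  set q := pderiv 1 u₀ with hq
  have hpm : Measurable p := measurable_pderiv _ _
  have hqm : Measurable q := measurable_pderiv _ _
  have hpL : ∀ x, ‖p x‖ ≤ L := norm_pderiv_le hu₀ 0
  have hqL : ∀ x, ‖q x‖ ≤ L := norm_pderiv_le hu₀ 1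
  set S : Plane → ℝ := fun x => √(1 + (p x ^ 2 + q x ^ 2)) with hS
  have hSm : Measurable S :=
    Real.continuous_sqrt.measurable.comp (((hpm.pow_const 2).add (hqm.pow_const 2)).const_add 1)
  have hSL : ∀ x, S x ≤ 1 + 2 * L := fun x => (sqrt_le_one_add_abs _ _).trans (by
    have := hpL x; have := hqL x; simp only [Real.norm_eq_abs] at *; linarith)
  have hS0 : ∀ x, 0 ≤ S x := fun x => Real.sqrt_nonneg _
  have hSi : IntegrableOn S E := Measure.integrableOn_of_bounded (M := 1 + 2 * L) hEf
    hSm.aestronglyMeasurable (Eventually.of_forall fun x => by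
      rw [Real.norm_of_nonneg (hS0 x)]; exact hSL x)
  have hM : (0 : ℝ) < 2 * L + 1 := by have := L.coe_nonneg; linarith
  -- Truncation replaces √(1 + |∇u₀|²) ≤ 2 L + 1 by 1 on E \ K, which costs at most ε / 2. The other
  -- half of ε is for the mollification.
  obtain ⟨K, hKE, hK, hKd⟩ := hE.measurableSet.exists_isCompact_sdiff_lt hEf
    (ε := ENNReal.ofReal (ε / (2 * (2 * L + 1)))) (by
      rw [Ne, ENNReal.ofReal_eq_zero, not_le]; positivity)
  have hKm := hK.measurableSet
  have hKf : volume K ≠ ⊤ := hK.measure_lt_top.ne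
  set e₀ : Plane → ℝ := K.indicator fun x => p x / S x with he₀
  set e₁ : Plane → ℝ := K.indicator fun x => q x / S x with he₁
  have he₀m : Measurable e₀ := (hpm.div hSm).indicator hKm
  have he₁m : Measurable e₁ := (hqm.div hSm).indicator hKm
  have he00 : ∀ x, x ∉ K → e₀ x = 0 := fun x hx => indicator_of_notMem hx _
  have he10 : ∀ x, x ∉ K → e₁ x = 0 := fun x hx => indicator_of_notMem hx _
  have hesq : ∀ x, e₀ x ^ 2 + e₁ x ^ 2 ≤ 1 := by
    intro x
    by_cases hx : x ∈ K
    · rw [he₀, he₁, indicator_of_mem hx, indicator_of_mem hx]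
      exact sq_add_sq_dual_le _ _
    · rw [he00 x hx, he10 x hx]; norm_num
  have heb := fun x => abs_le_one_of_sq_add_sq (hesq x)
  have hint : ∀ {η : Plane → ℝ}, Measurable η → (∀ x, |η x| ≤ 1) → (∀ x, x ∉ K → η x = 0) →
      Integrable η := by
    intro η hm hb h0
    have : IntegrableOn η K := Measure.integrableOn_of_bounded (M := 1) hKf
      hm.aestronglyMeasurable (Eventually.of_forall fun x => hb x)
    refine (integrableOn_iff_integrable_of_support_subset fun x hx => ?_).1 this
    by_contra h
    exact hx (h0 x h)
  have he₀i := hint he₀m (fun x => (heb x).1) he00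
  have he₁i := hint he₁m (fun x => (heb x).2) he10
  obtain ⟨t, ht, htE⟩ := hK.exists_cthickening_subset_open hE hKE
  set r : ℕ → ℝ := fun n => t / (n + 1) with hr
  have hr0 : ∀ n, 0 < r n := fun n => div_pos ht (by positivity)
  have hrt : ∀ n, r n ≤ t := fun n => div_le_self ht.le (by
    have : (0 : ℝ) ≤ n := n.cast_nonneg
    linarith)
  have hrlim : Tendsto r atTop (𝓝 0) := by
    have := (tendsto_one_div_add_atTop_nhds_zero_nat (𝕜 := ℝ)).const_mul t
    simpa [hr, div_eq_mul_inv] using this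
  set ρ : ℕ → ContDiffBump (0 : Plane) := fun n => bump (r n) (hr0 n) with hρ
  have hz0 : ∀ n, IsTest E (moll (ρ n) e₀) := fun n =>
    isTest_moll (ρ n) he₀i.locallyIntegrable he00 hK.isBounded
      ((Metric.cthickening_mono (hrt n) _).trans htE)
  have hz1 : ∀ n, IsTest E (moll (ρ n) e₁) := fun n =>
    isTest_moll (ρ n) he₁i.locallyIntegrable he10 hK.isBounded
      ((Metric.cthickening_mono (hrt n) _).trans htE)
  have hzsq : ∀ n x, moll (ρ n) e₀ x ^ 2 + moll (ρ n) e₁ x ^ 2 ≤ 1 := fun n =>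
    sq_moll_add_sq_moll_le (ρ n) he₀i he₁i hesq
  have hlim0 := ae_tendsto_moll he₀i.locallyIntegrable hr0 hrlim
  have hlim1 := ae_tendsto_moll he₁i.locallyIntegrable hr0 hrlim
  set F : ℝ → ℝ → Plane → ℝ := fun z y x => p x * z + q x * y + (1 - gap z y) with hF
  have hFc : ∀ x, Continuous fun z : ℝ × ℝ => F z.1 z.2 x := fun x => by
    have := continuous_gap
    simp only [hF]; fun_prop
  have hFb : ∀ z y x, z ^ 2 + y ^ 2 ≤ 1 → ‖F z y x‖ ≤ 2 * L + 1 := by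
    intro z y x h
    have hzy := abs_le_one_of_sq_add_sq h
    have b1 : |p x * z| ≤ L := by
      rw [abs_mul]; exact (mul_le_of_le_one_right (abs_nonneg _) hzy.1).trans (hpL x)
    have b2 : |q x * y| ≤ L := by
      rw [abs_mul]; exact (mul_le_of_le_one_right (abs_nonneg _) hzy.2).trans (hqL x)
    have b3 : |1 - gap z y| ≤ 1 := by
      rw [abs_le]; constructor <;> linarith [gap_nonneg z y, gap_le_one z y]
    calc |p x * z + q x * y + (1 - gap z y)| ≤ |p x * z| + |q x * y| + |1 - gap z y| :=
          abs_add_three _ _ _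
      _ ≤ 2 * L + 1 := by linarith
  have hFm : ∀ {z y : Plane → ℝ}, Measurable z → Measurable y →
      Measurable fun x => F (z x) (y x) x := fun hz hy =>
    ((hpm.mul hz).add (hqm.mul hy)).add
      (measurable_const.sub (continuous_gap.measurable.comp (hz.prodMk hy)))
  have hDCT : Tendsto (fun n => ∫ x in E, F (moll (ρ n) e₀ x) (moll (ρ n) e₁ x) x) atTop
      (𝓝 (∫ x in E, F (e₀ x) (e₁ x) x)) := by
    refine tendsto_integral_of_dominated_convergence (fun _ => 2 * L + 1) (fun n => ?_)
      (integrableOn_const hEf) (fun n => Eventually.of_forall fun x => hFb _ _ _ (hzsq n x)) ?_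
    · exact (hFm (hz0 n).smooth.continuous.measurable
        (hz1 n).smooth.continuous.measurable).aestronglyMeasurable
    · filter_upwards [ae_restrict_of_ae hlim0, ae_restrict_of_ae hlim1] with x h0 h1
      exact ((hFc x).tendsto (e₀ x, e₁ x)).comp (h0.prodMk_nhds h1)
  have hlow : (∫ x in E, S x) - ε / 2 ≤ ∫ x in E, F (e₀ x) (e₁ x) x := by
    have hge : ∀ x, S x - (2 * L + 1) * (E \ K).indicator (fun _ => (1 : ℝ)) x
        ≤ F (e₀ x) (e₁ x) x ∨ x ∉ E := by
      intro x
      by_cases hxE : x ∈ E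
      · left
        by_cases hx : x ∈ K
        · rw [indicator_of_notMem (fun h => h.2 hx), mul_zero, sub_zero]
          have e : F (e₀ x) (e₁ x) x = S x := by
            simp only [hF, he₀, he₁, indicator_of_mem hx]
            rw [mul_comm (p x), mul_comm (q x)]
            exact (sqrt_eq_dual _ _).symm
          rw [e]
        · rw [indicator_of_mem (show x ∈ E \ K from ⟨hxE, hx⟩), mul_one]
          have e : F (e₀ x) (e₁ x) x = 1 := by
            simp only [hF, he00 x hx, he10 x hx]; simp
          rw [e]
          linarith [hSL x]
      · exact Or.inr hxE
    have hindi : Integrable ((E \ K).indicator fun _ => (1 : ℝ)) :=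
      (integrable_indicator_iff (hE.measurableSet.diff hKm)).2
        (integrableOn_const (ne_top_of_le_ne_top hEf (measure_mono sdiff_subset)))
    have hFi : IntegrableOn (fun x => F (e₀ x) (e₁ x) x) E :=
      Measure.integrableOn_of_bounded (M := 2 * L + 1) hEf
        (hFm he₀m he₁m).aestronglyMeasurable
        (Eventually.of_forall fun x => hFb _ _ _ (hesq x))
    have h1 : ∫ x in E, (S x - (2 * L + 1) * (E \ K).indicator (fun _ => (1 : ℝ)) x)
        ≤ ∫ x in E, F (e₀ x) (e₁ x) x :=
      setIntegral_mono_on (hSi.sub (hindi.const_mul _).integrableOn) hFi hE.measurableSet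
        fun x hx => (hge x).resolve_right (not_not.2 hx)
    rw [integral_sub hSi (hindi.const_mul _).integrableOn, integral_const_mul] at h1
    have h2 : ∫ x in E, (E \ K).indicator (fun _ => (1 : ℝ)) x ≤ ε / (2 * (2 * L + 1)) := by
      have h3 : ∫ x in E, (E \ K).indicator (fun _ => (1 : ℝ)) x
          ≤ ∫ x, (E \ K).indicator (fun _ => (1 : ℝ)) x :=
        setIntegral_le_integral hindi (Eventually.of_forall fun x =>
          indicator_nonneg (fun _ _ => zero_le_one) x)
      refine h3.trans ?_
      rw [integral_indicator_const _ (hE.measurableSet.diff hKm), smul_eq_mul, mul_one, Measure.real]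
      exact ENNReal.toReal_le_of_le_ofReal (by positivity) hKd.le
    have h3 : (2 * L + 1) * (ε / (2 * (2 * L + 1))) = ε / 2 := by field_simp
    have h4 := mul_le_mul_of_nonneg_left h2 hM.le
    linarith
  obtain ⟨n, hn⟩ := (hDCT.eventually (lt_mem_nhds
    (show (∫ x in E, F (e₀ x) (e₁ x) x) - ε / 2 < ∫ x in E, F (e₀ x) (e₁ x) x by linarith))).exists
  refine ⟨moll (ρ n) e₀, moll (ρ n) e₁, hz0 n, hz1 n, hzsq n, ?_⟩
  have i0 : Integrable (moll (ρ n) e₀) := integrable_moll _ he₀i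
  have i1 : Integrable (moll (ρ n) e₁) := integrable_moll _ he₁i
  have k0 : Integrable fun x => p x * moll (ρ n) e₀ x :=
    i0.bdd_mul hpm.aestronglyMeasurable (Eventually.of_forall hpL)
  have k1 : Integrable fun x => q x * moll (ρ n) e₁ x :=
    i1.bdd_mul hqm.aestronglyMeasurable (Eventually.of_forall hqL)
  have kg := integrable_gap i0 i1 (hzsq n)
  have hoff : ∀ x, x ∉ E → moll (ρ n) e₀ x = 0 ∧ moll (ρ n) e₁ x = 0 := fun x hx =>
    ⟨image_eq_zero_of_notMem_tsupport fun h => hx ((hz0 n).tsupport_subset h),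
      image_eq_zero_of_notMem_tsupport fun h => hx ((hz1 n).tsupport_subset h)⟩
  have hval : ∫ x in E, F (moll (ρ n) e₀ x) (moll (ρ n) e₁ x) x
      = (∫ x, p x * moll (ρ n) e₀ x) + (∫ x, q x * moll (ρ n) e₁ x)
        + (volume.real E - ∫ x, gap (moll (ρ n) e₀ x) (moll (ρ n) e₁ x)) := by
    simp only [hF]
    rw [setIntegral_add_add k0.integrableOn k1.integrableOn
      (integrableOn_one_sub hEf kg.integrableOn), setIntegral_one_sub hEf kg.integrableOn,
      setIntegral_isTest (hz0 n), setIntegral_isTest (hz1 n),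
      setIntegral_eq_integral_of_forall_compl_eq_zero
        (f := fun x => gap (moll (ρ n) e₀ x) (moll (ρ n) e₁ x))
        fun x hx => by rw [(hoff x hx).1, (hoff x hx).2, gap_zero]]
  rw [hval] at hn
  linarith

end Exterior

/-! ### A competitor composed of two fields. -/

section LowerBound

theorem pderiv_add {f g : Plane → ℝ} {x : Plane} (hf : DifferentiableAt ℝ f x)
    (hg : DifferentiableAt ℝ g x) (i : Fin 2) :
    pderiv i (fun y => f y + g y) x = pderiv i f x + pderiv i g x := by
  rw [pderiv, fderiv_fun_add hf hg]
  rfl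

theorem IsTest.add {U : Set Plane} {φ ψ : Plane → ℝ} (hφ : IsTest U φ) (hψ : IsTest U ψ) :
    IsTest U fun x => φ x + ψ x :=
  ⟨hφ.smooth.add hψ.smooth, hφ.hasCompactSupport.add hψ.hasCompactSupport,
    (tsupport_add φ ψ).trans (union_subset hφ.tsupport_subset hψ.tsupport_subset)⟩

theorem IsTest.mono {U U' : Set Plane} {φ : Plane → ℝ} (hφ : IsTest U φ) (h : U ⊆ U') :
    IsTest U' φ := ⟨hφ.smooth, hφ.hasCompactSupport, hφ.tsupport_subset.trans h⟩

theorem IsTest.eq_zero {U : Set Plane} {φ : Plane → ℝ} (hφ : IsTest U φ) {x : Plane}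
    (hx : x ∉ U) : φ x = 0 :=
  image_eq_zero_of_notMem_tsupport fun h => hx (hφ.tsupport_subset h)

theorem IsTest.pderiv_eq_zero {U : Set Plane} {φ : Plane → ℝ} (hφ : IsTest U φ) {x : Plane}
    (hx : x ∉ U) (i : Fin 2) : pderiv i φ x = 0 :=
  pderiv_eq_zero_of_notMem_tsupport (fun h => hx (hφ.tsupport_subset h)) i

theorem isTest_pt {U : Set Plane} {φ ψ : Plane → ℝ} (hφ : IsTest U φ) (hψ : IsTest U ψ) :
    IsTest U fun x => pt (φ x, ψ x) := by
  have hsub : tsupport (fun x => pt (φ x, ψ x)) ⊆ tsupport φ ∪ tsupport ψ := by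
    refine closure_minimal (fun x hx => ?_) ((isClosed_tsupport _).union (isClosed_tsupport _))
    by_contra h
    rw [mem_union, not_or] at h
    refine hx ?_
    show pt (φ x, ψ x) = 0
    rw [image_eq_zero_of_notMem_tsupport h.1, image_eq_zero_of_notMem_tsupport h.2]
    exact plane_ext rfl rfl
  refine ⟨?_, ?_, hsub.trans (union_subset hφ.tsupport_subset hψ.tsupport_subset)⟩
  · rw [contDiff_euclidean]
    intro i
    fin_cases i
    · exact hφ.smooth
    · exact hψ.smooth
  · exact HasCompactSupport.of_support_subset_isCompact
      (hφ.hasCompactSupport.isCompact.union hψ.hasCompactSupport.isCompact)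
      (subset_closure.trans hsub)

theorem norm_pt_sq (p q : ℝ) : ‖pt (p, q)‖ ^ 2 = p ^ 2 + q ^ 2 := by
  rw [EuclideanSpace.norm_sq_eq, Fin.sum_univ_two]
  simp

/-- Since at each point one of the two fields vanishes, their sum stays in the unit disc and its gap
is the sum of the gaps, so the sum is admissible in the supremum. -/
theorem le_area {Ω' : Set Plane} (hΩ'f : volume Ω' ≠ ⊤) {u₀ v w : Plane → ℝ} {L : ℝ≥0}
    (hu₀ : LipschitzWith L u₀) (hv : Integrable v) (hw : ∀ᵐ x, w x = u₀ x + v x)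
    {K E : Set Plane} (hK : K ⊆ Ω') (hE : E ⊆ Ω') (hvE : ∀ x ∈ E, v x = 0)
    {ζ₀ ζ₁ θ₀ θ₁ : Plane → ℝ} (hζ₀ : IsTest K ζ₀) (hζ₁ : IsTest K ζ₁) (hθ₀ : IsTest E θ₀)
    (hθ₁ : IsTest E θ₁) (hζ : ∀ x, ζ₀ x ^ 2 + ζ₁ x ^ 2 ≤ 1) (hθ : ∀ x, θ₀ x ^ 2 + θ₁ x ^ 2 ≤ 1)
    (hdisj : ∀ x, (ζ₀ x = 0 ∧ ζ₁ x = 0) ∨ (θ₀ x = 0 ∧ θ₁ x = 0)) :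
    ENNReal.ofReal (volume.real Ω' - (∫ x, (u₀ x + v x) * pderiv 0 ζ₀ x)
        - (∫ x, (u₀ x + v x) * pderiv 1 ζ₁ x) - (∫ x, gap (ζ₀ x) (ζ₁ x))
        + (∫ x, pderiv 0 u₀ x * θ₀ x) + (∫ x, pderiv 1 u₀ x * θ₁ x)
        - ∫ x, gap (θ₀ x) (θ₁ x)) ≤ area Ω' w := by
  have h0 : IsTest Ω' fun x => ζ₀ x + θ₀ x := (hζ₀.mono hK).add (hθ₀.mono hE)
  have h1 : IsTest Ω' fun x => ζ₁ x + θ₁ x := (hζ₁.mono hK).add (hθ₁.mono hE)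
  have hsq : ∀ x, (ζ₀ x + θ₀ x) ^ 2 + (ζ₁ x + θ₁ x) ^ 2 ≤ 1 := by
    intro x
    rcases hdisj x with ⟨e0, e1⟩ | ⟨e0, e1⟩
    · rw [e0, e1, zero_add, zero_add]; exact hθ x
    · rw [e0, e1, add_zero, add_zero]; exact hζ x
  have hgap : ∀ x, gap (ζ₀ x + θ₀ x) (ζ₁ x + θ₁ x) = gap (ζ₀ x) (ζ₁ x) + gap (θ₀ x) (θ₁ x) := by
    intro x
    rcases hdisj x with ⟨e0, e1⟩ | ⟨e0, e1⟩
    · rw [e0, e1, zero_add, zero_add, gap_zero, zero_add]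
    · rw [e0, e1, add_zero, add_zero, gap_zero, add_zero]
  have hint : ∀ {U : Set Plane} {φ : Plane → ℝ}, IsTest U φ → Integrable φ := fun h =>
    h.smooth.continuous.integrable_of_hasCompactSupport h.hasCompactSupport
  have hgζ := integrable_gap (hint hζ₀) (hint hζ₁) hζ
  have hgθ := integrable_gap (hint hθ₀) (hint hθ₁) hθ
  have hui : ∀ {U : Set Plane} {φ : Plane → ℝ} (i : Fin 2), IsTest U φ →
      Integrable fun x => u₀ x * pderiv i φ x := fun i h =>
    (hu₀.continuous.mul (continuous_pderiv h.smooth i)).integrable_of_hasCompactSupport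
      (hasCompactSupport_pderiv h.hasCompactSupport i).mul_left
  have huvi : ∀ {U : Set Plane} {φ : Plane → ℝ} (i : Fin 2), IsTest U φ →
      Integrable fun x => (u₀ x + v x) * pderiv i φ x := fun i h => by
    have := (hui i h).add (integrable_mul_hasCompactSupport hv (continuous_pderiv h.smooth i)
      (hasCompactSupport_pderiv h.hasCompactSupport i))
    refine this.congr (Eventually.of_forall fun x => ?_)
    simp only [Pi.add_apply]; ring
  -- On E only u₀ is present, so the derivative can be moved onto it.
  have hθu : ∀ {θ : Plane → ℝ} (i : Fin 2), IsTest E θ →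
      ∫ x, (u₀ x + v x) * pderiv i θ x = -∫ x, pderiv i u₀ x * θ x := by
    intro θ i h
    rw [← integral_mul_pderiv hu₀ i h]
    congr 1; ext x
    by_cases hx : x ∈ E
    · rw [hvE x hx, add_zero]
    · rw [h.pderiv_eq_zero hx, mul_zero, mul_zero]
  have hcomp : ∀ {ζ θ : Plane → ℝ} (i : Fin 2), IsTest K ζ → IsTest E θ →
      ∫ x, (u₀ x + v x) * pderiv i (fun x => ζ x + θ x) x
        = (∫ x, (u₀ x + v x) * pderiv i ζ x) - ∫ x, pderiv i u₀ x * θ x := by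
    intro ζ θ i h h'
    rw [sub_eq_add_neg, ← hθu i h', ← integral_add (huvi i h) (huvi i h')]
    congr 1; ext x
    rw [pderiv_add (h.smooth.differentiable (by simp) x) (h'.smooth.differentiable (by simp) x)]
    ring
  set η : Plane → Plane := fun x => pt (ζ₀ x + θ₀ x, ζ₁ x + θ₁ x) with hη
  have hηt : IsTest Ω' η := isTest_pt h0 h1
  have hηn : ∀ x, ‖η x‖ ≤ 1 := fun x => by
    have := norm_pt_sq (ζ₀ x + θ₀ x) (ζ₁ x + θ₁ x)
    rw [← abs_norm, ← sq_le_one_iff_abs_le_one]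
    rw [hη, this]; exact hsq x
  have hdiv : ∀ x, divergence η x
      = pderiv 0 (fun x => ζ₀ x + θ₀ x) x + pderiv 1 (fun x => ζ₁ x + θ₁ x) x := fun x => by
    rw [divergence, Fin.sum_univ_two]; rfl
  have e1 : ∫ x in Ω', w x * divergence η x
      = (∫ x, (u₀ x + v x) * pderiv 0 (fun x => ζ₀ x + θ₀ x) x)
        + ∫ x, (u₀ x + v x) * pderiv 1 (fun x => ζ₁ x + θ₁ x) x := by
    rw [← integral_add (huvi 0 h0) (huvi 1 h1),
      setIntegral_eq_integral_of_forall_compl_eq_zero fun x hx => by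
        rw [hdiv, h0.pderiv_eq_zero hx, h1.pderiv_eq_zero hx, add_zero, mul_zero]]
    refine integral_congr_ae ?_
    filter_upwards [hw] with x hx
    rw [hx, hdiv]; ring
  have e2 : ∫ x in Ω', √(1 - ‖η x‖ ^ 2)
      = volume.real Ω' - (∫ x, gap (ζ₀ x) (ζ₁ x)) - ∫ x, gap (θ₀ x) (θ₁ x) := by
    have e3 : ∀ x, √(1 - ‖η x‖ ^ 2) = 1 - (gap (ζ₀ x) (ζ₁ x) + gap (θ₀ x) (θ₁ x)) := fun x => by
      rw [← hgap, gap, sub_sub_cancel, hη, norm_pt_sq]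
    have hi : Integrable fun x => gap (ζ₀ x) (ζ₁ x) + gap (θ₀ x) (θ₁ x) := hgζ.add hgθ
    simp_rw [e3]
    rw [setIntegral_one_sub hΩ'f hi.integrableOn,
      setIntegral_eq_integral_of_forall_compl_eq_zero fun x hx => by
        rw [← hgap, h0.eq_zero hx, h1.eq_zero hx, gap_zero], integral_add hgζ hgθ]
    ring
  refine le_trans (ENNReal.ofReal_le_ofReal (le_of_eq ?_))
    (le_iSup_of_le η (le_iSup_of_le hηt (le_iSup_of_le hηn le_rfl)))
  rw [e1, e2, hcomp 0 hζ₀ hθ₀, hcomp 1 hζ₁ hθ₁]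
  ring

end LowerBound

/-! ### The error terms in the boundary datum. -/

section Limit

/-- The multiple n j allows for the factor l of the chain rule in the direction x_1; the factor 1 is
used in the direction x_2. -/
theorem eventually_integral_sub_moll_dil_le {Ω : Set Plane}
    {g h : Plane → ℝ} (hg : IntegrableOn g Ω) (hh : Integrable h)
    {ρ : ℕ → ContDiffBump (0 : Plane)} {c : ℝ} {l n : ℕ → ℝ}
    (hρ : Tendsto (fun j => (ρ j).rOut) atTop (𝓝 0)) (hl1 : ∀ j, 1 ≤ l j)
    (hl : Tendsto l atTop (𝓝 1)) (hn : Tendsto n atTop (𝓝 1)) {ε : ℝ} (hε : 0 < ε) :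
    ∀ᶠ j in atTop, ∫ x in Ω, |g x - n j * moll (ρ j) h (dil c (l j) x)|
      ≤ (∫ x in Ω, |g x - h x|) + ε := by
  have hTi : ∀ j, Integrable fun x => moll (ρ j) h (dil c (l j) x) := fun j =>
    integrable_comp_dil c (by linarith [hl1 j]) (integrable_moll _ hh)
  have hD : Tendsto (fun j => ∫ x, |moll (ρ j) h (dil c (l j) x) - h x|) atTop (𝓝 0) := by
    have h1 := (ENNReal.tendsto_toReal ENNReal.zero_ne_top).comp
      (tendsto_moll_dil (c := c) hρ hl1 hl hh)
    refine h1.congr fun j => ?_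
    rw [Function.comp_apply, ← integral_norm_eq_lintegral_enorm]
    · rfl
    · exact ((hTi j).sub hh).aestronglyMeasurable
  have hlim : Tendsto (fun j => |n j| * (∫ x, |moll (ρ j) h (dil c (l j) x) - h x|)
      + |n j - 1| * ∫ x, |h x|) atTop (𝓝 0) := by
    have h1 := (hn.abs.mul hD).add (((hn.sub_const 1).abs).mul_const (∫ x, |h x|))
    simpa using h1
  filter_upwards [hlim.eventually (gt_mem_nhds hε)] with j hj
  have i1 : Integrable fun x => |moll (ρ j) h (dil c (l j) x) - h x| := ((hTi j).sub hh).abs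
  have i2 : IntegrableOn (fun x => |g x - h x|) Ω := (hg.sub hh.integrableOn).abs
  have hpt : ∀ x, |g x - n j * moll (ρ j) h (dil c (l j) x)|
      ≤ |g x - h x| + |n j| * |moll (ρ j) h (dil c (l j) x) - h x| + |n j - 1| * |h x| := by
    intro x
    rw [← abs_mul, ← abs_mul, ← abs_neg (n j * _), ← abs_neg ((n j - 1) * h x)]
    refine (le_of_eq ?_).trans (abs_add_three _ _ _)
    congr 1; ring
  have h1 : ∫ x in Ω, |g x - n j * moll (ρ j) h (dil c (l j) x)|
      ≤ ∫ x in Ω, (|g x - h x| + |n j| * |moll (ρ j) h (dil c (l j) x) - h x|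
        + |n j - 1| * |h x|) :=
    integral_mono (hg.sub ((hTi j).const_mul (n j)).integrableOn).abs
      ((i2.add (i1.const_mul _).integrableOn).add (hh.abs.const_mul _).integrableOn) hpt
  rw [setIntegral_add_add i2 (i1.const_mul _).integrableOn (hh.abs.const_mul _).integrableOn,
    integral_const_mul, integral_const_mul] at h1
  have h2 := mul_le_mul_of_nonneg_left (setIntegral_le_integral (s := Ω) i1
    (Eventually.of_forall fun x => abs_nonneg _)) (abs_nonneg (n j))
  have h3 := mul_le_mul_of_nonneg_left (setIntegral_le_integral (s := Ω) hh.abs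
    (Eventually.of_forall fun x => abs_nonneg _)) (abs_nonneg (n j - 1))
  linarith

end Limit

/-! ### Upper bound for the area integral over the enlarged domain. -/

section Area

variable {a b : ℝ} {κ₁ κ₂ : ℝ → ℝ}

theorem ae_coord_zero_ne (s : ℝ) : ∀ᵐ x : Plane, x 0 ≠ s := by
  rw [ae_plane_iff, Measure.volume_eq_prod]
  exact Measure.quasiMeasurePreserving_fst.ae (Measure.ae_ne volume s)

theorem ae_coord_one_ne {κ : ℝ → ℝ} (hκ : Continuous κ) (a b : ℝ) :
    ∀ᵐ x : Plane, x 0 ∈ Icc a b → x 1 ≠ κ (x 0) := by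
  have h := volume_band hκ a b 0
  rw [mul_zero, ENNReal.ofReal_zero, zero_mul] at h
  refine measure_mono_null (fun x hx => ?_) h
  have hx : ¬(x 0 ∈ Icc a b → x 1 ≠ κ (x 0)) := hx
  push Not at hx
  exact ⟨hx.1, by rw [hx.2, sub_self, abs_zero]⟩

/-- The region between the graphs is, up to a null set, the closed region. -/
theorem ae_mem_between (h₁ : Continuous κ₁) (h₂ : Continuous κ₂) :
    ∀ᵐ x : Plane, (x 0 ∈ Icc a b ∧ κ₁ (x 0) ≤ x 1 ∧ x 1 ≤ κ₂ (x 0)) →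
      x ∈ between (Ioo a b) κ₁ κ₂ := by
  filter_upwards [ae_coord_zero_ne a, ae_coord_zero_ne b, ae_coord_one_ne h₁ a b,
    ae_coord_one_ne h₂ a b] with x ha hb h1 h2 hx
  exact ⟨⟨lt_of_le_of_ne hx.1.1 ha.symm, lt_of_le_of_ne hx.1.2 hb⟩,
    lt_of_le_of_ne hx.2.1 (h1 hx.1).symm, lt_of_le_of_ne hx.2.2 (h2 hx.1)⟩

theorem isClosed_closedBetween (h₁ : Continuous κ₁) (h₂ : Continuous κ₂) :
    IsClosed {x : Plane | x 0 ∈ Icc a b ∧ κ₁ (x 0) ≤ x 1 ∧ x 1 ≤ κ₂ (x 0)} :=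
  (isClosed_Icc.preimage (continuous_coord 0)).inter
    ((isClosed_le (h₁.comp (continuous_coord 0)) (continuous_coord 1)).inter
      (isClosed_le (continuous_coord 1) (h₂.comp (continuous_coord 0))))

/-- Ω' consists, up to a null set, of Ω and the exterior E of the closed region. The estimates on
both parts are added, and the two dual fields together are tested against ŵ; crossing the vertical
sides is allowed because Ω' contains them. -/
theorem eventually_area_le {L₀ : ℝ≥0} (hab : a < b) (h₁ : LipschitzWith L₀ κ₁)
    (h₂ : LipschitzWith L₀ κ₂) (hc₁ : ∀ s, κ₁ s = κ₁ (max a (min b s)))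
    (hc₂ : ∀ s, κ₂ s = κ₂ (max a (min b s)))
    {Ω Ω' : Set Plane} (hΩ : Ω = between (Ioo a b) κ₁ κ₂) (hΩ'o : IsOpen Ω')
    (hΩ'b : Bornology.IsBounded Ω') (hΩ' : between (Icc a b) κ₁ κ₂ ⊆ Ω')
    {u₀ : Plane → ℝ} {L : ℝ≥0} (hu₀ : LipschitzWith L u₀) {v w : Plane → ℝ} (hv : Integrable v)
    (hv0 : ∀ x, x ∉ Ω → v x = 0) (hw : ∀ᵐ x, w x = u₀ x + v x)
    {β : Plane → ℝ} {δ : ℝ} (hδ : 0 < δ)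
    (hβ : ContDiff ℝ ((⊤ : ℕ∞) : WithTop ℕ∞) β) (hβ0 : ∀ x, 0 ≤ β x) (hβ1 : ∀ x, β x ≤ 1)
    (hβs : ∀ x, β x ≠ 0 → κ₁ (x 0) + δ ≤ x 1 ∧ x 1 ≤ κ₂ (x 0) - δ) {ε : ℝ} (hε : 0 < ε)
    (hvβ : ∀ i, Integrable fun x => v x * pderiv i β x)
    (hvβε : ∀ i, ∫ x, |v x * pderiv i β x| ≤ ε) (hβε : ∫ x in Ω, (1 - β x) ≤ ε)
    {r l : ℕ → ℝ} (hr : ∀ j, 0 < r j) (hr0 : Tendsto r atTop (𝓝 0))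
    (hl : ∀ j, l j = 1 + 4 * r j / (b - a)) {c : ℝ} (hc : c = (a + b) / 2)
    (hφ : ∀ᶠ j in atTop, IsTest Ω fun x =>
      moll (bump (r j) (hr j)) (fun y => β y * v y) (dil c (l j) x)) :
    ∀ᶠ j in atTop, ∫⁻ x in Ω', ENNReal.ofReal √(1 + ((pderiv 0 u₀ x
          + pderiv 0 (fun x => moll (bump (r j) (hr j)) (fun y => β y * v y) (dil c (l j) x)) x) ^ 2
        + (pderiv 1 u₀ x
          + pderiv 1 (fun x => moll (bump (r j) (hr j)) (fun y => β y * v y) (dil c (l j) x)) x) ^ 2))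
      ≤ area Ω' w + ENNReal.ofReal ((6 + 2 * L) * ε) := by
  have k₁ := h₁.continuous
  have k₂ := h₂.continuous
  have hΩo : IsOpen Ω := by rw [hΩ]; exact isOpen_between k₁ k₂ isOpen_Ioo
  have hΩm := hΩo.measurableSet
  have hΩf : volume Ω ≠ ⊤ := by rw [hΩ]; exact (volume_between_lt_top k₁ k₂).ne
  have hΩ'm := hΩ'o.measurableSet
  have hΩ'f : volume Ω' ≠ ⊤ := hΩ'b.measure_lt_top.ne
  have hΩΩ' : Ω ⊆ Ω' := by
    rw [hΩ]; exact fun x hx => hΩ' ⟨Ioo_subset_Icc_self hx.1, hx.2⟩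
  set R : Set Plane := {x | x 0 ∈ Icc a b ∧ κ₁ (x 0) ≤ x 1 ∧ x 1 ≤ κ₂ (x 0)} with hR
  have hΩR : Ω ⊆ R := by rw [hΩ]; exact between_subset
  set E := Ω' \ R with hE
  have hEo : IsOpen E := hΩ'o.sdiff (isClosed_closedBetween k₁ k₂)
  have hEf : volume E ≠ ⊤ := ne_top_of_le_ne_top hΩ'f (measure_mono sdiff_subset)
  have hEΩ : Disjoint Ω E := disjoint_left.2 fun x hx h => h.2 (hΩR hx)
  have hae : (Ω' : Set Plane) =ᵐ[volume] (Ω ∪ E : Set Plane) := by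
    filter_upwards [ae_mem_between (a := a) (b := b) k₁ k₂] with x hx
    refine propext ⟨fun h => ?_, fun h => h.elim (fun h => hΩΩ' h) fun h => h.1⟩
    by_cases hxR : x ∈ R
    · left; rw [hΩ]; exact hx hxR
    · right; exact ⟨h, hxR⟩
  obtain ⟨θ₀, θ₁, hθ₀, hθ₁, hθ, hext⟩ := exists_exterior_field hEo hEf hu₀ hε
  -- the supports of the two fields are disjoint
  set C : Set Plane := {x | x 0 ∈ Icc a b ∧ κ₁ (x 0) + δ ≤ x 1 ∧ x 1 ≤ κ₂ (x 0) - δ} with hC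
  have hCc : IsCompact C := isCompact_core k₁ k₂ a b δ
  have hCR : C ⊆ R := fun x hx => ⟨hx.1, by linarith [hx.2.1], by linarith [hx.2.2]⟩
  have hCΩ' : C ⊆ Ω' := fun x hx => hΩ' ⟨hx.1, by linarith [hx.2.1], by linarith [hx.2.2]⟩
  -- The compact core C includes its points on the vertical sides, lies in Ω' and misses the
  -- supports of the exterior field; a thickening of it still does.
  obtain ⟨t, ht, htO⟩ := hCc.exists_cthickening_subset_open
    (hΩ'o.sdiff ((isClosed_tsupport θ₀).union (isClosed_tsupport θ₁))) fun x hx =>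
      ⟨hCΩ' hx, fun h => h.elim (fun h => (hθ₀.tsupport_subset h).2 (hCR hx))
        fun h => (hθ₁.tsupport_subset h).2 (hCR hx)⟩
  set K : ℕ → Set Plane := fun j => {x | x 0 ∈ Icc (a - 3 * r j) (b + 3 * r j) ∧
    κ₁ (x 0) + δ ≤ x 1 ∧ x 1 ≤ κ₂ (x 0) - δ} with hK
  -- Projecting x_1 to [a, b] moves a point of K j by at most 3 r j, and its height remains
  -- admissible because κ₁ and κ₂ are constant beyond a and b.
  have hKO : ∀ j, 3 * r j ≤ t → K j ⊆ Ω' \ (tsupport θ₀ ∪ tsupport θ₁) := by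
    intro j hj x hx
    refine htO (Metric.mem_cthickening_of_dist_le x (pt (max a (min b (x 0)), x 1)) t C
      ⟨⟨le_max_left _ _, max_le hab.le (min_le_left _ _)⟩, ?_, ?_⟩ ?_)
    · simp only [pt_zero, pt_one]; rw [← hc₁]; exact hx.2.1
    · simp only [pt_zero, pt_one]; rw [← hc₂]; exact hx.2.2
    · refine (dist_le_abs_add_abs _ _).trans ?_
      simp only [pt_zero, pt_one, sub_self, abs_zero, add_zero]
      refine le_trans ?_ hj
      have hx0 := hx.1
      have hrj := hr j
      rw [abs_le]
      rcases le_total (x 0) b with hb' | hb'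
      · rw [min_eq_right hb']
        rcases le_total a (x 0) with ha' | ha'
        · rw [max_eq_right ha']; constructor <;> linarith
        · rw [max_eq_left ha']; constructor <;> linarith [hx0.1]
      · rw [min_eq_left hb', max_eq_right hab.le]; constructor <;> linarith [hx0.2]
  -- the error terms
  have hba : 0 < b - a := by linarith
  have hl1 : ∀ j, 1 ≤ l j := fun j => by
    have : 0 < 4 * r j / (b - a) := div_pos (by linarith [hr j]) hba
    rw [hl]; linarith
  have hllim : Tendsto l atTop (𝓝 1) := by
    have := ((hr0.const_mul 4).div_const (b - a)).const_add 1
    simp only [mul_zero, zero_div, add_zero] at this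
    exact this.congr fun j => (hl j).symm
  have hρlim : Tendsto (fun j => (bump (r j) (hr j)).rOut) atTop (𝓝 0) := hr0
  set h : Fin 2 → Plane → ℝ := fun i => Ω'.indicator fun y => β y * pderiv i u₀ y with hh
  have hβabs : ∀ x, ‖β x‖ ≤ 1 := fun x => by rw [Real.norm_of_nonneg (hβ0 x)]; exact hβ1 x
  have hhi : ∀ i, Integrable (h i) := by
    intro i
    rw [hh, integrable_indicator_iff hΩ'm]
    refine Measure.integrableOn_of_bounded (M := L) hΩ'f
      (hβ.continuous.measurable.mul (measurable_pderiv u₀ i)).aestronglyMeasurable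
      (Eventually.of_forall fun x => ?_)
    rw [norm_mul]
    refine (mul_le_mul (hβabs x) (norm_pderiv_le hu₀ i x) (norm_nonneg _) zero_le_one).trans_eq
      (one_mul _)
  have hgi : ∀ i, IntegrableOn (pderiv i u₀) Ω := fun i =>
    Measure.integrableOn_of_bounded (M := L) hΩf (measurable_pderiv u₀ i).aestronglyMeasurable
      (Eventually.of_forall fun x => norm_pderiv_le hu₀ i x)
  have hβi : IntegrableOn β Ω := Measure.integrableOn_of_bounded (M := 1) hΩf
    hβ.continuous.aestronglyMeasurable (Eventually.of_forall hβabs)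
  have hgh : ∀ i, ∫ x in Ω, |pderiv i u₀ x - h i x| ≤ L * ε := by
    intro i
    refine le_trans ?_ (mul_le_mul_of_nonneg_left hβε L.coe_nonneg)
    rw [← integral_const_mul]
    refine setIntegral_mono_on ((hgi i).sub (hhi i).integrableOn).abs
      ((integrableOn_one_sub hΩf hβi).const_mul _) hΩm fun x hx => ?_
    rw [hh]
    simp only
    rw [indicator_of_mem (hΩΩ' hx), show pderiv i u₀ x - β x * pderiv i u₀ x
      = pderiv i u₀ x * (1 - β x) by ring, abs_mul,
      abs_of_nonneg (show 0 ≤ 1 - β x by linarith [hβ1 x])]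
    exact mul_le_mul_of_nonneg_right (norm_pderiv_le hu₀ i x) (by linarith [hβ1 x])
  have hvol : ∀ᶠ j in atTop, (l j - 1) * volume.real Ω < ε := by
    have := (hllim.sub_const 1).mul_const (volume.real Ω)
    rw [sub_self, zero_mul] at this
    exact this.eventually (gt_mem_nhds hε)
  have hrt : ∀ᶠ j in atTop, 3 * r j < t := by
    have := hr0.const_mul 3
    rw [mul_zero] at this
    exact this.eventually (gt_mem_nhds ht)
  filter_upwards [hφ, hvol, hrt,
    eventually_integral_sub_moll_dil_le (c := c) (hgi 0) (hhi 0) hρlim hl1 hllim hllim hε,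
    eventually_integral_sub_moll_dil_le (c := c) (n := fun _ => 1) (hgi 1) (hhi 1) hρlim hl1 hllim
      tendsto_const_nhds hε] with j hφj hvolj hrtj herr0 herr1
  simp only [one_mul] at herr1
  have hKj := hKO j hrtj.le
  obtain ⟨ζ₀, ζ₁, hζ₀, hζ₁, hζ, hint⟩ := interior_area_le hab k₁ k₂ hΩ hu₀ hv hβ hβ0 hβ1 hβs hvβ
    (bump (r j) (hr j)) rfl hc (hl j) hφj hΩ'm hΩ'f (hKj.trans sdiff_subset)
  set φ : Plane → ℝ := fun x =>
    moll (bump (r j) (hr j)) (fun y => β y * v y) (dil c (l j) x) with hφdef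
  have hdisj : ∀ x, (ζ₀ x = 0 ∧ ζ₁ x = 0) ∨ (θ₀ x = 0 ∧ θ₁ x = 0) := by
    intro x
    by_cases hx : x ∈ K j
    · right
      have := (hKj hx).2
      rw [mem_union, not_or] at this
      exact ⟨image_eq_zero_of_notMem_tsupport this.1, image_eq_zero_of_notMem_tsupport this.2⟩
    · left; exact ⟨hζ₀.eq_zero hx, hζ₁.eq_zero hx⟩
  have harea := le_area hΩ'f hu₀ hv hw (hKj.trans sdiff_subset) (sdiff_subset (s := Ω') (t := R))
    (fun x hx => hv0 x fun h => hx.2 (hΩR h)) hζ₀ hζ₁ hθ₀ hθ₁ hζ hθ hdisj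
  obtain ⟨D, hD⟩ := lipschitz_of_isTest hφj
  set S : Plane → ℝ := fun x => √(1 + ((pderiv 0 u₀ x + pderiv 0 φ x) ^ 2
    + (pderiv 1 u₀ x + pderiv 1 φ x) ^ 2)) with hS
  have hSm : Measurable S := Real.continuous_sqrt.measurable.comp
    (((((measurable_pderiv _ _).add (measurable_pderiv _ _)).pow_const 2).add
      (((measurable_pderiv _ _).add (measurable_pderiv _ _)).pow_const 2)).const_add 1)
  have hS0 : ∀ x, 0 ≤ S x := fun x => Real.sqrt_nonneg _
  have hSi : IntegrableOn S Ω' := by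
    refine Measure.integrableOn_of_bounded (M := 1 + (L + D) + (L + D)) hΩ'f
      hSm.aestronglyMeasurable (Eventually.of_forall fun x => ?_)
    rw [Real.norm_of_nonneg (hS0 x)]
    refine (sqrt_le_one_add_abs _ _).trans (add_le_add (add_le_add le_rfl ?_) ?_)
    · exact (norm_add_le _ _).trans (add_le_add (norm_pderiv_le hu₀ 0 x) (norm_pderiv_le hD 0 x))
    · exact (norm_add_le _ _).trans (add_le_add (norm_pderiv_le hu₀ 1 x) (norm_pderiv_le hD 1 x))
  have hsplit : ∫ x in Ω', S x = (∫ x in Ω, S x) + ∫ x in E, S x := by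
    rw [setIntegral_congr_set hae, setIntegral_union hEΩ hEo.measurableSet (hSi.mono_set hΩΩ')
      (hSi.mono_set sdiff_subset)]
  have hSE : ∫ x in E, S x = ∫ x in E, √(1 + (pderiv 0 u₀ x ^ 2 + pderiv 1 u₀ x ^ 2)) := by
    refine setIntegral_congr_fun hEo.measurableSet fun x hx => ?_
    have hxΩ : x ∉ Ω := fun h => hx.2 (hΩR h)
    simp only [hS]
    rw [hφj.pderiv_eq_zero hxΩ, hφj.pderiv_eq_zero hxΩ, add_zero, add_zero]
  have hvolΩ' : volume.real Ω' = volume.real Ω + volume.real E := by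
    rw [measureReal_congr hae, measureReal_union hEΩ hEo.measurableSet hΩf hEf]
  rw [← ofReal_integral_eq_lintegral_ofReal hSi (Eventually.of_forall hS0)]
  refine le_trans ?_ (add_le_add harea le_rfl)
  refine le_trans (ENNReal.ofReal_le_ofReal ?_) ENNReal.ofReal_add_le
  have hint' : ∫ x in Ω, S x ≤ _ := hint
  have e0 := hgh 0
  have e1 := hgh 1
  have e2 := hvβε 0
  have e3 := hvβε 1
  rw [hsplit, hSE, hvolΩ']
  -- The constant 6 + 2 L: one ε from the exterior field, one from (l - 1) |Ω|, two from v ∂_i β,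
  -- and L + 1 from each of the two error terms in ∂_i u₀.
  linarith

end Area

/-! ### Construction of one approximating function. -/

section Approximation

variable {a b : ℝ} {κ₁ κ₂ : ℝ → ℝ}

theorem integral_abs_le_of_lintegral_enorm_le {F : Plane → ℝ} (hF : Integrable F) {ε : ℝ}
    (hε : 0 ≤ ε) (h : ∫⁻ x, ‖F x‖ₑ ≤ ENNReal.ofReal ε) : ∫ x, |F x| ≤ ε := by
  have := integral_norm_eq_lintegral_enorm hF.aestronglyMeasurable
  simp only [Real.norm_eq_abs] at this
  rw [this]
  exact ENNReal.toReal_le_of_le_ofReal hε h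

/-- The cutoff is fixed first, with its errors below ε₁; only then is the scale r of mollification
and dilation chosen, small compared with the distance δ of the support of β from the graphs. -/
theorem exists_test_approx {L₀ : ℝ≥0} (hab : a < b) (h₁ : LipschitzWith L₀ κ₁)
    (h₂ : LipschitzWith L₀ κ₂) (hc₁ : ∀ s, κ₁ s = κ₁ (max a (min b s)))
    (hc₂ : ∀ s, κ₂ s = κ₂ (max a (min b s)))
    {Ω Ω' : Set Plane} (hΩ : Ω = between (Ioo a b) κ₁ κ₂) (hΩ'o : IsOpen Ω')
    (hΩ'b : Bornology.IsBounded Ω') (hΩ' : between (Icc a b) κ₁ κ₂ ⊆ Ω')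
    {u₀ : Plane → ℝ} {L : ℝ≥0} (hu₀ : LipschitzWith L u₀) {v w G : Plane → ℝ}
    (hGm : Measurable G) (hG : Integrable G) (hG0 : ∀ x, x ∉ Ω → G x = 0)
    (hGs : ∀ᵐ s : ℝ, ∫ t, G (pt (s, t)) = 0) (hv : v = Ω.indicator (vint G))
    (hw : ∀ᵐ x, w x = u₀ x + v x)
    {f : ℝ → ℝ} (hf : ConvexOn ℝ univ f) (hf0 : ∀ t, 0 ≤ f t) {c₃ : ℝ}
    (htri : ∀ t s, f (t + s) ≤ c₃ * (f t + f s)) {ε : ℝ} (hε : 0 < ε) :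
    ∃ φ : Plane → ℝ, IsTest Ω φ ∧ (∫⁻ x, ‖φ x - v x‖ₑ ≤ ENNReal.ofReal ε) ∧
      (∫⁻ x, ‖pderiv 1 φ x - G x‖ₑ ≤ ENNReal.ofReal ε) ∧
      (∫⁻ x in Ω', ENNReal.ofReal √(1 + ((pderiv 0 u₀ x + pderiv 0 φ x) ^ 2
        + (pderiv 1 u₀ x + pderiv 1 φ x) ^ 2)) ≤ area Ω' w + ENNReal.ofReal ε) ∧
      ∫⁻ x in Ω, ENNReal.ofReal (f (pderiv 1 u₀ x + pderiv 1 φ x))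
        ≤ (∫⁻ x in Ω, ENNReal.ofReal (f (pderiv 1 u₀ x + G x))) + ENNReal.ofReal ε := by
  have k₁ := h₁.continuous
  have k₂ := h₂.continuous
  have hΩo : IsOpen Ω := by rw [hΩ]; exact isOpen_between k₁ k₂ isOpen_Ioo
  have hΩm := hΩo.measurableSet
  have hΩf : volume Ω ≠ ⊤ := by rw [hΩ]; exact (volume_between_lt_top k₁ k₂).ne
  have hLpos : (0 : ℝ) < 2 * (6 + 2 * L) := by have := L.coe_nonneg; linarith
  -- Small enough both for the constant 6 + 2 L of the area bound and for the sum of the two errors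
  -- from cutoff and mollification.
  set ε₁ : ℝ := ε / (2 * (6 + 2 * L)) with hε₁
  have hε₁0 : 0 < ε₁ := div_pos hε hLpos
  have hε₁L : (6 + 2 * L) * ε₁ ≤ ε := by
    have : (6 + 2 * L) * ε₁ = ε / 2 := by rw [hε₁]; field_simp
    linarith
  have hε₁2 : ε₁ + ε₁ ≤ ε := by
    have := mul_nonneg L.coe_nonneg hε₁0.le
    linarith
  have hE : 0 < ENNReal.ofReal ε₁ := ENNReal.ofReal_pos.2 hε₁0
  have hEE : ENNReal.ofReal ε₁ + ENNReal.ofReal ε₁ ≤ ENNReal.ofReal ε := by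
    rw [← ENNReal.ofReal_add hε₁0.le hε₁0.le]; exact ENNReal.ofReal_le_ofReal hε₁2
  have hv0 : ∀ x, x ∉ Ω → v x = 0 := fun x hx => by rw [hv]; exact indicator_of_notMem hx _
  have hvG : ∀ᵐ x, v x = vint G x := by
    filter_upwards [ae_vint_eq_zero hΩ hG hG0 hGs] with x hx
    by_cases h : x ∈ Ω
    · rw [hv, indicator_of_mem h]
    · rw [hv0 x h, hx h]
  have hvi : Integrable v :=
    (integrable_vint k₁ k₂ hΩ hGm hG hG0 hGs).congr (hvG.mono fun x hx => hx.symm)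
  have hvw : ∀ φ, IsTest univ φ → ∫ x, v x * pderiv 1 φ x = -∫ x, G x * φ x := by
    intro φ hφ
    rw [← integral_vint_mul_pderiv hGm hG hφ]
    refine integral_congr_ae ?_
    filter_upwards [hvG] with x hx
    rw [hx]
  obtain ⟨β, δ, hδ, hβ, hβ0, hβ1, hβs, b1, b2, b3, b4, b5⟩ := exists_cutoff_approx h₁ h₂ hΩ hGm hG
    hG0 hGs hf hf0 htri (norm_pderiv_le hu₀ 1) hE
  have hβabs : ∀ x, ‖β x‖ ≤ 1 := fun x => by rw [Real.norm_of_nonneg (hβ0 x)]; exact hβ1 x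
  have hvβi : ∀ i, Integrable fun x => v x * pderiv i β x := fun i => by
    refine ⟨hvi.aestronglyMeasurable.mul (continuous_pderiv hβ i).aestronglyMeasurable, ?_⟩
    refine lt_of_le_of_lt ?_ ((b1 i).trans_lt ENNReal.ofReal_lt_top)
    exact (lintegral_congr_ae (hvG.mono fun x hx => by simp only [hx])).le
  have hvβε : ∀ i, ∫ x, |v x * pderiv i β x| ≤ ε₁ := fun i =>
    integral_abs_le_of_lintegral_enorm_le (hvβi i) hε₁0.le
      ((lintegral_congr_ae (hvG.mono fun x hx => by simp only [hx])).trans_le (b1 i))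
  have hβi : IntegrableOn β Ω := Measure.integrableOn_of_bounded (M := 1) hΩf
    hβ.continuous.aestronglyMeasurable (Eventually.of_forall hβabs)
  have hβε : ∫ x in Ω, (1 - β x) ≤ ε₁ := by
    rw [integral_eq_lintegral_of_nonneg_ae
      (Eventually.of_forall fun x => show (0 : ℝ) ≤ 1 - β x by linarith [hβ1 x])
      (integrableOn_one_sub hΩf hβi).aestronglyMeasurable]
    exact ENNReal.toReal_le_of_le_ofReal hε₁0.le b4
  set V : Plane → ℝ := fun y => β y * v y with hV
  set H : Plane → ℝ := fun x => β x * G x + v x * pderiv 1 β x with hH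
  have hVi : Integrable V := hvi.bdd_mul hβ.continuous.aestronglyMeasurable
    (Eventually.of_forall hβabs)
  have hβGi : Integrable fun x => β x * G x := hG.bdd_mul hβ.continuous.aestronglyMeasurable
    (Eventually.of_forall hβabs)
  have hHi : Integrable H := hβGi.add (hvβi 1)
  have hHG : ∀ᵐ x, H x = β x * G x + vint G x * pderiv 1 β x :=
    hvG.mono fun x hx => by simp only [hH, hx]
  have hH0 : ∀ x, x ∉ Ω → H x = 0 := fun x hx => by
    simp only [hH, hG0 x hx, hv0 x hx]; ring
  have hVs : ∀ x, V x ≠ 0 → x 0 ∈ Icc a b ∧ κ₁ (x 0) + δ ≤ x 1 ∧ x 1 ≤ κ₂ (x 0) - δ := by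
    intro x hx
    have hxΩ : x ∈ Ω := by
      by_contra h
      exact right_ne_zero_of_mul hx (hv0 x h)
    rw [hΩ] at hxΩ
    exact ⟨Ioo_subset_Icc_self hxΩ.1, hβs x (left_ne_zero_of_mul hx)⟩
  -- the scales
  set r : ℕ → ℝ := fun j => 1 / ((j : ℝ) + 1) with hr
  have hrp : ∀ j, 0 < r j := fun j => by positivity
  have hr0 : Tendsto r atTop (𝓝 0) := tendsto_one_div_add_atTop_nhds_zero_nat
  set l : ℕ → ℝ := fun j => 1 + 4 * r j / (b - a) with hl
  have hl1 : ∀ j, 1 ≤ l j := fun j => by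
    have : 0 < 4 * r j / (b - a) := div_pos (by linarith [hrp j]) (by linarith)
    simp only [hl]; linarith
  have hllim : Tendsto l atTop (𝓝 1) := by
    have := ((hr0.const_mul 4).div_const (b - a)).const_add 1
    simpa using this
  have hρlim : Tendsto (fun j => (bump (r j) (hrp j)).rOut) atTop (𝓝 0) := hr0
  have hφ : ∀ᶠ j in atTop, IsTest Ω fun x =>
      moll (bump (r j) (hrp j)) V (dil ((a + b) / 2) (l j) x) := by
    have : Tendsto (fun j => (3 * L₀ + 1 : ℝ) * r j) atTop (𝓝 0) := by
      simpa using hr0.const_mul (3 * L₀ + 1 : ℝ)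
    filter_upwards [this.eventually (gt_mem_nhds hδ)] with j hj
    rw [hΩ]
    exact isTest_moll_dil hab h₁ h₂ hVi hVs (bump (r j) (hrp j)) rfl hj
  have harea := eventually_area_le hab h₁ h₂ hc₁ hc₂ hΩ hΩ'o hΩ'b hΩ' hu₀ hvi hv0 hw hδ hβ hβ0
    hβ1 hβs hε₁0 hvβi hvβε hβε hrp hr0 (fun j => rfl) rfl hφ
  have hlimV := (tendsto_moll_dil (c := (a + b) / 2) hρlim hl1 hllim hVi).eventually
    (gt_mem_nhds hE)
  have hlimH := (tendsto_moll_dil (c := (a + b) / 2) hρlim hl1 hllim hHi).eventually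
    (gt_mem_nhds hE)
  have henergy : ∀ᶠ j in atTop, ∫⁻ x in Ω, ENNReal.ofReal (f (pderiv 1 u₀ x
        + moll (bump (r j) (hrp j)) H (dil ((a + b) / 2) (l j) x)))
      ≤ (∫⁻ x in Ω, ENNReal.ofReal (f (pderiv 1 u₀ x + G x))) + ENNReal.ofReal ε := by
    -- When the limit energy is infinite the upper bound is trivial.
    by_cases hfin : ∫⁻ x in Ω, ENNReal.ofReal (f (pderiv 1 u₀ x + G x)) = ⊤
    · simp [hfin]
    obtain ⟨f1, f2⟩ := b5 hfin
    have f1' : ∫⁻ x in Ω, ENNReal.ofReal (f (H x)) ≠ ⊤ := by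
      have e : ∫⁻ x in Ω, ENNReal.ofReal (f (H x))
          = ∫⁻ x in Ω, ENNReal.ofReal (f (β x * G x + vint G x * pderiv 1 β x)) :=
        lintegral_congr_ae (ae_restrict_of_ae (hHG.mono fun x hx => by simp only [hx]))
      rwa [e]
    have f2' : ∫⁻ x in Ω, ENNReal.ofReal (f (pderiv 1 u₀ x + H x))
        ≤ (∫⁻ x in Ω, ENNReal.ofReal (f (pderiv 1 u₀ x + G x))) + ENNReal.ofReal ε₁ := by
      have e : ∫⁻ x in Ω, ENNReal.ofReal (f (pderiv 1 u₀ x + H x)) = ∫⁻ x in Ω,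
          ENNReal.ofReal (f (pderiv 1 u₀ x + (β x * G x + vint G x * pderiv 1 β x))) :=
        lintegral_congr_ae (ae_restrict_of_ae (hHG.mono fun x hx => by simp only [hx]))
      rwa [e]
    filter_upwards [eventually_energy_moll_dil_le hΩm hΩf hf hf0 htri (measurable_pderiv u₀ 1)
      (norm_pderiv_le hu₀ 1) hρlim hl1 hllim hHi hH0 f1' (c := (a + b) / 2) hE] with j hj
    refine hj.trans ((add_le_add f2' le_rfl).trans ?_)
    rw [add_assoc]
    exact add_le_add le_rfl hEE
  obtain ⟨j, hφj, haj, hVj, hHj, hej⟩ :=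
    (hφ.and (harea.and (hlimV.and (hlimH.and henergy)))).exists
  set ρ := bump (r j) (hrp j) with hρ
  -- The dilation and the mollification commute with ∂_2, and H is the weak derivative of β v on the
  -- whole plane by the product rule.
  have hd : ∀ x, pderiv 1 (fun x => moll ρ V (dil ((a + b) / 2) (l j) x)) x
      = moll ρ H (dil ((a + b) / 2) (l j) x) := by
    intro x
    rw [pderiv_one_comp_dil ((contDiff_moll ρ hVi.locallyIntegrable).differentiable (by simp))]
    exact pderiv_moll_of_weak ρ hVi.locallyIntegrable (subset_univ _)
      fun φ hφ => weak_pderiv_mul hvi hG hvw hβ hφ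
  have htwo : ∀ F F' F'' : Plane → ℝ, AEStronglyMeasurable (fun x => F x - F' x) →
      ∫⁻ x, ‖F x - F' x‖ₑ ≤ ENNReal.ofReal ε₁ → ∫⁻ x, ‖F' x - F'' x‖ₑ ≤ ENNReal.ofReal ε₁ →
      ∫⁻ x, ‖F x - F'' x‖ₑ ≤ ENNReal.ofReal ε := by
    intro F F' F'' hm i1 i2
    refine le_trans ?_ ((add_le_add i1 i2).trans hEE)
    rw [← lintegral_add_left' hm.enorm]
    refine lintegral_mono fun x => ?_
    rw [← sub_add_sub_cancel (F x) (F' x) (F'' x)]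
    exact enorm_add_le _ _
  have hl0 : 0 < l j := by linarith [hl1 j]
  refine ⟨_, hφj, ?_, ?_, ?_, ?_⟩
  · refine htwo _ V _ ?_ hVj.le ?_
    · exact ((integrable_comp_dil _ hl0 (integrable_moll ρ hVi)).sub hVi).aestronglyMeasurable
    · exact (lintegral_congr_ae (hvG.mono fun x hx => by simp only [hV, hx])).trans_le b2
  · simp_rw [hd]
    refine htwo _ H _ ?_ hHj.le ?_
    · exact ((integrable_comp_dil _ hl0 (integrable_moll ρ hHi)).sub hHi).aestronglyMeasurable
    · exact (lintegral_congr_ae (hHG.mono fun x hx => by simp only [hx])).trans_le b3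
  · exact haj.trans (add_le_add le_rfl (ENNReal.ofReal_le_ofReal hε₁L))
  · simp_rw [hd]
    exact hej

end Approximation

/-! ### Lower semicontinuity of the area. -/

section Convergence

theorem isWeakPartial_add_test {u₀ : Plane → ℝ} {L : ℝ≥0} (hu₀ : LipschitzWith L u₀)
    {U : Set Plane} {φ : Plane → ℝ} (hφ : IsTest U φ) (Ω : Set Plane) (i : Fin 2) :
    IsWeakPartial Ω i (fun x => u₀ x + φ x) fun x => pderiv i u₀ x + pderiv i φ x := by
  obtain ⟨D, hD⟩ := lipschitz_of_isTest hφ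
  have h := isWeakPartial_of_lipschitz (hu₀.add hD) Ω i
  have hae : ∀ᵐ x, pderiv i (fun x => u₀ x + φ x) x = pderiv i u₀ x + pderiv i φ x := by
    filter_upwards [hu₀.ae_differentiableAt] with x hx
    exact pderiv_add hx (hφ.smooth.differentiable (by simp) x) i
  refine ⟨h.locallyIntegrable, ?_, fun ψ hψ => ?_⟩
  · exact ((locallyIntegrable_pderiv hu₀ i).add (locallyIntegrable_pderiv hD i)).locallyIntegrableOn Ω
  · rw [h.integral_eq ψ hψ]
    congr 1
    refine integral_congr_ae (ae_restrict_of_ae ?_)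
    filter_upwards [hae] with x hx
    exact congrArg (· * ψ x) hx

/-- The Cauchy–Schwarz inequality in ℝ³ for (p, q, 1) and the unit vector (z, y, √(1 - z² - y²)). -/
theorem le_sqrt_one_add {p q z y : ℝ} (h : z ^ 2 + y ^ 2 ≤ 1) :
    p * z + q * y + √(1 - (z ^ 2 + y ^ 2)) ≤ √(1 + (p ^ 2 + q ^ 2)) := by
  refine Real.le_sqrt_of_sq_le ?_
  set s := √(1 - (z ^ 2 + y ^ 2)) with hs
  have hs2 : s ^ 2 = 1 - (z ^ 2 + y ^ 2) := Real.sq_sqrt (by linarith)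
  have : z ^ 2 + y ^ 2 + s ^ 2 = 1 := by rw [hs2]; ring
  have e : 1 + (p ^ 2 + q ^ 2) = (1 + (p ^ 2 + q ^ 2)) * (z ^ 2 + y ^ 2 + s ^ 2) := by
    rw [this, mul_one]
  rw [e]
  nlinarith [sq_nonneg (p * y - q * z), sq_nonneg (p * s - z), sq_nonneg (q * s - y)]

/-- The dual functional is bounded by the area integral. -/
theorem ofReal_dual_le {Ω' : Set Plane} (hΩ'f : volume Ω' ≠ ⊤) {u g₀ g₁ : Plane → ℝ} {M : ℝ}
    (hu : Continuous u)
    (h₀ : IsWeakPartial Ω' 0 u g₀) (h₁ : IsWeakPartial Ω' 1 u g₁) (hm₀ : Measurable g₀)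
    (hm₁ : Measurable g₁) (hM₀ : ∀ x, ‖g₀ x‖ ≤ M) (hM₁ : ∀ x, ‖g₁ x‖ ≤ M) {η : Plane → Plane}
    (hη : IsTest Ω' η) (hη1 : ∀ x, ‖η x‖ ≤ 1) :
    ENNReal.ofReal (-(∫ x in Ω', u x * divergence η x) + ∫ x in Ω', √(1 - ‖η x‖ ^ 2))
      ≤ ∫⁻ x in Ω', ENNReal.ofReal √(1 + (g₀ x ^ 2 + g₁ x ^ 2)) := by
  have hcoord : ∀ i : Fin 2, IsTest Ω' fun x => η x i := fun i => by
    have hsub : tsupport (fun x => η x i) ⊆ tsupport η :=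
      tsupport_comp_subset (g := fun z : Plane => z i) rfl η
    exact ⟨(contDiff_euclidean.1 hη.smooth) i,
      hη.hasCompactSupport.comp_left (g := fun z : Plane => z i) rfl,
      hsub.trans hη.tsupport_subset⟩
  have hsq : ∀ x, ‖η x‖ ^ 2 = η x 0 ^ 2 + η x 1 ^ 2 := fun x => by
    rw [EuclideanSpace.norm_sq_eq, Fin.sum_univ_two]; simp
  have hηsq : ∀ x, η x 0 ^ 2 + η x 1 ^ 2 ≤ 1 := fun x => by
    rw [← hsq]; exact pow_le_one₀ (norm_nonneg _) (hη1 x)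
  have hui : ∀ i : Fin 2, IntegrableOn (fun x => u x * pderiv i (fun y => η y i) x) Ω' := fun i =>
    ((hu.mul (continuous_pderiv (hcoord i).smooth i)).integrable_of_hasCompactSupport
      (hasCompactSupport_pderiv (hcoord i).hasCompactSupport i).mul_left).integrableOn
  have e1 : -(∫ x in Ω', u x * divergence η x)
      = (∫ x in Ω', g₀ x * η x 0) + ∫ x in Ω', g₁ x * η x 1 := by
    have : ∫ x in Ω', u x * divergence η x
        = (∫ x in Ω', u x * pderiv 0 (fun y => η y 0) x)
          + ∫ x in Ω', u x * pderiv 1 (fun y => η y 1) x := by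
      rw [← integral_add (hui 0) (hui 1)]
      congr 1; ext x
      rw [divergence, Fin.sum_univ_two]; ring
    rw [this, h₀.integral_eq _ (hcoord 0), h₁.integral_eq _ (hcoord 1)]
    ring
  have hηc : Continuous η := hη.smooth.continuous
  have i0 : IntegrableOn (fun x => g₀ x * η x 0) Ω' := by
    refine Measure.integrableOn_of_bounded (M := M * 1) hΩ'f
      (hm₀.mul (hcoord 0).smooth.continuous.measurable).aestronglyMeasurable
      (Eventually.of_forall fun x => ?_)
    rw [norm_mul]
    exact mul_le_mul (hM₀ x) (abs_le_one_of_sq_add_sq (hηsq x)).1 (norm_nonneg _)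
      ((norm_nonneg _).trans (hM₀ x))
  have i1 : IntegrableOn (fun x => g₁ x * η x 1) Ω' := by
    refine Measure.integrableOn_of_bounded (M := M * 1) hΩ'f
      (hm₁.mul (hcoord 1).smooth.continuous.measurable).aestronglyMeasurable
      (Eventually.of_forall fun x => ?_)
    rw [norm_mul]
    exact mul_le_mul (hM₁ x) (abs_le_one_of_sq_add_sq (hηsq x)).2 (norm_nonneg _)
      ((norm_nonneg _).trans (hM₁ x))
  have i2 : IntegrableOn (fun x => √(1 - ‖η x‖ ^ 2)) Ω' := by
    have hc : Continuous fun x => √(1 - ‖η x‖ ^ 2) := by fun_prop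
    refine Measure.integrableOn_of_bounded (M := 1) hΩ'f hc.aestronglyMeasurable
      (Eventually.of_forall fun x => ?_)
    rw [Real.norm_of_nonneg (Real.sqrt_nonneg _), Real.sqrt_le_one]
    linarith [sq_nonneg ‖η x‖]
  set S : Plane → ℝ := fun x => √(1 + (g₀ x ^ 2 + g₁ x ^ 2)) with hS
  have hSm : Measurable S := Real.continuous_sqrt.measurable.comp
    (((hm₀.pow_const 2).add (hm₁.pow_const 2)).const_add 1)
  have hSi : IntegrableOn S Ω' := by
    refine Measure.integrableOn_of_bounded (M := 1 + M + M) hΩ'f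
      hSm.aestronglyMeasurable (Eventually.of_forall fun x => ?_)
    rw [Real.norm_of_nonneg (Real.sqrt_nonneg _)]
    exact (sqrt_le_one_add_abs _ _).trans (add_le_add (add_le_add le_rfl (hM₀ x)) (hM₁ x))
  rw [← ofReal_integral_eq_lintegral_ofReal hSi (Eventually.of_forall fun x => Real.sqrt_nonneg _),
    e1, ← setIntegral_add_add i0 i1 i2]
  refine ENNReal.ofReal_le_ofReal (integral_mono ((i0.add i1).add i2) hSi fun x => ?_)
  simp only [hS]
  rw [hsq]
  exact le_sqrt_one_add (hηsq x)

/-- Lower semicontinuity of the area and an upper bound imply convergence. -/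
theorem tendsto_area {Ω' : Set Plane} {w : Plane → ℝ} {wm : ℕ → Plane → ℝ}
    (hw : IntegrableOn w Ω') (hwm : ∀ m, IntegrableOn (wm m) Ω')
    (hlim : Tendsto (fun m => ∫⁻ x in Ω', ‖wm m x - w x‖ₑ) atTop (𝓝 0))
    {I : ℕ → ℝ≥0∞} {e : ℕ → ℝ≥0∞} (he : Tendsto e atTop (𝓝 0))
    (hup : ∀ m, I m ≤ area Ω' w + e m)
    (hlow : ∀ m, ∀ η : Plane → Plane, IsTest Ω' η → (∀ x, ‖η x‖ ≤ 1) →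
      ENNReal.ofReal (-(∫ x in Ω', wm m x * divergence η x) + ∫ x in Ω', √(1 - ‖η x‖ ^ 2))
        ≤ I m) : Tendsto I atTop (𝓝 (area Ω' w)) := by
  refine tendsto_order.2 ⟨fun c hc => ?_, fun c hc => ?_⟩
  -- A single competitor η exceeds c for w, and for fixed η the dual functional is continuous in L¹
  -- because div η is bounded.
  · rw [area, lt_iSup_iff] at hc
    obtain ⟨η, hc⟩ := hc
    rw [lt_iSup_iff] at hc
    obtain ⟨hη, hc⟩ := hc
    rw [lt_iSup_iff] at hc
    obtain ⟨hη1, hc⟩ := hc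
    have hcoord : ∀ i : Fin 2, ContDiff ℝ ((⊤ : ℕ∞) : WithTop ℕ∞) fun x => η x i :=
      contDiff_euclidean.1 hη.smooth
    have hdc : Continuous (divergence η) :=
      continuous_finsetSum _ fun i _ => continuous_pderiv (hcoord i) i
    have hds : HasCompactSupport (divergence η) := by
      refine HasCompactSupport.of_support_subset_isCompact hη.hasCompactSupport.isCompact
        fun x hx => ?_
      by_contra h
      refine hx (Finset.sum_eq_zero fun i _ => pderiv_eq_zero_of_notMem_tsupport (fun h' => h ?_) i)
      exact tsupport_comp_subset (g := fun z : Plane => z i) rfl η h'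
    obtain ⟨C, hC⟩ := hdc.bounded_above_of_compact_support hds
    have hconv : Tendsto (fun m => ∫ x in Ω', wm m x * divergence η x) atTop
        (𝓝 (∫ x in Ω', w x * divergence η x)) := by
      refine tendsto_integral_of_L1 _
        (hw.mul_bdd hdc.aestronglyMeasurable (Eventually.of_forall hC)).aestronglyMeasurable
        (Eventually.of_forall fun m =>
          (hwm m).mul_bdd hdc.aestronglyMeasurable (Eventually.of_forall hC)) ?_
      have h2 : Tendsto (fun m => (∫⁻ x in Ω', ‖wm m x - w x‖ₑ) * ENNReal.ofReal C) atTop (𝓝 0) := by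
        have := ENNReal.Tendsto.mul_const (b := ENNReal.ofReal C) hlim (Or.inr ENNReal.ofReal_ne_top)
        rwa [zero_mul] at this
      refine tendsto_of_tendsto_of_tendsto_of_le_of_le tendsto_const_nhds h2
        (fun _ => zero_le) fun m => ?_
      rw [← lintegral_mul_const' _ _ ENNReal.ofReal_ne_top]
      refine lintegral_mono fun x => ?_
      rw [← sub_mul, enorm_mul]
      refine mul_le_mul_right ?_ _
      rw [← ofReal_norm]
      exact ENNReal.ofReal_le_ofReal (hC x)
    have h3 := (ENNReal.continuous_ofReal.tendsto _).comp
      (hconv.neg.add_const (∫ x in Ω', √(1 - ‖η x‖ ^ 2)))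
    filter_upwards [h3.eventually (lt_mem_nhds hc)] with m hm
    exact hm.trans_le (hlow m η hη hη1)
  · have h1 : Tendsto (fun m => area Ω' w + e m) atTop (𝓝 (area Ω' w)) := by
      have := Tendsto.const_add (area Ω' w) he
      rwa [add_zero] at this
    filter_upwards [h1.eventually (gt_mem_nhds hc)] with m hm
    exact (hup m).trans_lt hm

end Convergence

/-! ### Integrability of functions in the Orlicz space. -/

section Orlicz

/-- Superlinearity gives t ≤ A t for large t, so l |v| is at most a constant plus A(l |v|), on a set
of finite area. -/
theorem MemOrlicz.integrableOn {A : ℝ → ℝ} (hA : IsNFunction A) {U : Set Plane}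
    (hU : volume U ≠ ⊤) {v : Plane → ℝ} (hv : MemOrlicz A U v) : IntegrableOn v U := by
  obtain ⟨l, hl, hfin⟩ := hv.lintegral_lt_top
  obtain ⟨T, hT⟩ := eventually_atTop.1
    ((hA.tendsto_top.eventually_ge_atTop 1).and (eventually_gt_atTop (0 : ℝ)))
  refine ⟨hv.aestronglyMeasurable, ?_⟩
  have hle : ∀ x, ‖v x‖ₑ ≤ ENNReal.ofReal l⁻¹ *
      (ENNReal.ofReal |T| + ENNReal.ofReal (A (l * |v x|))) := by
    intro x
    have h0 : 0 ≤ l * |v x| := by positivity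
    have h1 : l * |v x| ≤ |T| + A (l * |v x|) := by
      rcases le_total T (l * |v x|) with h | h
      · obtain ⟨h2, h3⟩ := hT _ h
        rw [le_div_iff₀ h3, one_mul] at h2
        linarith [abs_nonneg T]
      · linarith [le_abs_self T, hA.nonneg _ h0]
    rw [← ENNReal.ofReal_add (abs_nonneg _) (hA.nonneg _ h0),
      ← ENNReal.ofReal_mul (inv_pos.2 hl).le, ← ofReal_norm, Real.norm_eq_abs]
    refine ENNReal.ofReal_le_ofReal ?_
    rw [inv_mul_eq_div, le_div_iff₀ hl]
    linarith
  refine lt_of_le_of_lt (lintegral_mono hle) ?_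
  rw [lintegral_const_mul' _ _ ENNReal.ofReal_ne_top, lintegral_add_left measurable_const,
    setLIntegral_const]
  exact ENNReal.mul_lt_top ENNReal.ofReal_lt_top (ENNReal.add_lt_top.2
    ⟨ENNReal.mul_lt_top ENNReal.ofReal_lt_top (lt_top_iff_ne_top.2 hU), hfin⟩)

end Orlicz

end SplitBV

/-! ### The theorem. -/

theorem lemma2p3
    -- the domain `Ω`, normal with respect to the `x_2`-axis, and the enlarged domain
    {a b : ℝ} (hab : a < b) {κ₁ κ₂ : ℝ → ℝ} {L₁ L₂ : ℝ≥0}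
    (hκ₁ : LipschitzOnWith L₁ κ₁ (Icc a b)) (hκ₂ : LipschitzOnWith L₂ κ₂ (Icc a b))
    (hκ : ∀ s ∈ Ioo a b, κ₁ s < κ₂ s)
    {Ω Ω' : Set Plane} (hΩ : Ω = between (Ioo a b) κ₁ κ₂)
    (hΩ'_open : IsOpen Ω') (hΩ'_bdd : Bornology.IsBounded Ω')
    (hΩ' : between (Icc a b) κ₁ κ₂ ⊆ Ω')
    -- the boundary datum
    {u₀ : Plane → ℝ} {L : ℝ≥0} (hu₀ : LipschitzWith L u₀)
    -- the densities
    {A : ℝ → ℝ} (hA : IsNFunction A)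
    {f₂ : ℝ → ℝ} (hf₂ : ConvexOn ℝ univ f₂)
    {b₁ b₂ : ℝ} (hb₁ : 0 < b₁) (hb₂ : 0 ≤ b₂) (hlow : ∀ t, b₁ * A |t| - b₂ ≤ f₂ t)
    {c₃ : ℝ} (hc₃ : 0 < c₃) (htri : ∀ t s, f₂ (t + s) ≤ c₃ * (f₂ t + f₂ s))
    -- the function `w` with the partial derivative `∂₂w`
    {w d₂w : Plane → ℝ} (hw : MemBV Ω w)
    (hd₂w : IsWeakPartial Ω 1 w d₂w) (hd₂w_mem : MemOrlicz A Ω d₂w)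
    (hbdry : VerticalBoundaryCondition Ω w u₀) :
    ∃ wm : ℕ → Plane → ℝ,
      (∀ m, MemAddTest Ω u₀ (wm m)) ∧
      Tendsto (fun m => eLpNorm (extend Ω u₀ (wm m) - extend Ω u₀ w) 1 (volume.restrict Ω'))
        atTop (𝓝 0) ∧
      (∃ g₁ g₂ : ℕ → Plane → ℝ,
        (∀ m, IsWeakPartial Ω' 0 (extend Ω u₀ (wm m)) (g₁ m)) ∧
        (∀ m, IsWeakPartial Ω' 1 (extend Ω u₀ (wm m)) (g₂ m)) ∧
        Tendsto (fun m => ∫⁻ x in Ω', ENNReal.ofReal √(1 + (g₁ m x ^ 2 + g₂ m x ^ 2)))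
          atTop (𝓝 (area Ω' (extend Ω u₀ w)))) ∧
      (∃ d₂ : ℕ → Plane → ℝ,
        (∀ m, IsWeakPartial Ω 1 (wm m) (d₂ m)) ∧
        Tendsto (fun m => energy f₂ Ω (d₂ m)) atTop (𝓝 (energy f₂ Ω d₂w))) := by
  -- Only the values of κ₁ and κ₂ on [a, b] enter. Composed with the projection to [a, b] they
  -- become Lipschitz on the line and constant beyond a and b.
  have hΩ_ext : ∀ I : Set ℝ, I ⊆ Icc a b → between I κ₁ κ₂
      = between I (fun s => κ₁ (max a (min b s))) fun s => κ₂ (max a (min b s)) := by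
    intro I hI
    ext x
    refine and_congr_right fun hx => ?_
    simp only [min_eq_right (hI hx).2, max_eq_right (hI hx).1]
  have hproj : LipschitzWith 1 fun s : ℝ => max a (min b s) :=
    (LipschitzWith.id.const_min b).const_max a
  have hmaps : MapsTo (fun s : ℝ => max a (min b s)) univ (Icc a b) := fun s _ =>
    ⟨le_max_left _ _, max_le hab.le (min_le_left _ _)⟩
  have hext : ∀ {κ : ℝ → ℝ} {C : ℝ≥0}, LipschitzOnWith C κ (Icc a b) → C ≤ max L₁ L₂ →
      LipschitzWith (max L₁ L₂) fun s => κ (max a (min b s)) := by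
    intro κ C h hC
    have := h.comp hproj.lipschitzOnWith hmaps
    rw [mul_one, lipschitzOnWith_univ] at this
    exact this.weaken hC
  have h₁ := hext hκ₁ (le_max_left _ _)
  have h₂ := hext hκ₂ (le_max_right _ _)
  have hidem : ∀ s : ℝ, max a (min b s) = max a (min b (max a (min b s))) := fun s => by
    rw [min_eq_right (hmaps (mem_univ s)).2, max_eq_right (hmaps (mem_univ s)).1]
  rw [hΩ_ext _ Ioo_subset_Icc_self] at hΩ
  rw [hΩ_ext _ subset_rfl] at hΩ'
  have hκ' : ∀ s ∈ Ioo a b, κ₁ (max a (min b s)) < κ₂ (max a (min b s)) := fun s hs => by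
    rw [min_eq_right hs.2.le, max_eq_right hs.1.le]; exact hκ s hs
  have hΩo : IsOpen Ω := by rw [hΩ]; exact isOpen_between h₁.continuous h₂.continuous isOpen_Ioo
  have hΩm := hΩo.measurableSet
  have hΩf : volume Ω ≠ ⊤ := by
    rw [hΩ]; exact (volume_between_lt_top h₁.continuous h₂.continuous).ne
  have hΩ'f : volume Ω' ≠ ⊤ := hΩ'_bdd.measure_lt_top.ne
  obtain ⟨G, hGm, hG, hG0, hGd, hwG, hGs⟩ := exists_primitive ⟨_, h₁⟩ ⟨_, h₂⟩ hκ' hΩ hu₀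
    hw.integrable (hd₂w_mem.integrableOn hA hΩf) hd₂w hbdry
  set v : Plane → ℝ := Ω.indicator (vint G) with hv
  -- With v extended by zero, ŵ = u₀ + v almost everywhere on the plane, so all estimates refer to
  -- the single function v.
  have hw' : ∀ᵐ x, extend Ω u₀ w x = u₀ x + v x := by
    filter_upwards [(ae_restrict_iff' hΩm).1 hwG] with x hx
    by_cases h : x ∈ Ω
    · rw [SplitBV.extend, if_pos h, hv, indicator_of_mem h, ← hx h]; ring
    · rw [SplitBV.extend, if_neg h, hv, indicator_of_notMem h, add_zero]
  have hvi : Integrable v := by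
    rw [hv, integrable_indicator_iff hΩm]
    exact (integrable_vint h₁.continuous h₂.continuous hΩ hGm hG hG0 hGs).integrableOn
  have hf0 := density_nonneg hA hb₁ hlow hc₃ htri
  have hε : ∀ m : ℕ, (0 : ℝ) < 1 / ((m : ℝ) + 1) := fun m => by positivity
  choose φ hφ hφv hφG hφa hφe using fun m => exists_test_approx hab h₁ h₂
    (fun s => congrArg κ₁ (hidem s)) (fun s => congrArg κ₂ (hidem s)) hΩ hΩ'_open hΩ'_bdd hΩ' hu₀
    hGm hG hG0 hGs hv hw' hf₂ hf0 htri (hε m)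
  have hε0 : Tendsto (fun m : ℕ => ENNReal.ofReal (1 / ((m : ℝ) + 1))) atTop (𝓝 0) := by
    rw [← ENNReal.ofReal_zero]
    exact (ENNReal.continuous_ofReal.tendsto 0).comp tendsto_one_div_add_atTop_nhds_zero_nat
  have hextm : ∀ m, extend Ω u₀ (fun x => u₀ x + φ m x) = fun x => u₀ x + φ m x := by
    intro m
    ext x
    by_cases h : x ∈ Ω
    · rw [SplitBV.extend, if_pos h]
    · rw [SplitBV.extend, if_neg h, (hφ m).eq_zero h, add_zero]
  have hL1 : Tendsto (fun m => ∫⁻ x in Ω', ‖u₀ x + φ m x - extend Ω u₀ w x‖ₑ) atTop (𝓝 0) := by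
    refine tendsto_of_tendsto_of_tendsto_of_le_of_le tendsto_const_nhds hε0
      (fun _ => zero_le) fun m => ?_
    refine (setLIntegral_le_lintegral _ _).trans (le_trans (le_of_eq ?_) (hφv m))
    refine lintegral_congr_ae ?_
    filter_upwards [hw'] with x hx
    rw [hx, add_sub_add_left_eq_sub]
  have hu₀i : IntegrableOn u₀ Ω' :=
    (hu₀.continuous.locallyIntegrable.integrableOn_isCompact hΩ'_bdd.isCompact_closure).mono_set
      subset_closure
  refine ⟨fun m x => u₀ x + φ m x, fun m => ⟨φ m, hφ m, fun x _ => rfl⟩, ?_, ?_, ?_⟩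
  · simp_rw [eLpNorm_one_eq_lintegral_enorm, hextm]
    exact hL1
  · refine ⟨fun m x => pderiv 0 u₀ x + pderiv 0 (φ m) x, fun m x => pderiv 1 u₀ x + pderiv 1 (φ m) x,
      fun m => ?_, fun m => ?_, ?_⟩
    · rw [hextm]; exact isWeakPartial_add_test hu₀ (hφ m) Ω' 0
    · rw [hextm]; exact isWeakPartial_add_test hu₀ (hφ m) Ω' 1
    · refine tendsto_area (wm := fun m x => u₀ x + φ m x) ?_ (fun m => ?_) hL1 hε0 hφa
        fun m η hη hη1 => ?_
      · exact (hu₀i.add hvi.integrableOn).congr (ae_restrict_of_ae (hw'.mono fun x hx => hx.symm))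
      · exact hu₀i.add ((hφ m).smooth.continuous.integrable_of_hasCompactSupport
          (hφ m).hasCompactSupport).integrableOn
      · obtain ⟨D, hD⟩ := lipschitz_of_isTest (hφ m)
        exact ofReal_dual_le (M := L + D) hΩ'f (hu₀.continuous.add (hφ m).smooth.continuous)
          (isWeakPartial_add_test hu₀ (hφ m) Ω' 0) (isWeakPartial_add_test hu₀ (hφ m) Ω' 1)
          ((measurable_pderiv _ _).add (measurable_pderiv _ _))
          ((measurable_pderiv _ _).add (measurable_pderiv _ _))
          (fun x => (norm_add_le _ _).trans
            (add_le_add (norm_pderiv_le hu₀ 0 x) (norm_pderiv_le hD 0 x)))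
          (fun x => (norm_add_le _ _).trans
            (add_le_add (norm_pderiv_le hu₀ 1 x) (norm_pderiv_le hD 1 x))) hη hη1
  · refine ⟨fun m x => pderiv 1 u₀ x + pderiv 1 (φ m) x,
      fun m => isWeakPartial_add_test hu₀ (hφ m) Ω 1, ?_⟩
    -- On Ω the derivative ∂_2 w is ∂_2 u₀ + G almost everywhere, the form in which the energy bound
    -- was obtained.
    have he : energy f₂ Ω d₂w = ∫⁻ x in Ω, ENNReal.ofReal (f₂ (pderiv 1 u₀ x + G x)) := by
      refine lintegral_congr_ae ?_
      filter_upwards [hGd] with x hx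
      rw [hx, add_sub_cancel]
    rw [he]
    refine tendsto_lintegral_of_upper_bound (μ := volume.restrict Ω)
      (d := fun m x => pderiv 1 u₀ x + pderiv 1 (φ m) x) (d₀ := fun x => pderiv 1 u₀ x + G x)
      (continuousOn_univ.1 (hf₂.continuousOn isOpen_univ)) (fun m => ?_) ?_ ?_ hε0 hφe
    · exact ((measurable_pderiv _ _).add (measurable_pderiv _ _)).aestronglyMeasurable
    · exact ((measurable_pderiv _ _).add hGm).aestronglyMeasurable
    · refine tendsto_of_tendsto_of_tendsto_of_le_of_le tendsto_const_nhds hε0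
        (fun _ => zero_le) fun m => ?_
      refine (setLIntegral_le_lintegral _ _).trans (le_trans (le_of_eq ?_) (hφG m))
      simp_rw [add_sub_add_left_eq_sub]
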